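/- \textbf{Setting.} Let $\mathbf R^4_1$ be $\mathbf R^4$ with the Lorentz product $\langle x,y\rangle=-x_0y_0+x_1y_1+x_2y_2+x_3y_3$, and let $S^3_1=\{x:\langle x,x\rangle=1\}$ be de Sitter 3-space. Identify $\mathbf R^4_1$ with the Hermitian $2\times2$ matrices by $x\leftrightarrow\begin{pmatrix}x_0+x_3&x_1+ix_2\\x_1-ix_2&x_0-x_3\end{pmatrix}$, and put $e_3=\mathrm{diag}(1,-1)$ and $\Delta^*=\{z\in\mathbf C:0<|z|<1\}$. A $C^\infty$ map $f:\Delta^*\to S^3_1$ is a \emph{CMC-1 face} if (i) there is an open dense $W\subset\Delta^*$ on which $f$ is a spacelike immersion of constant mean curvature $1$; (ii) for every singular point $p$ (a point where the induced metric $ds^2$ degenerates) there are a neighbourhood $U$ of $p$ and a $C^1$ function $\lambda:U\cap W\to(0,\infty)$ such that $\lambda\,ds^2$ extends to a $C^1$ Riemannian metric on $U$; (iii) $df\neq0$ everywhere. The complex structure of $\Delta^*$ is the one induced by $f$: $f$ is conformal on $W$, and the mean curvature is $1$ with respect to the unit normal $\nu$ for which $(f_u,f_v,\nu,f)$ is a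 positively oriented basis of $\mathbf R^4$ ($z=u+iv$). A \emph{holomorphic null lift} of $f$ is a holomorphic immersion $F$ of the universal cover $\widetilde\Delta^*$ into $\mathrm{SL}_2\mathbf C$ with $\det(F^{-1}dF)=0$ and $f=Fe_3F^*$; its \emph{secondary Gauss map} is the meromorphic function $g$ with $F^{-1}dF=\begin{pmatrix}g&-g^2\\1&-g\end{pmatrix}\omega$. The end $z=0$ of $f$ is \emph{$g$-regular} if the Schwarzian derivative $S_z(g)=(g''/g')'-\tfrac12(g''/g')^2$, for the secondary Gauss map $g$ of a holomorphic null lift of $f$, is near $z=0$ meromorphic in $z$ with at most a pole of order $2$ at $0$ (an end with $g$ constant is counted as $g$-regular). If $\tau$ is the deck transformation of the counterclockwise loop about $0$, then $F\circ\tau=F\rho$ with $\rho\in\mathrm{SU}_{1,1}=\{A\in\mathrm{SL}_2\mathbf C:Ae_3A^*=e_3\}$; the end is \emph{hyperbolic} if $\rho$ is conjugate in $\mathrm{SU}_{1,1}$ to $\pm\begin{pmatrix}\cosh t&\sinh t\\\sinh t&\cosh t\end{pmatrix}$ for some $t>0$. \textbf{Corollary (Characterization of hyperbolic ends).} Let $f:\Delta^*\to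 S^3_1$ be a CMC-1 face whose end $z=0$ is $g$-regular. Then the end is hyperbolic if and only if every ray emanating from the origin meets the singular set of $f$ infinitely many times in every neighbourhood of the origin; that is, for all $\theta\in\mathbf R$ and $r>0$ there are infinitely many $t\in(0,r)$ such that $te^{i\theta}$ is a singular point of $f$. -/

import Mathlib

namespace CMC1Face

noncomputable section

open Complex Matrix
open scoped ContDiff

/-! ### Lorentz-Minkowski space and de Sitter space -/

/-- The Lorentz inner product `-x₀y₀ + x₁y₁ + x₂y₂ + x₃y₃` on `ℝ⁴₁`. -/
def lorentz (x y : Fin 4 → ℝ) : ℝ :=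
  -(x 0 * y 0) + x 1 * y 1 + x 2 * y 2 + x 3 * y 3

/-- De Sitter 3-space `S³₁`. -/
def deSitter : Set (Fin 4 → ℝ) := {x | lorentz x x = 1}

/-- The identification of `ℝ⁴₁` with the Hermitian `2 × 2` matrices. -/
def herm (x : Fin 4 → ℝ) : Matrix (Fin 2) (Fin 2) ℂ :=
  !![(x 0 : ℂ) + x 3, (x 1 : ℂ) + I * x 2;
     (x 1 : ℂ) - I * x 2, (x 0 : ℂ) - x 3]

def e₃ : Matrix (Fin 2) (Fin 2) ℂ := !![1, 0; 0, -1]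

/-- The punctured unit disk `Δ* = {0 < |z| < 1}`; the end is the puncture `z = 0`. -/
def puncturedDisk : Set ℂ := {z | 0 < ‖z‖ ∧ ‖z‖ < 1}

/-! ### First and second fundamental forms, mean curvature

`z = u + i v`; the real direction `1` is `∂/∂u` and the real direction `I` is `∂/∂v`. -/

/-- The derivative of `f` in the real direction `a`. -/
def dir (f : ℂ → Fin 4 → ℝ) (a z : ℂ) : Fin 4 → ℝ := fderiv ℝ f z a

/-- The coefficients `ds²(a, b)` of the first fundamental form. -/
def first (f : ℂ → Fin 4 → ℝ) (a b z : ℂ) : ℝ := lorentz (dir f a z) (dir f b z)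

/-- The coefficients of the second fundamental form with respect to the normal vector `ν`. -/
def second (f : ℂ → Fin 4 → ℝ) (ν : Fin 4 → ℝ) (a b z : ℂ) : ℝ :=
  lorentz (dir (dir f b) a z) ν

/-- The determinant `EG - F²` of the first fundamental form. -/
def firstDet (f : ℂ → Fin 4 → ℝ) (z : ℂ) : ℝ :=
  first f 1 1 z * first f I I z - first f 1 I z ^ 2

/-- `f` is a spacelike immersion at `z`: the induced metric is positive definite. -/
def IsSpacelikeAt (f : ℂ → Fin 4 → ℝ) (z : ℂ) : Prop :=
  0 < first f 1 1 z ∧ 0 < firstDet f z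

/-- `f` is conformal at `z`. -/
def IsConformalPt (f : ℂ → Fin 4 → ℝ) (z : ℂ) : Prop :=
  first f 1 1 z = first f I I z ∧ first f 1 I z = 0

/-- `ν` is the unit (timelike) normal vector of `f` in `S³₁` at `z` that is compatible with the
orientation of the domain: `(f_u, f_v, ν)` followed by the position vector `f` is a positively
oriented basis of `ℝ⁴`. -/
structure IsUnitNormal (f : ℂ → Fin 4 → ℝ) (z : ℂ) (ν : Fin 4 → ℝ) : Prop where
  unit : lorentz ν ν = -1
  tangent_deSitter : lorentz ν (f z) = 0
  normal_u : lorentz ν (dir f 1 z) = 0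
  normal_v : lorentz ν (dir f I z) = 0
  oriented : 0 < (Matrix.of ![dir f 1 z, dir f I z, ν, f z]).det

/-- The mean curvature `(E N - 2 F M + G L) / (2 (EG - F²))` with respect to `ν`. -/
def meanCurvature (f : ℂ → Fin 4 → ℝ) (ν : Fin 4 → ℝ) (z : ℂ) : ℝ :=
  (first f 1 1 z * second f ν I I z - 2 * first f 1 I z * second f ν 1 I z
    + first f I I z * second f ν 1 1 z) / (2 * firstDet f z)

/-! ### CMC-1 faces -/

/-- The singular set: the points of `Δ*` at which the induced metric degenerates. -/
def singularSet (f : ℂ → Fin 4 → ℝ) : Set ℂ := {z ∈ puncturedDisk | firstDet f z = 0}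

/-- `f : Δ* → S³₁` is a CMC-1 face (only the values of `f` on `Δ*` matter), where `Δ*` carries
the complex structure induced by `f`: `f` is conformal where it is a spacelike immersion, and the
unit normal with respect to which the mean curvature is `1` is the one given by the orientation. -/
structure IsCMC1Face (f : ℂ → Fin 4 → ℝ) : Prop where
  maps : ∀ z ∈ puncturedDisk, f z ∈ deSitter
  smooth : ContDiffOn ℝ ∞ f puncturedDisk
  /-- There is an open dense `W ⊆ Δ*` such that `f` restricted to `W` is a spacelike (conformal)
  CMC-1 immersion, and near each singular point some positive `C¹` multiple `l · ds²`, defined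
  on `U ∩ W`, extends to a `C¹` Riemannian metric `a du² + 2 b du dv + c dv²` on `U`. -/
  exists_dense : ∃ W : Set ℂ, IsOpen W ∧ W ⊆ puncturedDisk ∧ puncturedDisk ⊆ closure W ∧
    (∀ z ∈ W, IsSpacelikeAt f z ∧ IsConformalPt f z ∧
      ∃ ν, IsUnitNormal f z ν ∧ meanCurvature f ν z = 1) ∧
    ∀ p ∈ singularSet f, ∃ U : Set ℂ, IsOpen U ∧ p ∈ U ∧ U ⊆ puncturedDisk ∧
      ∃ l a b c : ℂ → ℝ,
        ContDiffOn ℝ 1 l (U ∩ W) ∧ (∀ z ∈ U ∩ W, 0 < l z) ∧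
        ContDiffOn ℝ 1 a U ∧ ContDiffOn ℝ 1 b U ∧ ContDiffOn ℝ 1 c U ∧
        (∀ z ∈ U, 0 < a z ∧ 0 < a z * c z - b z ^ 2) ∧
        ∀ z ∈ U ∩ W, a z = l z * first f 1 1 z ∧ b z = l z * first f 1 I z ∧
          c z = l z * first f I I z
  differential_ne_zero : ∀ z ∈ puncturedDisk, fderiv ℝ f z ≠ 0

/-! ### Holomorphic null lifts on the universal cover

The universal cover of `Δ*` is the left half-plane with covering map `w ↦ exp w`; the deck
transformation of the counterclockwise loop about the puncture is `w ↦ w + 2πi`. -/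

def univCover : Set ℂ := {w | w.re < 0}

def deck (w : ℂ) : ℂ := w + 2 * Real.pi * I

/-- The entrywise derivative. -/
def matDeriv (F : ℂ → Matrix (Fin 2) (Fin 2) ℂ) (w : ℂ) : Matrix (Fin 2) (Fin 2) ℂ :=
  Matrix.of fun i j => deriv (fun ζ => F ζ i j) w

/-- `F` is a holomorphic null lift of `f`: a holomorphic null immersion of the universal cover
into `SL₂ℂ` with `f = F e₃ F*`. -/
structure IsNullLift (f : ℂ → Fin 4 → ℝ) (F : ℂ → Matrix (Fin 2) (Fin 2) ℂ) : Prop where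
  holomorphic : ∀ i j, DifferentiableOn ℂ (fun w => F w i j) univCover
  det_eq_one : ∀ w ∈ univCover, (F w).det = 1
  null : ∀ w ∈ univCover, ((F w)⁻¹ * matDeriv F w).det = 0
  immersion : ∀ w ∈ univCover, matDeriv F w ≠ 0
  lift : ∀ w ∈ univCover, herm (f (exp w)) = F w * e₃ * (F w)ᴴ

/-- The secondary Gauss map `g` of `F`, read off from
`F⁻¹ dF = (g, -g²; 1, -g) ω`. -/
def secondaryGauss (F : ℂ → Matrix (Fin 2) (Fin 2) ℂ) (w : ℂ) : ℂ :=
  ((F w)⁻¹ * matDeriv F w) 0 0 / ((F w)⁻¹ * matDeriv F w) 1 0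

/-- The derivation `d/dz` on the universal cover: `z = exp w`, so `d/dz = exp(-w) d/dw`. -/
def dz (h : ℂ → ℂ) (w : ℂ) : ℂ := exp (-w) * deriv h w

/-- The Schwarzian derivative `S_z(h) = (h''/h')' - (h''/h')² / 2`, with `' = d/dz`. -/
def schwarzian (h : ℂ → ℂ) (w : ℂ) : ℂ :=
  dz (fun ζ => dz (dz h) ζ / dz h ζ) w - (dz (dz h) w / dz h w) ^ 2 / 2

/-- The end is `g`-regular: near the puncture, the Schwarzian derivative `S(g) = p(z) dz²` of the
secondary Gauss map `g` (of a holomorphic null lift) is given by a function `p` that is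
meromorphic at `0` with at most a pole of order `2`. The identity is required where `g` is finite
with `g' ≠ 0`, a dense set unless `g` is constant; a constant `g` counts as regular. -/
def IsGRegular (f : ℂ → Fin 4 → ℝ) : Prop :=
  ∃ F, IsNullLift f F ∧ ∃ p : ℂ → ℂ, MeromorphicAt p 0 ∧ (-2 : ℤ) ≤ meromorphicOrderAt p 0 ∧
    ∃ r : ℝ, 0 < r ∧ r < 1 ∧ ∀ w : ℂ, ‖exp w‖ < r →
      AnalyticAt ℂ (secondaryGauss F) w → deriv (secondaryGauss F) w ≠ 0 →
        schwarzian (secondaryGauss F) w = p (exp w)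

/-! ### Monodromy -/

/-- `SU(1,1)`. -/
def SU11 : Set (Matrix (Fin 2) (Fin 2) ℂ) := {A | A.det = 1 ∧ A * e₃ * Aᴴ = e₃}

def Lambdah (t : ℝ) : Matrix (Fin 2) (Fin 2) ℂ :=
  !![(Real.cosh t : ℂ), (Real.sinh t : ℂ); (Real.sinh t : ℂ), (Real.cosh t : ℂ)]

/-- `A` is conjugate in `SU(1,1)` to `Λ_h(t)` or `-Λ_h(t)` for some `t > 0`. -/
def IsHyperbolicMatrix (A : Matrix (Fin 2) (Fin 2) ℂ) : Prop :=
  A ∈ SU11 ∧ ∃ P ∈ SU11, ∃ t : ℝ, 0 < t ∧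
    (P⁻¹ * A * P = Lambdah t ∨ P⁻¹ * A * P = -Lambdah t)

/-- The end is hyperbolic: the monodromy matrix `ρ` (given by `F ∘ τ = F ρ`) of a holomorphic null
lift `F` about the puncture is hyperbolic. -/
def IsHyperbolicEnd (f : ℂ → Fin 4 → ℝ) : Prop :=
  ∃ F, IsNullLift f F ∧ ∃ ρ, (∀ w ∈ univCover, F (deck w) = F w * ρ) ∧ IsHyperbolicMatrix ρ

end

end CMC1Face

namespace CMC1Face

noncomputable section

open Complex Matrix Filter Topology

/-! ### Functions on a left half-plane -/

/-! Work on the universal cover with z = exp w, and let A = F⁻¹ dF/dw. Since det F = 1 and F is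
null, A is nilpotent, and A is nonzero because F is an immersion. The induced metric is conformal
with factor (|A₀₁| - |A₁₀|)² / |z|², so exp w is singular exactly when |g| = 1. Equivalently A* e₃ A
= 0, a condition that survives changes of basis once e₃ is replaced by C* e₃ C
(`IsNullLift.exp_mem_singularSet_iff`, `norm_eq_iff_conjTranspose_mul`). Only the line spanned by A
matters, so A may be replaced by any convenient scalar multiple.

The convenient multiple is B = (g, -g²; 1, -g) / g', with ' = d/dw. Each entry is a quadratic
polynomial in g divided by g', so it solves X''' + 2TX' + T'X = 0 with T the Schwarzian derivative
of g in w. Regularity of the end makes T = z² S_z(g) - 1/2 bounded near the puncture. Grönwall's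
inequality then does two things: it removes the singularities of B at poles and branch points of g,
and it bounds B by an exponential in |Re w|, that is, by a power of 1/|z|. If g is constant, A is a
scalar function times a constant matrix, and an exponential replaces the scalar. Either way a
`TameFrame` results, whose monodromy is conjugation by ρ ∈ SU(1,1).

Bring ρ to normal form by a constant matrix. Entries with a multiplier become exp((κ + m)w) q(z)
with q holomorphic and q(0) ≠ 0 (`exists_normalForm`), so the quotient G = B₀₀ / B₁₀, which is g in
the new basis, is explicit whenever B₁₀ and B₀₀ are not identically zero. In the elliptic case G =
exp(δw) p(z) with δ real, and singular means |G| = 1: if δ ≠ 0 this fails near the puncture, and if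
δ = 0 it fails on a suitable ray, as p is not a constant of modulus 1. In the parabolic case G is a
nonzero multiple of w / i plus a meromorphic germ in z, and singular means Im G = 0: a ray on which
both terms push Im G to the same side has no singular points near 0. In the hyperbolic case G =
exp((n + iτ)w) p(z) with τ > 0, and singular means Re G = 0: along every ray the phase τ log|z|
turns without end while that of p converges, so Re G changes sign infinitely often.

The degenerate cases in which everything would be singular are excluded by the density of the
regular points of f. -/

/-- The left half-plane `Re w < R`. -/
def leftHalfPlane (R : ℝ) : Set ℂ := {w | w.re < R}

theorem isOpen_leftHalfPlane (R : ℝ) : IsOpen (leftHalfPlane R) :=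
  isOpen_lt continuous_re continuous_const

theorem convex_leftHalfPlane (R : ℝ) : Convex ℝ (leftHalfPlane R) :=
  convex_halfSpace_re_lt R

theorem leftHalfPlane_mono {R S : ℝ} (h : R ≤ S) : leftHalfPlane R ⊆ leftHalfPlane S :=
  fun _ hw => lt_of_lt_of_le hw h

@[simp] theorem deck_re (w : ℂ) : (deck w).re = w.re := by
  simp [deck]

@[simp] theorem exp_deck (w : ℂ) : exp (deck w) = exp w := by
  simp [deck, exp_add, exp_two_pi_mul_I]

theorem deck_mem {R : ℝ} {w : ℂ} : deck w ∈ leftHalfPlane R ↔ w ∈ leftHalfPlane R := by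
  simp [leftHalfPlane]

theorem hasDerivAt_deck (w : ℂ) : HasDerivAt deck 1 w := by
  exact (hasDerivAt_id w).add_const (2 * Real.pi * I : ℂ)

/-- At most exponential growth on the strip `0 ≤ Im w ≤ 2π` towards `Re w = -∞`. -/
def ExpGrowth (X : ℂ → ℂ) (R : ℝ) : Prop :=
  ∃ C K : ℝ, 0 ≤ C ∧ 0 ≤ K ∧ ∀ w : ℂ, w.re < R → 0 ≤ w.im → w.im ≤ 2 * Real.pi →
    ‖X w‖ ≤ C * Real.exp (K * |w.re|)

theorem ExpGrowth.add {X Y : ℂ → ℂ} {R : ℝ} (hX : ExpGrowth X R) (hY : ExpGrowth Y R) :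
    ExpGrowth (fun w => X w + Y w) R := by
  obtain ⟨C, K, hC, hK, h⟩ := hX
  obtain ⟨C', K', hC', hK', h'⟩ := hY
  refine ⟨C + C', max K K', by positivity, by positivity, fun w h1 h2 h3 => ?_⟩
  have e1 : Real.exp (K * |w.re|) ≤ Real.exp (max K K' * |w.re|) :=
    Real.exp_le_exp.2 (mul_le_mul_of_nonneg_right (le_max_left _ _) (abs_nonneg _))
  have e2 : Real.exp (K' * |w.re|) ≤ Real.exp (max K K' * |w.re|) :=
    Real.exp_le_exp.2 (mul_le_mul_of_nonneg_right (le_max_right _ _) (abs_nonneg _))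
  calc ‖X w + Y w‖ ≤ ‖X w‖ + ‖Y w‖ := norm_add_le _ _
    _ ≤ C * Real.exp (K * |w.re|) + C' * Real.exp (K' * |w.re|) :=
        add_le_add (h w h1 h2 h3) (h' w h1 h2 h3)
    _ ≤ C * Real.exp (max K K' * |w.re|) + C' * Real.exp (max K K' * |w.re|) := by gcongr
    _ = _ := by ring

theorem ExpGrowth.mul {X Y : ℂ → ℂ} {R : ℝ} (hX : ExpGrowth X R) (hY : ExpGrowth Y R) :
    ExpGrowth (fun w => X w * Y w) R := by
  obtain ⟨C, K, hC, hK, h⟩ := hX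
  obtain ⟨C', K', hC', hK', h'⟩ := hY
  refine ⟨C * C', K + K', by positivity, by positivity, fun w h1 h2 h3 => ?_⟩
  calc ‖X w * Y w‖ = ‖X w‖ * ‖Y w‖ := norm_mul _ _
    _ ≤ (C * Real.exp (K * |w.re|)) * (C' * Real.exp (K' * |w.re|)) :=
        mul_le_mul (h w h1 h2 h3) (h' w h1 h2 h3) (norm_nonneg _) (by positivity)
    _ = _ := by rw [add_mul, Real.exp_add]; ring

theorem expGrowth_const (c : ℂ) (R : ℝ) : ExpGrowth (fun _ => c) R :=
  ⟨‖c‖, 0, norm_nonneg _, le_rfl, fun w _ _ _ => by simp⟩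

theorem expGrowth_cexp (c : ℂ) (R : ℝ) : ExpGrowth (fun w => exp (c * w)) R := by
  refine ⟨Real.exp (‖c‖ * (2 * Real.pi)), ‖c‖, by positivity, norm_nonneg _, fun w _ h2 h3 => ?_⟩
  rw [norm_exp, ← Real.exp_add, Real.exp_le_exp]
  calc (c * w).re ≤ ‖c * w‖ := re_le_norm _
    _ = ‖c‖ * ‖w‖ := norm_mul _ _
    _ ≤ ‖c‖ * (|w.re| + |w.im|) := by gcongr; exact norm_le_abs_re_add_abs_im w
    _ ≤ ‖c‖ * (|w.re| + 2 * Real.pi) := by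
        gcongr; rw [abs_of_nonneg h2]; exact h3
    _ = _ := by ring

theorem expGrowth_id (R : ℝ) : ExpGrowth (fun w => w) R := by
  refine ⟨1 + 2 * Real.pi, 1, by positivity, zero_le_one, fun w _ h2 h3 => ?_⟩
  have h4 : |w.re| + 1 ≤ Real.exp (1 * |w.re|) := by
    rw [one_mul]; exact Real.add_one_le_exp _
  have h0 := abs_nonneg w.re
  have h5 : (1 : ℝ) ≤ Real.exp (1 * |w.re|) := by linarith
  calc ‖w‖ ≤ |w.re| + |w.im| := norm_le_abs_re_add_abs_im w
    _ ≤ |w.re| + 2 * Real.pi := by rw [abs_of_nonneg h2]; linarith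
    _ ≤ Real.exp (1 * |w.re|) + 2 * Real.pi * Real.exp (1 * |w.re|) := by
        have := mul_le_mul_of_nonneg_left h5 (by positivity : 0 ≤ 2 * Real.pi)
        linarith
    _ = _ := by ring

/-! ### Descent of periodic functions to the puncture -/

theorem periodic_of_deck {Y : ℂ → ℂ} {R : ℝ}
    (hp : ∀ w ∈ leftHalfPlane R, Y (deck w) = Y w) (n : ℤ) :
    ∀ w ∈ leftHalfPlane R, Y (w + n * (2 * Real.pi * I)) = Y w := by
  induction n using Int.induction_on with
  | zero => intro w _; simp
  | succ n ih =>
    intro w hw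
    have h : w + ((n : ℤ) * (2 * Real.pi * I) : ℂ) ∈ leftHalfPlane R := by
      simpa [leftHalfPlane] using hw
    rw [← ih w hw, ← hp _ h]
    congr 1
    simp only [deck]; push_cast; ring
  | pred n ih =>
    intro w hw
    have h : w + (((-n - 1 : ℤ) : ℂ) * (2 * Real.pi * I) : ℂ) ∈ leftHalfPlane R := by
      simpa [leftHalfPlane] using hw
    rw [← ih w hw, ← hp _ h]
    congr 1
    simp only [deck]; push_cast; ring

/-- A bounded holomorphic function on a left half-plane with period `2πi` is a holomorphic function
of `exp w`. -/
theorem exists_analyticAt_of_bounded_periodic {Y : ℂ → ℂ} {R C : ℝ}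
    (hY : DifferentiableOn ℂ Y (leftHalfPlane R))
    (hp : ∀ w ∈ leftHalfPlane R, Y (deck w) = Y w)
    (hb : ∀ w ∈ leftHalfPlane R, ‖Y w‖ ≤ C) :
    ∃ k : ℂ → ℂ, AnalyticAt ℂ k 0 ∧ ∀ w ∈ leftHalfPlane R, Y w = k (exp w) := by
  classical
  -- The substitution w = I t moves the puncture to the cusp i∞. The cutoff depends only on Im t, so
  -- the default value 0 keeps the real period 2π.
  set f : ℂ → ℂ := fun t => if (I * t).re < R then Y (I * t) else 0 with hf
  have hper : Function.Periodic f ((2 * Real.pi : ℝ) : ℂ) := by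
    intro t
    have h1 : I * (t + ((2 * Real.pi : ℝ) : ℂ)) = deck (I * t) := by
      simp only [deck]; push_cast; ring
    simp only [hf, h1, deck_re]
    split_ifs with h
    · exact hp _ h
    · rfl
  have hpi : (0 : ℝ) < 2 * Real.pi := by positivity
  have hev : ∀ᶠ t : ℂ in comap im atTop, -t.im < R := by
    filter_upwards [(tendsto_comap (f := im) (x := atTop)).eventually
      (eventually_gt_atTop (-R))] with t ht
    linarith
  have hdiff : ∀ᶠ t : ℂ in comap im atTop, DifferentiableAt ℂ f t := by
    filter_upwards [hev] with t ht
    have hmem : I * t ∈ leftHalfPlane R := by simpa [leftHalfPlane] using ht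
    have h1 : DifferentiableAt ℂ (fun t => Y (I * t)) t :=
      ((hY _ hmem).differentiableAt ((isOpen_leftHalfPlane R).mem_nhds hmem)).comp t
        (differentiableAt_id.const_mul I)
    refine h1.congr_of_eventuallyEq ?_
    have : ∀ᶠ s : ℂ in 𝓝 t, (I * s).re < R :=
      (isOpen_lt (by fun_prop) continuous_const).mem_nhds (by simpa using ht)
    filter_upwards [this] with s hs
    simp only [hf, if_pos hs]
  have hbd : BoundedAtFilter (comap im atTop) f := by
    refine Asymptotics.IsBigO.of_bound C ?_
    filter_upwards [hev] with t ht
    have hmem : I * t ∈ leftHalfPlane R := by simpa [leftHalfPlane] using ht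
    have h2 : (I * t).re < R := hmem
    simp only [hf, if_pos h2]
    simpa using hb _ hmem
  have hd0 := Function.Periodic.differentiableAt_cuspFunction_zero hpi hper hdiff hbd
  have hd1 := Function.Periodic.eventually_differentiableAt_cuspFunction_nhds_ne_zero hpi hper hdiff
  refine ⟨Function.Periodic.cuspFunction (2 * Real.pi) f,
    analyticAt_of_differentiable_on_punctured_nhds_of_continuousAt hd1 hd0.continuousAt, ?_⟩
  intro w hw
  have h1 := Function.Periodic.eq_cuspFunction hpi.ne' hper (-I * w)
  have h2 : Function.Periodic.qParam (2 * Real.pi) (-I * w) = exp w := by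
    unfold Function.Periodic.qParam
    congr 1
    have : (Real.pi : ℂ) ≠ 0 := by exact_mod_cast Real.pi_ne_zero
    push_cast
    field_simp
    linear_combination (-w) * I_sq
  rw [h2] at h1
  have h3 : I * (-I * w) = w := by linear_combination (-w) * I_sq
  rw [h1]
  simp only [hf, h3]
  exact (if_pos (show w.re < R from hw)).symm

/-- A holomorphic function of moderate growth with period `2πi` is meromorphic in `exp w`. -/
theorem exists_analyticAt_of_expGrowth_periodic {Y : ℂ → ℂ} {R : ℝ}
    (hY : DifferentiableOn ℂ Y (leftHalfPlane R)) (hg : ExpGrowth Y R)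
    (hp : ∀ w ∈ leftHalfPlane R, Y (deck w) = Y w) :
    ∃ (n : ℕ) (k : ℂ → ℂ), AnalyticAt ℂ k 0 ∧ ∃ S ≤ R, ∀ w ∈ leftHalfPlane S,
      exp (n * w) * Y w = k (exp w) := by
  obtain ⟨C, K, hC, hK, hb⟩ := hg
  -- The factor exp(nw) = zⁿ with n ≥ K absorbs the growth exp(K|Re w|) without disturbing
  -- periodicity.
  obtain ⟨n, hn⟩ := exists_nat_ge K
  refine ⟨n, ?_⟩
  have hS : min R 0 ≤ R := min_le_left _ _
  have hper : ∀ w ∈ leftHalfPlane (min R 0), exp (n * deck w) * Y (deck w) = exp (n * w) * Y w := by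
    intro w hw
    simp only [hp w (leftHalfPlane_mono hS hw)]
    congr 1
    rw [exp_nat_mul, exp_nat_mul, exp_deck]
  have hbdd : ∀ w ∈ leftHalfPlane (min R 0), ‖exp (n * w) * Y w‖ ≤ C := by
    intro w hw
    -- Growth is known only on a fundamental strip, so w is translated there by a multiple of the
    -- period.
    set m : ℤ := -⌊w.im / (2 * Real.pi)⌋ with hm
    set w' : ℂ := w + m * (2 * Real.pi * I) with hw'
    have hpi : (0 : ℝ) < 2 * Real.pi := by positivity
    have hre : w'.re = w.re := by simp [hw']
    have him : w'.im = w.im - ⌊w.im / (2 * Real.pi)⌋ * (2 * Real.pi) := by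
      simp [hw', hm]; ring
    have h1 : 0 ≤ w'.im := by
      rw [him]
      have := Int.floor_le (w.im / (2 * Real.pi))
      rw [le_div_iff₀ hpi] at this
      linarith
    have h2 : w'.im ≤ 2 * Real.pi := by
      rw [him]
      have := (Int.lt_floor_add_one (w.im / (2 * Real.pi))).le
      rw [div_le_iff₀ hpi] at this
      linarith
    have h0 : w.re < 0 := lt_of_lt_of_le hw (min_le_right _ _)
    have h3 := hb w' (by rw [hre]; exact lt_of_lt_of_le hw hS) h1 h2
    rw [hw', periodic_of_deck hp m w (leftHalfPlane_mono hS hw), ← hw', hre, abs_of_neg h0] at h3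
    calc ‖exp (n * w) * Y w‖ = Real.exp (n * w.re) * ‖Y w‖ := by
          rw [norm_mul, norm_exp]; simp
      _ ≤ Real.exp (n * w.re) * (C * Real.exp (K * -w.re)) := by gcongr
      _ = C * Real.exp ((n - K) * w.re) := by
          rw [mul_left_comm, ← Real.exp_add]; congr 2; ring
      _ ≤ C * 1 := by
          gcongr
          rw [Real.exp_le_one_iff]
          exact mul_nonpos_of_nonneg_of_nonpos (by linarith) h0.le
      _ = C := mul_one C
  obtain ⟨k, hk, hk'⟩ := exists_analyticAt_of_bounded_periodic (R := min R 0) (C := C)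
    (Y := fun w => exp (n * w) * Y w)
    ((Differentiable.differentiableOn (by fun_prop)).mul (hY.mono (leftHalfPlane_mono hS)))
    hper hbdd
  exact ⟨k, hk, _, hS, hk'⟩

/-! ### Identity theorem and normal form of functions with a multiplier. -/

theorem analyticOnNhd_of_differentiableOn {X : ℂ → ℂ} {R : ℝ}
    (hX : DifferentiableOn ℂ X (leftHalfPlane R)) : AnalyticOnNhd ℂ X (leftHalfPlane R) :=
  hX.analyticOnNhd (isOpen_leftHalfPlane R)

/-- Identity theorem: a holomorphic function that vanishes far to the left vanishes. -/
theorem eq_zero_of_eq_zero_left {X : ℂ → ℂ} {R S : ℝ}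
    (hX : DifferentiableOn ℂ X (leftHalfPlane R)) (h : ∀ w ∈ leftHalfPlane S, X w = 0) :
    ∀ w ∈ leftHalfPlane R, X w = 0 := by
  have hm : ((min R S - 1 : ℝ) : ℂ) ∈ leftHalfPlane R := by
    have := min_le_left R S
    simp only [leftHalfPlane, Set.mem_ofPred_eq, ofReal_re]; linarith
  have hm' : ((min R S - 1 : ℝ) : ℂ) ∈ leftHalfPlane S := by
    have := min_le_right R S
    simp only [leftHalfPlane, Set.mem_ofPred_eq, ofReal_re]; linarith
  exact (analyticOnNhd_of_differentiableOn hX).eqOn_zero_of_preconnected_of_eventuallyEq_zero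
    (convex_leftHalfPlane R).isPreconnected hm
    (by filter_upwards [(isOpen_leftHalfPlane S).mem_nhds hm'] with w hw using h w hw)

theorem tendsto_exp_of_left {P : ℂ → Prop} (h : ∀ᶠ z in 𝓝 (0 : ℂ), P z) :
    ∃ S : ℝ, ∀ w ∈ leftHalfPlane S, P (exp w) := by
  obtain ⟨ε, hε, h⟩ := Metric.eventually_nhds_iff.1 h
  refine ⟨Real.log ε, fun w hw => h ?_⟩
  rw [dist_zero_right, norm_exp]
  exact (Real.lt_log_iff_exp_lt hε).1 hw

/-- A holomorphic function of moderate growth that is multiplied by `exp(2πiκ)` under the deck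
transformation is `exp((κ + m)w) h(exp w)` with `m` an integer, `h` holomorphic and `h 0 ≠ 0`. -/
theorem exists_normalForm {X : ℂ → ℂ} {R : ℝ} {κ : ℂ}
    (hX : DifferentiableOn ℂ X (leftHalfPlane R)) (hg : ExpGrowth X R)
    (hp : ∀ w ∈ leftHalfPlane R, X (deck w) = exp (2 * Real.pi * I * κ) * X w)
    (hne : ∃ w ∈ leftHalfPlane R, X w ≠ 0) :
    ∃ (m : ℤ) (h : ℂ → ℂ), AnalyticAt ℂ h 0 ∧ h 0 ≠ 0 ∧ ∃ S ≤ R, ∀ w ∈ leftHalfPlane S,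
      X w = exp ((κ + m) * w) * h (exp w) := by
  -- The factor exp(-κw) cancels the multiplier and leaves a periodic function.
  obtain ⟨n, k, hk, S, hS, hkS⟩ := exists_analyticAt_of_expGrowth_periodic
    (Y := fun w => exp (-κ * w) * X w) (R := R)
    ((Differentiable.differentiableOn (by fun_prop)).mul hX) ((expGrowth_cexp _ _).mul hg) (by
      intro w hw
      simp only [hp w hw]
      rw [← mul_assoc, ← exp_add]
      congr 2
      simp only [deck]; ring)
  have hXk : ∀ w ∈ leftHalfPlane S, X w = exp ((κ - n) * w) * k (exp w) := by
    intro w hw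
    rw [← hkS w hw, ← mul_assoc, ← mul_assoc, ← exp_add, ← exp_add]
    rw [show (κ - n) * w + n * w + -κ * w = 0 by ring, exp_zero, one_mul]
  -- A zero germ would force X = 0 by the identity theorem; otherwise the order j of k at 0 is moved
  -- into the integer exponent, which becomes j - n.
  by_cases hk0 : ∀ᶠ z in 𝓝 (0 : ℂ), k z = 0
  · obtain ⟨T, hT⟩ := tendsto_exp_of_left hk0
    obtain ⟨w, hw, hwne⟩ := hne
    refine absurd (eq_zero_of_eq_zero_left (S := min S T) hX (fun v hv => ?_) w hw) hwne
    rw [hXk v (leftHalfPlane_mono (min_le_left _ _) hv),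
      hT v (leftHalfPlane_mono (min_le_right _ _) hv), mul_zero]
  · obtain ⟨j, h, hh, hh0, hj⟩ := hk.exists_eventuallyEq_pow_smul_nonzero_iff.2 hk0
    obtain ⟨T, hT⟩ := tendsto_exp_of_left hj
    refine ⟨-n + j, h, hh, hh0, min S T, (min_le_left _ _).trans hS, fun w hw => ?_⟩
    rw [hXk w (leftHalfPlane_mono (min_le_left _ _) hw),
      hT w (leftHalfPlane_mono (min_le_right _ _) hw), sub_zero, smul_eq_mul, ← mul_assoc,
      ← exp_nat_mul, ← exp_add]
    congr 2
    push_cast; ring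

end

end CMC1Face

namespace CMC1Face

noncomputable section

open Complex Matrix Filter Topology

/-! ### The linear system satisfied by quadratic polynomials in `g` divided by `g'` -/

/-- The linear system `X' = Y`, `Y' = Z - T X`, `Z' = -T Y` at the point `w`; it is equivalent to
`X''' + 2 T X' + T' X = 0`. -/
structure SolvesAt (T X Y Z : ℂ → ℂ) (w : ℂ) : Prop where
  fst : HasDerivAt X (Y w) w
  snd : HasDerivAt Y (Z w - T w * X w) w
  trd : HasDerivAt Z (-(T w * Y w)) w

/-- Grönwall's inequality along the segment: in the sup norm of (X, Y, Z) the linear system has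
operator norm at most 1 + M. -/
theorem norm_le_of_solvesAt_segment {T X Y Z : ℂ → ℂ} {M : ℝ} (hM : 0 ≤ M) {u v : ℂ}
    (hS : ∀ t : ℝ, 0 ≤ t → t ≤ 1 → SolvesAt T X Y Z (u + t * (v - u)))
    (hT : ∀ t : ℝ, 0 ≤ t → t ≤ 1 → ‖T (u + t * (v - u))‖ ≤ M) :
    ‖(X v, Y v, Z v)‖ ≤ ‖(X u, Y u, Z u)‖ * Real.exp ((1 + M) * ‖v - u‖) := by
  set p : ℝ → ℂ := fun t => u + t * (v - u) with hp
  have hpd : ∀ t : ℝ, HasDerivAt p (v - u) t := by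
    intro t
    have h := ((hasDerivAt_id t).ofReal_comp.mul_const (v - u)).const_add u
    simpa [hp] using h
  set V : ℝ → ℂ × ℂ × ℂ := fun t => (X (p t), Y (p t), Z (p t)) with hV
  set V' : ℝ → ℂ × ℂ × ℂ := fun t => (v - u) •
    (Y (p t), Z (p t) - T (p t) * X (p t), -(T (p t) * Y (p t))) with hV'
  have hd : ∀ t : ℝ, 0 ≤ t → t ≤ 1 → HasDerivAt V (V' t) t := by
    intro t h0 h1
    have hs := hS t h0 h1
    exact (hs.fst.scomp t (hpd t)).prodMk
      ((hs.snd.scomp t (hpd t)).prodMk (hs.trd.scomp t (hpd t)))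
  have hbound : ∀ t : ℝ, 0 ≤ t → t ≤ 1 →
      ‖V' t‖ ≤ ((1 + M) * ‖v - u‖) * ‖V t‖ + 0 := by
    intro t h0 h1
    have hTt := hT t h0 h1
    change ‖T (p t)‖ ≤ M at hTt
    have hX : ‖X (p t)‖ ≤ ‖V t‖ := norm_fst_le (V t)
    have hYZ : ‖((Y (p t), Z (p t)) : ℂ × ℂ)‖ ≤ ‖V t‖ := norm_snd_le (V t)
    have hY : ‖Y (p t)‖ ≤ ‖V t‖ := (norm_fst_le ((Y (p t), Z (p t)) : ℂ × ℂ)).trans hYZ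
    have hZ : ‖Z (p t)‖ ≤ ‖V t‖ := (norm_snd_le ((Y (p t), Z (p t)) : ℂ × ℂ)).trans hYZ
    have hn : 0 ≤ ‖V t‖ := norm_nonneg _
    have hTX : ‖T (p t) * X (p t)‖ ≤ M * ‖V t‖ := by
      rw [norm_mul]; exact mul_le_mul hTt hX (norm_nonneg _) hM
    have hTY : ‖T (p t) * Y (p t)‖ ≤ M * ‖V t‖ := by
      rw [norm_mul]; exact mul_le_mul hTt hY (norm_nonneg _) hM
    have hMn : 0 ≤ M * ‖V t‖ := by positivity
    have h2 : ‖((Y (p t), Z (p t) - T (p t) * X (p t), -(T (p t) * Y (p t))) : ℂ × ℂ × ℂ)‖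
        ≤ (1 + M) * ‖V t‖ := by
      refine norm_prod_le_iff.2 ⟨?_, norm_prod_le_iff.2 ⟨?_, ?_⟩⟩
      · dsimp only; linarith
      · dsimp only; linarith [norm_sub_le (Z (p t)) (T (p t) * X (p t))]
      · dsimp only; rw [norm_neg]; linarith
    simp only [hV', norm_smul, add_zero]
    calc ‖v - u‖ * _ ≤ ‖v - u‖ * ((1 + M) * ‖V t‖) := by gcongr
      _ = _ := by ring
  have key := norm_le_gronwallBound_of_norm_deriv_right_le (f := V) (f' := V') (a := 0) (b := 1)
    (δ := ‖V 0‖) (K := (1 + M) * ‖v - u‖) (ε := 0)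
    (fun t ht => (hd t ht.1 ht.2).continuousAt.continuousWithinAt)
    (fun t ht => (hd t ht.1 ht.2.le).hasDerivWithinAt) le_rfl
    (fun t ht => hbound t ht.1 ht.2.le) 1 ⟨zero_le_one, le_rfl⟩
  rw [gronwallBound_ε0] at key
  simpa [hV, hp] using key

/-- Solutions are bounded on a small circle about c by compactness, and integrating radially inward
costs at most exp((1 + M) r) because T stays bounded at c. -/
theorem exists_bound_of_solvesAt_punctured {T X Y Z : ℂ → ℂ} {M : ℝ} (hM : 0 ≤ M) {c : ℂ}
    (hS : ∀ᶠ w in 𝓝[≠] c, SolvesAt T X Y Z w) (hT : ∀ᶠ w in 𝓝[≠] c, ‖T w‖ ≤ M) :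
    ∃ C, ∀ᶠ w in 𝓝[≠] c, ‖(X w, Y w, Z w)‖ ≤ C := by
  obtain ⟨ε, hε, h⟩ := Metric.eventually_nhds_iff.1 (eventually_nhdsWithin_iff.1 (hS.and hT))
  set r := ε / 2 with hr
  have hr0 : 0 < r := by positivity
  have hgood : ∀ w : ℂ, w ≠ c → ‖w - c‖ ≤ r → SolvesAt T X Y Z w ∧ ‖T w‖ ≤ M := by
    intro w hw hwr
    exact h (by rw [dist_eq_norm]; linarith) hw
  have hcont : ContinuousOn (fun w => (X w, Y w, Z w)) (Metric.sphere c r) := by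
    intro w hw
    have hwr : ‖w - c‖ = r := by simpa [dist_eq_norm] using hw
    have hwc : w ≠ c := by rintro rfl; simp at hwr; linarith
    have hs := (hgood w hwc hwr.le).1
    exact (hs.fst.continuousAt.prodMk
      (hs.snd.continuousAt.prodMk hs.trd.continuousAt)).continuousWithinAt
  obtain ⟨C, hC⟩ := (isCompact_sphere c r).exists_bound_of_continuousOn hcont
  refine ⟨C * Real.exp ((1 + M) * r), ?_⟩
  rw [eventually_nhdsWithin_iff]
  filter_upwards [Metric.ball_mem_nhds c hr0] with w hw hwc
  have hwr : ‖w - c‖ < r := by simpa [dist_eq_norm] using hw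
  have hn : 0 < ‖w - c‖ := norm_pos_iff.2 (sub_ne_zero.2 hwc)
  -- The radial projection of w to the circle; the segment from u to w never meets c.
  set u : ℂ := c + (r / ‖w - c‖ : ℝ) * (w - c) with hu
  have hun : ‖u - c‖ = r := by
    simp only [hu, add_sub_cancel_left, norm_mul, norm_real, Real.norm_eq_abs]
    rw [abs_of_pos (by positivity)]; field_simp
  have hseg : ∀ t : ℝ, 0 ≤ t → t ≤ 1 →
      u + t * (w - u) ≠ c ∧ ‖u + t * (w - u) - c‖ ≤ r := by
    intro t h0 h1
    have e : u + t * (w - u) - c = ((1 - t) * (r / ‖w - c‖) + t : ℝ) * (w - c) := by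
      simp only [hu]; push_cast; ring
    have hpos : 0 < (1 - t) * (r / ‖w - c‖) + t := by
      have hq : 1 ≤ r / ‖w - c‖ := by rw [one_le_div hn]; exact hwr.le
      nlinarith
    have e2 : ‖u + t * (w - u) - c‖ = (1 - t) * r + t * ‖w - c‖ := by
      rw [e, norm_mul, norm_real, Real.norm_eq_abs, abs_of_pos hpos]; field_simp
    constructor
    · intro hh
      rw [hh, sub_self, norm_zero] at e2
      nlinarith
    · rw [e2]; nlinarith
  have h1 := norm_le_of_solvesAt_segment hM
    (fun t h0 h1 => (hgood _ (hseg t h0 h1).1 (hseg t h0 h1).2).1)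
    (fun t h0 h1 => (hgood _ (hseg t h0 h1).1 (hseg t h0 h1).2).2)
  have h2 : ‖(X u, Y u, Z u)‖ ≤ C := hC u (by simpa [dist_eq_norm] using hun)
  have h3 : ‖w - u‖ ≤ r := by
    have : w - u = ((1 - r / ‖w - c‖ : ℝ) : ℂ) * (w - c) := by
      simp only [hu]; push_cast; ring
    rw [this, norm_mul, norm_real, Real.norm_eq_abs, abs_of_nonpos, neg_sub, sub_mul, one_mul,
      div_mul_cancel₀ _ hn.ne']
    · linarith
    · have hq : 1 ≤ r / ‖w - c‖ := by rw [one_le_div hn]; exact hwr.le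
      linarith
  calc _ ≤ _ := h1
    _ ≤ C * Real.exp ((1 + M) * r) := by
      have : 0 ≤ C := (norm_nonneg _).trans h2
      gcongr

/-- A function that is holomorphic and bounded near each point of an open set, except perhaps at
the point itself, extends holomorphically: the extension is given by the punctured limits. -/
theorem analyticAt_limUnder {X : ℂ → ℂ} {c : ℂ} (hd : ∀ᶠ w in 𝓝[≠] c, DifferentiableAt ℂ X w)
    {C : ℝ} (hb : ∀ᶠ w in 𝓝[≠] c, ‖X w‖ ≤ C) :
    AnalyticAt ℂ (fun w => limUnder (𝓝[≠] w) X) c := by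
  have hlim : ∀ w, DifferentiableAt ℂ X w → limUnder (𝓝[≠] w) X = X w := fun w hw =>
    (hw.continuousAt.tendsto.mono_left nhdsWithin_le_nhds).limUnder_eq
  have heq : ∀ᶠ w in 𝓝[≠] c, limUnder (𝓝[≠] w) X = X w := hd.mono hlim
  have ht := tendsto_limUnder_of_differentiable_on_punctured_nhds_of_bounded_under hd
    (Filter.isBoundedUnder_of_eventually_le (a := C + ‖X c‖)
      (hb.mono fun w hw => norm_sub_le_of_le hw le_rfl))
  refine analyticAt_of_differentiable_on_punctured_nhds_of_continuousAt ?_ ?_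
  · have h1 : ∀ᶠ w in 𝓝[≠] c, ∀ᶠ v in 𝓝 w, limUnder (𝓝[≠] v) X = X v :=
      (eventually_eventually_nhdsWithin.2 heq).mp (eventually_nhdsWithin_of_forall fun w hw h => by
        rwa [IsOpen.nhdsWithin_eq isOpen_compl_singleton hw] at h)
    filter_upwards [hd, h1] with w hw h1w using hw.congr_of_eventuallyEq h1w
  · exact continuousAt_iff_punctured_nhds.2 (ht.congr' (heq.mono fun w hw => hw.symm))

/-- The derivative of an analytic function is continuous, so a differential equation valid off c
passes to the limit at c. -/
theorem hasDerivAt_of_eventually_hasDerivAt {X Y : ℂ → ℂ} {c : ℂ} (hX : AnalyticAt ℂ X c)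
    (hY : ContinuousAt Y c) (h : ∀ᶠ w in 𝓝[≠] c, HasDerivAt X (Y w) w) : HasDerivAt X (Y c) c := by
  have h1 : Tendsto (deriv X) (𝓝[≠] c) (𝓝 (deriv X c)) :=
    hX.deriv.continuousAt.tendsto.mono_left nhdsWithin_le_nhds
  have h2 : Tendsto (deriv X) (𝓝[≠] c) (𝓝 (Y c)) :=
    (hY.tendsto.mono_left nhdsWithin_le_nhds).congr' (h.mono fun w hw => hw.deriv.symm)
  rw [← tendsto_nhds_unique h1 h2]
  exact hX.differentiableAt.hasDerivAt

/-- Isolated singularities of solutions of the linear system are removable. -/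
theorem exists_solvesAt_extension {T X Y Z : ℂ → ℂ} {M R : ℝ} (hM : 0 ≤ M)
    (hTc : ContinuousOn T (leftHalfPlane R)) (hT : ∀ w ∈ leftHalfPlane R, ‖T w‖ ≤ M)
    (hS : ∀ c ∈ leftHalfPlane R, ∀ᶠ w in 𝓝[≠] c, SolvesAt T X Y Z w) :
    ∃ X' Y' Z' : ℂ → ℂ, (∀ w ∈ leftHalfPlane R, SolvesAt T X' Y' Z' w) ∧
      ∀ w, SolvesAt T X Y Z w → X' w = X w := by
  have hlim : ∀ {U : ℂ → ℂ} {w : ℂ}, DifferentiableAt ℂ U w → limUnder (𝓝[≠] w) U = U w :=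
    fun hw => (hw.continuousAt.tendsto.mono_left nhdsWithin_le_nhds).limUnder_eq
  have hlX : ∀ w, SolvesAt T X Y Z w → limUnder (𝓝[≠] w) X = X w :=
    fun w hw => hlim hw.fst.differentiableAt
  have hlY : ∀ w, SolvesAt T X Y Z w → limUnder (𝓝[≠] w) Y = Y w :=
    fun w hw => hlim hw.snd.differentiableAt
  have hlZ : ∀ w, SolvesAt T X Y Z w → limUnder (𝓝[≠] w) Z = Z w :=
    fun w hw => hlim hw.trd.differentiableAt
  refine ⟨fun w => limUnder (𝓝[≠] w) X, fun w => limUnder (𝓝[≠] w) Y,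
    fun w => limUnder (𝓝[≠] w) Z, fun c hc => ?_, hlX⟩
  have hnc : leftHalfPlane R ∈ 𝓝 c := (isOpen_leftHalfPlane R).mem_nhds hc
  have hSc := hS c hc
  obtain ⟨C, hC⟩ := exists_bound_of_solvesAt_punctured hM hSc
    (by filter_upwards [nhdsWithin_le_nhds hnc] with w hw using hT w hw)
  have hCX : ∀ᶠ w in 𝓝[≠] c, ‖X w‖ ≤ C := hC.mono fun w hw => (norm_fst_le _).trans hw
  have hC2 : ∀ᶠ w in 𝓝[≠] c, ‖((Y w, Z w) : ℂ × ℂ)‖ ≤ C :=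
    hC.mono fun w hw => (norm_snd_le (X w, Y w, Z w)).trans hw
  have hCY : ∀ᶠ w in 𝓝[≠] c, ‖Y w‖ ≤ C := hC2.mono fun w hw => (norm_fst_le _).trans hw
  have hCZ : ∀ᶠ w in 𝓝[≠] c, ‖Z w‖ ≤ C := hC2.mono fun w hw => (norm_snd_le _).trans hw
  have aX := analyticAt_limUnder (hSc.mono fun w hw => hw.fst.differentiableAt) hCX
  have aY := analyticAt_limUnder (hSc.mono fun w hw => hw.snd.differentiableAt) hCY
  have aZ := analyticAt_limUnder (hSc.mono fun w hw => hw.trd.differentiableAt) hCZ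
  have hTcc : ContinuousAt T c := hTc.continuousAt hnc
  have hev : ∀ᶠ w in 𝓝[≠] c, (∀ᶠ v in 𝓝 w, SolvesAt T X Y Z v) :=
    (eventually_eventually_nhdsWithin.2 hSc).mp (eventually_nhdsWithin_of_forall fun w hw h => by
      rwa [IsOpen.nhdsWithin_eq isOpen_compl_singleton hw] at h)
  have hev' : ∀ᶠ w in 𝓝[≠] c, SolvesAt T (fun w => limUnder (𝓝[≠] w) X)
      (fun w => limUnder (𝓝[≠] w) Y) (fun w => limUnder (𝓝[≠] w) Z) w := by
    filter_upwards [hev] with w hw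
    have h := hw.self_of_nhds
    constructor
    · simp only [hlY w h]
      exact h.fst.congr_of_eventuallyEq (hw.mono hlX)
    · simp only [hlX w h, hlZ w h]
      exact h.snd.congr_of_eventuallyEq (hw.mono hlY)
    · simp only [hlY w h]
      exact h.trd.congr_of_eventuallyEq (hw.mono hlZ)
  exact ⟨hasDerivAt_of_eventually_hasDerivAt aX aY.continuousAt (hev'.mono fun w hw => hw.fst),
    hasDerivAt_of_eventually_hasDerivAt aY
      (Y := fun w => limUnder (𝓝[≠] w) Z - T w * limUnder (𝓝[≠] w) X)
      (aZ.continuousAt.sub (hTcc.mul aX.continuousAt)) (hev'.mono fun w hw => hw.snd),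
    hasDerivAt_of_eventually_hasDerivAt aZ
      (Y := fun w => -(T w * limUnder (𝓝[≠] w) Y))
      (hTcc.mul aY.continuousAt).neg (hev'.mono fun w hw => hw.trd)⟩

/-- Integrate horizontally from the line Re w = R - 1. The initial values are bounded only over the
compact range 0 ≤ Im w ≤ 2π, which is why the bound concerns a strip; the shift by 1 keeps that line
inside the open half-plane. -/
theorem expGrowth_of_solvesAt {T X Y Z : ℂ → ℂ} {M R : ℝ} (hM : 0 ≤ M)
    (hT : ∀ w ∈ leftHalfPlane R, ‖T w‖ ≤ M)
    (hS : ∀ w ∈ leftHalfPlane R, SolvesAt T X Y Z w) : ExpGrowth X (R - 1) := by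
  have hcont : ContinuousOn (fun y : ℝ => (X ((R - 1 : ℝ) + y * I), Y ((R - 1 : ℝ) + y * I),
      Z ((R - 1 : ℝ) + y * I))) (Set.Icc 0 (2 * Real.pi)) := by
    intro y _
    have hs := hS ((R - 1 : ℝ) + y * I) (by simp [leftHalfPlane])
    have hl : ContinuousAt (fun y : ℝ => ((R - 1 : ℝ) : ℂ) + y * I) y := by fun_prop
    have hX := ContinuousAt.comp (f := fun y : ℝ => ((R - 1 : ℝ) : ℂ) + y * I)
      hs.fst.continuousAt hl
    have hY := ContinuousAt.comp (f := fun y : ℝ => ((R - 1 : ℝ) : ℂ) + y * I)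
      hs.snd.continuousAt hl
    have hZ := ContinuousAt.comp (f := fun y : ℝ => ((R - 1 : ℝ) : ℂ) + y * I)
      hs.trd.continuousAt hl
    exact (hX.prodMk (hY.prodMk hZ)).continuousWithinAt
  obtain ⟨C, hC⟩ := isCompact_Icc.exists_bound_of_continuousOn hcont
  have hC0 : 0 ≤ C := (norm_nonneg _).trans (hC 0 ⟨le_rfl, by positivity⟩)
  refine ⟨C * Real.exp ((1 + M) * |R - 1|), 1 + M, by positivity, by positivity,
    fun w h1 h2 h3 => ?_⟩
  set u : ℂ := (R - 1 : ℝ) + w.im * I with hu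
  have hdiff : w - u = ((w.re - (R - 1) : ℝ) : ℂ) := by
    apply Complex.ext <;> simp [hu]
  have hseg : ∀ t : ℝ, 0 ≤ t → t ≤ 1 → u + t * (w - u) ∈ leftHalfPlane R := by
    intro t h0 h1'
    rw [hdiff, ← ofReal_mul]
    simp only [leftHalfPlane, Set.mem_ofPred_eq, add_re, ofReal_re, hu, mul_re, ofReal_im, I_re,
      I_im]
    nlinarith
  have key := norm_le_of_solvesAt_segment hM (fun t h0 h1 => hS _ (hseg t h0 h1))
    (fun t h0 h1 => hT _ (hseg t h0 h1))
  have hu' := hC w.im ⟨h2, h3⟩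
  have hn : ‖w - u‖ ≤ |R - 1| + |w.re| := by
    rw [hdiff, norm_real, Real.norm_eq_abs]
    have := abs_sub w.re (R - 1)
    linarith
  calc ‖X w‖ ≤ ‖(X w, Y w, Z w)‖ := norm_fst_le (X w, Y w, Z w)
    _ ≤ _ := key
    _ ≤ C * Real.exp ((1 + M) * (|R - 1| + |w.re|)) := by gcongr
    _ = _ := by rw [mul_add, Real.exp_add]; ring

/-- For a polynomial `r` of degree at most two, `r(g) / g'` satisfies the linear system whose
coefficient is the Schwarzian derivative of `g`. -/
theorem exists_solvesAt_quadratic_div_deriv (g T : ℂ → ℂ) (α β γ : ℂ) :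
    ∃ Y Z : ℂ → ℂ, ∀ w, AnalyticAt ℂ g w → deriv g w ≠ 0 →
      deriv (fun v => deriv (deriv g) v / deriv g v) w
        - (deriv (deriv g) w / deriv g w) ^ 2 / 2 = T w →
      SolvesAt T (fun v => (α * g v ^ 2 + β * g v + γ) / deriv g v) Y Z w := by
  -- With P = g''/g' these are X' and X'' + TX, written without T. All that is used about T is the
  -- Riccati equation P' = T + P²/2.
  refine ⟨fun v => 2 * α * g v + β
        - deriv (deriv g) v / deriv g v * ((α * g v ^ 2 + β * g v + γ) / deriv g v),
      fun v => 2 * α * deriv g v - (2 * α * g v + β) * (deriv (deriv g) v / deriv g v)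
        + (deriv (deriv g) v / deriv g v) ^ 2 / 2 * ((α * g v ^ 2 + β * g v + γ) / deriv g v),
      fun w hg hg' hT => ?_⟩
  set P : ℂ → ℂ := fun v => deriv (deriv g) v / deriv g v with hP
  have d0 : HasDerivAt g (deriv g w) w := hg.differentiableAt.hasDerivAt
  have d1 : HasDerivAt (deriv g) (deriv (deriv g) w) w := hg.deriv.differentiableAt.hasDerivAt
  have d2 : HasDerivAt P (deriv P w) w :=
    (hg.deriv.deriv.differentiableAt.div hg.deriv.differentiableAt hg').hasDerivAt
  have hdP : deriv P w = T w + P w ^ 2 / 2 := by rw [← hT]; ring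
  have hg2 : deriv (deriv g) w = P w * deriv g w := by simp only [hP]; field_simp
  have dR : HasDerivAt (fun v => α * g v ^ 2 + β * g v + γ)
      ((2 * α * g w + β) * deriv g w) w := by
    convert! (((d0.pow 2).const_mul α).add (d0.const_mul β)).add_const γ using 1
    push_cast; ring
  have dL : HasDerivAt (fun v => 2 * α * g v + β) (2 * α * deriv g w) w :=
    (d0.const_mul (2 * α)).add_const β
  have dX : HasDerivAt (fun v => (α * g v ^ 2 + β * g v + γ) / deriv g v)
      (2 * α * g w + β - P w * ((α * g w ^ 2 + β * g w + γ) / deriv g w)) w := by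
    convert! dR.div d1 hg' using 1
    rw [hg2]; field_simp
  refine ⟨dX, ?_, ?_⟩
  · convert! dL.sub (d2.mul dX) using 1
    rw [hdP]; ring
  · convert! ((d1.const_mul (2 * α)).sub (dL.mul d2)).add (((d2.pow 2).div_const 2).mul dX) using 1
    simp only [Pi.pow_apply]
    rw [hdP, hg2]; push_cast; field_simp; ring

end

end CMC1Face

namespace CMC1Face

noncomputable section

open Complex Matrix Filter Topology
open scoped ContDiff

/-! ### The Maurer-Cartan form of a null lift -/

/-- The coefficient `F⁻¹ dF/dw` of the Maurer-Cartan form of `F`. -/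
def maurerCartan (F : ℂ → Matrix (Fin 2) (Fin 2) ℂ) (w : ℂ) : Matrix (Fin 2) (Fin 2) ℂ :=
  (F w)⁻¹ * matDeriv F w

theorem inv_eq_of_det_eq_one {A : Matrix (Fin 2) (Fin 2) ℂ} (h : A.det = 1) :
    A⁻¹ = !![A 1 1, -A 0 1; -A 1 0, A 0 0] := by
  rw [Matrix.inv_def, h, adjugate_fin_two]; simp

theorem isUnit_det_of_eq_one {A : Matrix (Fin 2) (Fin 2) ℂ} (h : A.det = 1) : IsUnit A.det := by
  rw [h]; exact isUnit_one

/-- `2 × 2` matrices of square zero: trace and determinant vanish. -/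
structure IsNilpotentTwo (A : Matrix (Fin 2) (Fin 2) ℂ) : Prop where
  trace_eq : A 1 1 = -A 0 0
  det_eq : A 0 0 ^ 2 = -(A 0 1 * A 1 0)

theorem isNilpotentTwo_iff {A : Matrix (Fin 2) (Fin 2) ℂ} :
    IsNilpotentTwo A ↔ A.trace = 0 ∧ A.det = 0 := by
  rw [trace_fin_two, det_fin_two]
  constructor
  · rintro ⟨h1, h2⟩
    rw [h1]
    exact ⟨by ring, by linear_combination -h2⟩
  · rintro ⟨h1, h2⟩
    have h3 : A 1 1 = -A 0 0 := by linear_combination h1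
    rw [h3] at h2
    exact ⟨h3, by linear_combination -h2⟩

theorem IsNilpotentTwo.conj {A P : Matrix (Fin 2) (Fin 2) ℂ} (h : IsNilpotentTwo A)
    (hP : IsUnit P.det) : IsNilpotentTwo (P⁻¹ * A * P) := by
  rw [isNilpotentTwo_iff] at h ⊢
  constructor
  · rw [trace_mul_comm, ← Matrix.mul_assoc, mul_nonsing_inv _ hP, Matrix.one_mul, h.1]
  · rw [det_mul, det_mul, h.2]; simp

theorem IsNilpotentTwo.smul {A : Matrix (Fin 2) (Fin 2) ℂ} (h : IsNilpotentTwo A) (s : ℂ) :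
    IsNilpotentTwo (s • A) := by
  obtain ⟨h1, h2⟩ := h
  constructor
  · simp [h1]
  · simp only [Matrix.smul_apply, smul_eq_mul]; linear_combination s ^ 2 * h2

section NullLift

variable {f : ℂ → Fin 4 → ℝ} {F : ℂ → Matrix (Fin 2) (Fin 2) ℂ}

theorem hasDerivAt_entry (hF : ∀ i j, DifferentiableOn ℂ (fun w => F w i j) univCover) {w : ℂ}
    (hw : w ∈ univCover) (i j : Fin 2) : HasDerivAt (fun v => F v i j) (matDeriv F w i j) w :=
  ((hF i j w hw).differentiableAt ((isOpen_leftHalfPlane 0).mem_nhds hw)).hasDerivAt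

theorem differentiableOn_matDeriv (hF : ∀ i j, DifferentiableOn ℂ (fun w => F w i j) univCover)
    (i j : Fin 2) : DifferentiableOn ℂ (fun w => matDeriv F w i j) univCover :=
  (hF i j).deriv (isOpen_leftHalfPlane 0)

theorem maurerCartan_eq {w : ℂ} (h : (F w).det = 1) :
    maurerCartan F w =
      !![F w 1 1 * matDeriv F w 0 0 - F w 0 1 * matDeriv F w 1 0,
         F w 1 1 * matDeriv F w 0 1 - F w 0 1 * matDeriv F w 1 1;
         F w 0 0 * matDeriv F w 1 0 - F w 1 0 * matDeriv F w 0 0,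
         F w 0 0 * matDeriv F w 1 1 - F w 1 0 * matDeriv F w 0 1] := by
  rw [maurerCartan, inv_eq_of_det_eq_one h]
  ext i j
  fin_cases i <;> fin_cases j <;> simp [Matrix.mul_apply, Fin.sum_univ_two] <;> ring

theorem mul_maurerCartan {w : ℂ} (h : (F w).det = 1) : F w * maurerCartan F w = matDeriv F w := by
  rw [maurerCartan, ← Matrix.mul_assoc, mul_nonsing_inv _ (isUnit_det_of_eq_one h), Matrix.one_mul]

theorem IsNullLift.differentiableOn_maurerCartan (h : IsNullLift f F) (i j : Fin 2) :
    DifferentiableOn ℂ (fun w => maurerCartan F w i j) univCover := by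
  have hF := h.holomorphic
  have hD := differentiableOn_matDeriv h.holomorphic
  have key : ∀ i j, DifferentiableOn ℂ (fun w =>
      (!![F w 1 1 * matDeriv F w 0 0 - F w 0 1 * matDeriv F w 1 0,
         F w 1 1 * matDeriv F w 0 1 - F w 0 1 * matDeriv F w 1 1;
         F w 0 0 * matDeriv F w 1 0 - F w 1 0 * matDeriv F w 0 0,
         F w 0 0 * matDeriv F w 1 1 - F w 1 0 * matDeriv F w 0 1] :
        Matrix (Fin 2) (Fin 2) ℂ) i j) univCover := by
    intro i j
    fin_cases i <;> fin_cases j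
    · exact ((hF 1 1).mul (hD 0 0)).sub ((hF 0 1).mul (hD 1 0))
    · exact ((hF 1 1).mul (hD 0 1)).sub ((hF 0 1).mul (hD 1 1))
    · exact ((hF 0 0).mul (hD 1 0)).sub ((hF 1 0).mul (hD 0 0))
    · exact ((hF 0 0).mul (hD 1 1)).sub ((hF 1 0).mul (hD 0 1))
  refine (key i j).congr fun w hw => ?_
  rw [maurerCartan_eq (h.det_eq_one w hw)]

/-- The trace vanishes because it is the derivative of det F = 1; the determinant vanishes because F
is null. -/
theorem IsNullLift.isNilpotentTwo_maurerCartan (h : IsNullLift f F) {w : ℂ} (hw : w ∈ univCover) :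
    IsNilpotentTwo (maurerCartan F w) := by
  rw [isNilpotentTwo_iff]
  refine ⟨?_, h.null w hw⟩
  rw [maurerCartan_eq (h.det_eq_one w hw), trace_fin_two]
  have hd := fun i j => hasDerivAt_entry h.holomorphic hw i j
  have h1 : HasDerivAt (fun v => F v 0 0 * F v 1 1 - F v 0 1 * F v 1 0) _ w :=
    ((hd 0 0).mul (hd 1 1)).sub ((hd 0 1).mul (hd 1 0))
  have h2 : HasDerivAt (fun v => F v 0 0 * F v 1 1 - F v 0 1 * F v 1 0) 0 w := by
    refine (hasDerivAt_const w (1 : ℂ)).congr_of_eventuallyEq ?_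
    filter_upwards [(isOpen_leftHalfPlane 0).mem_nhds hw] with v hv
    rw [← det_fin_two, h.det_eq_one v hv]
  have h3 := h1.unique h2
  simp only [of_apply, cons_val', cons_val_zero, cons_val_one]
  linear_combination h3

theorem IsNullLift.maurerCartan_ne_zero (h : IsNullLift f F) {w : ℂ} (hw : w ∈ univCover) :
    maurerCartan F w ≠ 0 := by
  intro h0
  apply h.immersion w hw
  rw [← mul_maurerCartan (h.det_eq_one w hw), h0, Matrix.mul_zero]

/-! ### The induced metric and the singular set -/

theorem det_herm (v : Fin 4 → ℝ) : (herm v).det = -(lorentz v v : ℂ) := by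
  rw [det_fin_two]
  simp only [herm, lorentz, of_apply, cons_val', cons_val_zero, cons_val_one]
  push_cast
  linear_combination (v 2 : ℂ) ^ 2 * I_sq

theorem hasDerivAt_herm {γ : ℝ → Fin 4 → ℝ} {v : Fin 4 → ℝ} {t : ℝ} (h : HasDerivAt γ v t)
    (i j : Fin 2) : HasDerivAt (fun s => herm (γ s) i j) (herm v i j) t := by
  have hc := fun k => (hasDerivAt_pi.1 h k).ofReal_comp
  fin_cases i <;> fin_cases j
  · exact (hc 0).add (hc 3)
  · exact (hc 1).add ((hc 2).const_mul I)
  · exact (hc 1).sub ((hc 2).const_mul I)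
  · exact (hc 0).sub (hc 3)

theorem isOpen_puncturedDisk : IsOpen puncturedDisk :=
  (isOpen_lt continuous_const continuous_norm).inter (isOpen_lt continuous_norm continuous_const)

theorem exp_mem_puncturedDisk {w : ℂ} : exp w ∈ puncturedDisk ↔ w ∈ univCover := by
  simp [puncturedDisk, univCover, norm_exp]

/-- Differentiate F e₃ F* along w + tη. The direction η upstairs becomes exp w · η downstairs
because dz = exp(w) dw. -/
theorem IsNullLift.herm_fderiv (h : IsNullLift f F) {w : ℂ} (hw : w ∈ univCover)
    (hf : DifferentiableAt ℝ f (exp w)) (η : ℂ) :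
    herm (fderiv ℝ f (exp w) (exp w * η)) =
      F w * (η • (maurerCartan F w * e₃) + (η • (maurerCartan F w * e₃))ᴴ) * (F w)ᴴ := by
  set p : ℝ → ℂ := fun t => w + t * η with hp
  have hp0 : p 0 = w := by simp [hp]
  have hpd : HasDerivAt p η 0 := by
    have h := ((hasDerivAt_id (0 : ℝ)).ofReal_comp.mul_const η).const_add w
    simpa [hp] using h
  have hγ : HasDerivAt (fun t => f (exp (p t))) (fderiv ℝ f (exp w) (exp w * η)) 0 := by
    have h1 : HasDerivAt (fun t => exp (p t)) (exp w * η) 0 := by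
      have := hpd.cexp
      rwa [hp0] at this
    have h2 : HasFDerivAt f (fderiv ℝ f (exp w)) (exp (p 0)) := by
      rw [hp0]; exact hf.hasFDerivAt
    exact h2.comp_hasDerivAt 0 h1
  have hent : ∀ i j, HasDerivAt (fun t => F (p t) i j) (η * matDeriv F w i j) 0 := by
    intro i j
    have h1 : HasDerivAt (fun v => F v i j) (matDeriv F w i j) (p 0) := by
      rw [hp0]; exact hasDerivAt_entry h.holomorphic hw i j
    exact h1.scomp (0 : ℝ) hpd
  have hD := mul_maurerCartan (h.det_eq_one w hw)
  have hrw : F w * (η • (maurerCartan F w * e₃) + (η • (maurerCartan F w * e₃))ᴴ) * (F w)ᴴ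
      = (η • matDeriv F w) * e₃ * (F w)ᴴ + F w * e₃ * (η • matDeriv F w)ᴴ := by
    have he : e₃ᴴ = e₃ := by
      ext i j; fin_cases i <;> fin_cases j <;> simp [e₃]
    rw [← hD]
    simp only [conjTranspose_smul, conjTranspose_mul, he]
    simp only [Matrix.mul_add, Matrix.add_mul, Matrix.mul_assoc, Matrix.smul_mul, Matrix.mul_smul]
  rw [hrw]
  ext i j
  refine (hasDerivAt_herm hγ i j).unique ?_
  have hev : (fun t => herm (f (exp (p t))) i j) =ᶠ[𝓝 0]
      fun t => F (p t) i 0 * star (F (p t) j 0) - F (p t) i 1 * star (F (p t) j 1) := by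
    have hcont : ContinuousAt p 0 := hpd.continuousAt
    have : ∀ᶠ t in 𝓝 (0 : ℝ), p t ∈ univCover :=
      hcont.eventually_mem ((isOpen_leftHalfPlane 0).mem_nhds (by rw [hp0]; exact hw))
    filter_upwards [this] with t ht
    rw [h.lift _ ht]
    simp [Matrix.mul_apply, Fin.sum_univ_two, e₃, conjTranspose_apply]
    ring
  refine HasDerivAt.congr_of_eventuallyEq ?_ hev
  convert! ((hent i 0).mul (hent j 0).star).sub ((hent i 1).mul (hent j 1).star) using 1
  simp [Matrix.mul_apply, Fin.sum_univ_two, e₃, conjTranspose_apply, hp0]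
  ring

/-- The Lorentz square is minus the determinant of the Hermitian matrix, and F drops out as det F =
1. For nilpotent A one has |A₀₀|² = |A₀₁||A₁₀|, which turns the remaining determinant into a perfect
square. -/
theorem lorentz_fderiv (h : IsNullLift f F) {w : ℂ} (hw : w ∈ univCover)
    (hf : DifferentiableAt ℝ f (exp w)) (η : ℂ) :
    lorentz (fderiv ℝ f (exp w) (exp w * η)) (fderiv ℝ f (exp w) (exp w * η)) =
      ‖η‖ ^ 2 * (‖maurerCartan F w 0 1‖ - ‖maurerCartan F w 1 0‖) ^ 2 := by
  have h1 := congrArg Matrix.det (h.herm_fderiv hw hf η)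
  rw [det_herm, det_mul, det_mul, det_conjTranspose, h.det_eq_one w hw, star_one, one_mul,
    mul_one] at h1
  obtain ⟨ht, hd⟩ := h.isNilpotentTwo_maurerCartan hw
  set a := maurerCartan F w 0 0
  set b := maurerCartan F w 0 1
  set c := maurerCartan F w 1 0
  rw [det_fin_two] at h1
  simp only [Matrix.add_apply, Matrix.smul_apply, conjTranspose_apply, Matrix.mul_apply, Fin.sum_univ_two, e₃,
    of_apply, cons_val', cons_val_zero, cons_val_one, cons_val_fin_one, ht, smul_eq_mul] at h1
  change -(_ : ℂ) = (η * (a * 1 + b * 0) + star (η * (a * 1 + b * 0))) *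
    (η * (c * 0 + -a * -1) + star (η * (c * 0 + -a * -1)))
    - (η * (a * 0 + b * -1) + star (η * (c * 1 + -a * 0))) *
    (η * (c * 1 + -a * 0) + star (η * (a * 0 + b * -1))) at h1
  have hn : ‖a‖ * ‖a‖ = ‖b‖ * ‖c‖ := by
    rw [← norm_mul, ← norm_mul, ← sq, hd, norm_neg]
  have ha2 : a * star a = (‖b‖ * ‖c‖ : ℝ) := by
    rw [← hn, star_def, mul_conj, normSq_eq_norm_sq]; push_cast; ring
  have hb2 : b * star b = (‖b‖ ^ 2 : ℝ) := by rw [star_def, mul_conj, normSq_eq_norm_sq]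
  have hc2 : c * star c = (‖c‖ ^ 2 : ℝ) := by rw [star_def, mul_conj, normSq_eq_norm_sq]
  have hη2 : η * star η = (‖η‖ ^ 2 : ℝ) := by rw [star_def, mul_conj, normSq_eq_norm_sq]
  have hd' : star a ^ 2 = -(star b * star c) := by
    rw [← star_pow, hd, star_neg, star_mul]; ring
  apply ofReal_injective
  simp only [star_mul', star_add, star_neg, star_one, star_zero] at h1
  push_cast at ha2 hb2 hc2 hη2 ⊢
  linear_combination (-1 : ℂ) * h1 + (-η ^ 2) * hd - (star η) ^ 2 * hd'
    - 2 * η * star η * ha2 + η * star η * hb2 + η * star η * hc2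
    + ((‖b‖ : ℂ) - ‖c‖) ^ 2 * hη2

theorem IsNullLift.exp_mem_singularSet_iff (h : IsNullLift f F) {w : ℂ} (hw : w ∈ univCover)
    (hf : ContDiffOn ℝ ∞ f puncturedDisk) :
    exp w ∈ singularSet f ↔ ‖maurerCartan F w 0 1‖ = ‖maurerCartan F w 1 0‖ := by
  have hz := exp_mem_puncturedDisk.2 hw
  have hd : DifferentiableAt ℝ f (exp w) :=
    (hf.contDiffAt (isOpen_puncturedDisk.mem_nhds hz)).differentiableAt (by simp)
  set q := (‖maurerCartan F w 0 1‖ - ‖maurerCartan F w 1 0‖) ^ 2 / ‖exp w‖ ^ 2 with hq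
  have hQ : ∀ ζ : ℂ, lorentz (fderiv ℝ f (exp w) ζ) (fderiv ℝ f (exp w) ζ) = ‖ζ‖ ^ 2 * q := by
    intro ζ
    have := lorentz_fderiv h hw hd (ζ / exp w)
    rw [mul_div_cancel₀ _ (exp_ne_zero w)] at this
    rw [this, norm_div, hq]; field_simp
  have h1 : first f 1 1 (exp w) = q := by simpa [first, dir] using hQ 1
  have h2 : first f I I (exp w) = q := by simpa [first, dir] using hQ I
  -- Polarization: |1 + i|² = 2 leaves no room for a mixed term.
  have h3 : first f 1 I (exp w) = 0 := by
    have h4 := hQ (1 + I)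
    have h5 : ‖(1 : ℂ) + I‖ ^ 2 = 2 := by
      rw [← normSq_eq_norm_sq, normSq_apply]; simp; norm_num
    rw [h5, map_add] at h4
    simp only [first, dir] at h1 h2 ⊢
    simp only [lorentz, Pi.add_apply] at h1 h2 h4 ⊢
    linarith
  have hdet : firstDet f (exp w) = q ^ 2 := by rw [firstDet, h1, h2, h3]; ring
  simp only [singularSet, Set.mem_ofPred_eq, hz, true_and, hdet, hq]
  rw [sq_eq_zero_iff, div_eq_zero_iff, sq_eq_zero_iff, sub_eq_zero]
  simp

/-- The image of a nonzero A is a line, spanned by (g, 1) when g is finite, and both sides say that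
it is e₃-isotropic. Unlike the comparison of norms, the right side can be followed through a change
of basis. -/
theorem norm_eq_iff_conjTranspose_mul {A : Matrix (Fin 2) (Fin 2) ℂ} (hA : IsNilpotentTwo A) :
    ‖A 0 1‖ = ‖A 1 0‖ ↔ Aᴴ * e₃ * A = 0 := by
  obtain ⟨ht, hd⟩ := hA
  have hn : ‖A 0 0‖ * ‖A 0 0‖ = ‖A 0 1‖ * ‖A 1 0‖ := by
    rw [← norm_mul, ← norm_mul, ← sq, hd, norm_neg]
  have hsq : ∀ z : ℂ, star z * z = (‖z‖ ^ 2 : ℝ) := fun z => by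
    rw [mul_comm, star_def, mul_conj, normSq_eq_norm_sq]
  have e00 : (Aᴴ * e₃ * A) 0 0 = (‖A 0 0‖ ^ 2 - ‖A 1 0‖ ^ 2 : ℝ) := by
    rw [ofReal_sub, ← hsq, ← hsq]
    simp [Matrix.mul_apply, Fin.sum_univ_two, e₃, conjTranspose_apply]; ring
  have e11 : (Aᴴ * e₃ * A) 1 1 = (‖A 0 1‖ ^ 2 - ‖A 0 0‖ ^ 2 : ℝ) := by
    rw [ofReal_sub, ← hsq, ← hsq]
    simp [Matrix.mul_apply, Fin.sum_univ_two, e₃, conjTranspose_apply, ht]; ring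
  have e01 : (Aᴴ * e₃ * A) 0 1 = star (A 0 0) * A 0 1 + star (A 1 0) * A 0 0 := by
    simp [Matrix.mul_apply, Fin.sum_univ_two, e₃, conjTranspose_apply, ht]
  have e10 : (Aᴴ * e₃ * A) 1 0 = star (A 0 1) * A 0 0 + star (A 0 0) * A 1 0 := by
    simp [Matrix.mul_apply, Fin.sum_univ_two, e₃, conjTranspose_apply, ht]
  constructor
  · intro h
    have h1 : ‖A 0 0‖ = ‖A 1 0‖ := by
      rw [h] at hn
      exact (mul_self_inj (norm_nonneg _) (norm_nonneg _)).1 hn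
    have h01 : star (A 0 0) * A 0 1 + star (A 1 0) * A 0 0 = 0 := by
      by_cases h0 : A 0 0 = 0
      · simp [h0]
      · refine (mul_eq_zero_iff_left h0).1 ?_
        have k1 := hsq (A 0 0)
        have k2 := hsq (A 1 0)
        rw [h1, ← k2] at k1
        linear_combination A 0 1 * k1 + star (A 1 0) * hd
    ext i j
    fin_cases i <;> fin_cases j
    · change (Aᴴ * e₃ * A) 0 0 = 0
      rw [e00, h1]; simp
    · change (Aᴴ * e₃ * A) 0 1 = 0
      rw [e01, h01]
    · change (Aᴴ * e₃ * A) 1 0 = 0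
      rw [e10, ← star_eq_zero, ← h01]
      simp only [star_add, star_mul', star_star]; ring
    · change (Aᴴ * e₃ * A) 1 1 = 0
      rw [e11, h, h1]; simp
  · intro h
    rw [h, Matrix.zero_apply] at e00 e11
    have k1 : ‖A 0 0‖ ^ 2 - ‖A 1 0‖ ^ 2 = 0 := by exact_mod_cast e00.symm
    have k2 : ‖A 0 1‖ ^ 2 - ‖A 0 0‖ ^ 2 = 0 := by exact_mod_cast e11.symm
    exact (sq_eq_sq₀ (norm_nonneg _) (norm_nonneg _)).1 (by linarith)

end NullLift

end

end CMC1Face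

namespace CMC1Face

noncomputable section

open Complex Matrix Filter Topology
open scoped ContDiff

/-! ### Uniqueness of null lifts and the monodromy -/

theorem e₃_mul_e₃ : e₃ * e₃ = 1 := by
  ext i j; fin_cases i <;> fin_cases j <;> simp [e₃, Matrix.mul_apply, Fin.sum_univ_two]

theorem SU11.entries {A : Matrix (Fin 2) (Fin 2) ℂ} (hA : A ∈ SU11) :
    A 1 0 = star (A 0 1) ∧ A 1 1 = star (A 0 0) := by
  obtain ⟨hdet, hA⟩ := hA
  have h1 : A * (e₃ * Aᴴ * e₃) = 1 := by
    rw [← Matrix.mul_assoc, ← Matrix.mul_assoc, hA, e₃_mul_e₃]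
  have h2 := inv_eq_right_inv h1
  rw [inv_eq_of_det_eq_one hdet] at h2
  have h10 := congrFun (congrFun h2 1) 0
  have h00 := congrFun (congrFun h2 0) 0
  simp only [e₃, Matrix.mul_apply, Fin.sum_univ_two, conjTranspose_apply, of_apply, cons_val',
    cons_val_zero, cons_val_one, cons_val_fin_one] at h10 h00
  simp at h10 h00
  exact ⟨h10, h00⟩

theorem mem_SU11_of_entries {p q : ℂ} (h : p * star p - q * star q = 1) :
    (!![p, q; star q, star p] : Matrix (Fin 2) (Fin 2) ℂ) ∈ SU11 := by
  constructor
  · rw [det_fin_two_of]; exact h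
  · ext i j
    fin_cases i <;> fin_cases j <;>
      simp [e₃, Matrix.mul_apply, Fin.sum_univ_two, conjTranspose_apply] <;>
      simp only [star_def] at h
    · linear_combination h
    · ring
    · ring
    · linear_combination -h

theorem SU11.isUnit_det {A : Matrix (Fin 2) (Fin 2) ℂ} (hA : A ∈ SU11) : IsUnit A.det :=
  isUnit_det_of_eq_one hA.1

theorem SU11.mul {A B : Matrix (Fin 2) (Fin 2) ℂ} (hA : A ∈ SU11) (hB : B ∈ SU11) :
    A * B ∈ SU11 := by
  refine ⟨by rw [det_mul, hA.1, hB.1, one_mul], ?_⟩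
  calc A * B * e₃ * (A * B)ᴴ = A * (B * e₃ * Bᴴ) * Aᴴ := by
        simp only [conjTranspose_mul, Matrix.mul_assoc]
    _ = e₃ := by rw [hB.2, hA.2]

theorem SU11.conjTranspose_mul_mul {A : Matrix (Fin 2) (Fin 2) ℂ} (hA : A ∈ SU11) :
    Aᴴ * e₃ * A = e₃ := by
  have h1 : A * (e₃ * Aᴴ * e₃) = 1 := by
    rw [← Matrix.mul_assoc, ← Matrix.mul_assoc, hA.2, e₃_mul_e₃]
  have h2 := mul_eq_one_comm.1 h1
  calc Aᴴ * e₃ * A = e₃ * (e₃ * Aᴴ * e₃ * A) := by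
        simp only [← Matrix.mul_assoc, e₃_mul_e₃, Matrix.one_mul]
    _ = e₃ := by rw [h2, Matrix.mul_one]

/-- A holomorphic function whose complex conjugate is holomorphic has derivative zero. -/
theorem deriv_eq_zero_of_star {h k : ℂ → ℂ} {w : ℂ} (hh : DifferentiableAt ℂ h w)
    (hk : DifferentiableAt ℂ k w) (hkh : k =ᶠ[𝓝 w] fun v => star (h v)) : deriv h w = 0 := by
  -- Derivatives in the real direction η: the left side is linear in η, the right side antilinear.
  -- Comparing η = 1 with η = I kills them.
  have key : ∀ η : ℂ, η * deriv k w = star (η * deriv h w) := by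
    intro η
    have hpd : HasDerivAt (fun t : ℝ => w + t * η) η 0 := by
      have h := ((hasDerivAt_id (0 : ℝ)).ofReal_comp.mul_const η).const_add w
      simpa using h
    have e0 : w + ((0 : ℝ) : ℂ) * η = w := by simp
    have h1 : HasDerivAt (fun t : ℝ => k (w + t * η)) (η * deriv k w) 0 := by
      have : HasDerivAt k (deriv k w) (w + ((0 : ℝ) : ℂ) * η) := by rw [e0]; exact hk.hasDerivAt
      exact this.scomp (0 : ℝ) hpd
    have h2 : HasDerivAt (fun t : ℝ => star (h (w + t * η))) (star (η * deriv h w)) 0 := by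
      have : HasDerivAt h (deriv h w) (w + ((0 : ℝ) : ℂ) * η) := by rw [e0]; exact hh.hasDerivAt
      exact (this.scomp (0 : ℝ) hpd).star
    refine h1.unique (h2.congr_of_eventuallyEq ?_)
    have hc : Tendsto (fun t : ℝ => w + t * η) (𝓝 0) (𝓝 w) := by
      have := hpd.continuousAt.tendsto
      rwa [e0] at this
    exact hc.eventually hkh
  have k1 := key 1
  have k2 := key I
  simp only [one_mul] at k1
  rw [k1, star_mul', star_def, conj_I] at k2
  have : (starRingEnd ℂ) (deriv h w) = 0 := by
    have : (2 * I) * (starRingEnd ℂ) (deriv h w) = 0 := by linear_combination k2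
    simpa using this
  simpa using this

theorem exists_const_of_deriv_eq_zero {h : ℂ → ℂ} (hh : DifferentiableOn ℂ h univCover)
    (hd : ∀ w ∈ univCover, deriv h w = 0) : ∀ w ∈ univCover, h w = h (-1) := by
  intro w hw
  have h1 : (-1 : ℂ) ∈ univCover := by simp [univCover]
  refine (convex_leftHalfPlane 0).is_const_of_fderivWithin_eq_zero (𝕜 := ℂ) hh ?_ hw h1
  intro v hv
  rw [fderivWithin_of_isOpen (isOpen_leftHalfPlane 0) hv]
  ext
  simp [hd v hv]

/-- Two holomorphic maps into `SL₂ℂ` with the same `F e₃ F*` differ by a constant of `SU(1,1)`. -/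
theorem exists_eq_mul_of_same_product {F G : ℂ → Matrix (Fin 2) (Fin 2) ℂ}
    (hF : ∀ i j, DifferentiableOn ℂ (fun w => F w i j) univCover)
    (hG : ∀ i j, DifferentiableOn ℂ (fun w => G w i j) univCover)
    (hFd : ∀ w ∈ univCover, (F w).det = 1) (hGd : ∀ w ∈ univCover, (G w).det = 1)
    (h : ∀ w ∈ univCover, F w * e₃ * (F w)ᴴ = G w * e₃ * (G w)ᴴ) :
    ∃ Q ∈ SU11, ∀ w ∈ univCover, G w = F w * Q := by
  set M : ℂ → Matrix (Fin 2) (Fin 2) ℂ := fun w => (F w)⁻¹ * G w with hM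
  have hMG : ∀ w ∈ univCover, G w = F w * M w := fun w hw => by
    simp only [hM]
    rw [← Matrix.mul_assoc, mul_nonsing_inv _ (isUnit_det_of_eq_one (hFd w hw)), Matrix.one_mul]
  have hMS : ∀ w ∈ univCover, M w ∈ SU11 := by
    intro w hw
    have hu := isUnit_det_of_eq_one (hFd w hw)
    refine ⟨?_, ?_⟩
    · have := congrArg Matrix.det (hMG w hw)
      rw [det_mul, hGd w hw, hFd w hw, one_mul] at this
      exact this.symm
    · calc M w * e₃ * (M w)ᴴ = (F w)⁻¹ * (G w * e₃ * (G w)ᴴ) * ((F w)⁻¹)ᴴ := by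
            simp only [hM, conjTranspose_mul, Matrix.mul_assoc]
        _ = ((F w)⁻¹ * F w) * e₃ * ((F w)⁻¹ * F w)ᴴ := by
            rw [← h w hw]; simp only [conjTranspose_mul, Matrix.mul_assoc]
        _ = e₃ := by rw [nonsing_inv_mul _ hu]; simp
  have hMd : ∀ i j, DifferentiableOn ℂ (fun w => M w i j) univCover := by
    have key : ∀ i j, DifferentiableOn ℂ (fun w =>
        ((!![F w 1 1, -F w 0 1; -F w 1 0, F w 0 0] : Matrix (Fin 2) (Fin 2) ℂ) * G w) i j)
        univCover := by
      intro i j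
      simp only [Matrix.mul_apply, Fin.sum_univ_two]
      fin_cases i
      · exact ((hF 1 1).mul (hG 0 j)).add ((hF 0 1).neg.mul (hG 1 j))
      · exact ((hF 1 0).neg.mul (hG 0 j)).add ((hF 0 0).mul (hG 1 j))
    intro i j
    refine (key i j).congr fun w hw => ?_
    simp only [hM]
    rw [inv_eq_of_det_eq_one (hFd w hw)]
  -- Entries of an element of SU(1,1) come in conjugate pairs, so each entry of M is both
  -- holomorphic and antiholomorphic.
  have hconst : ∀ i j i' j', (∀ w ∈ univCover, M w i' j' = star (M w i j)) →
      ∀ w ∈ univCover, M w i j = M (-1) i j := by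
    intro i j i' j' hs
    refine exists_const_of_deriv_eq_zero (hMd i j) fun w hw => ?_
    have hn := (isOpen_leftHalfPlane 0).mem_nhds hw
    exact deriv_eq_zero_of_star ((hMd i j w hw).differentiableAt hn)
      ((hMd i' j' w hw).differentiableAt hn)
      (by filter_upwards [hn] with v hv using hs v hv)
  refine ⟨M (-1), hMS _ (by simp [univCover]), fun w hw => ?_⟩
  have hE := fun w hw => SU11.entries (hMS w hw)
  have hc : M w = M (-1) := by
    ext i j
    fin_cases i <;> fin_cases j
    · exact hconst 0 0 1 1 (fun w hw => (hE w hw).2) w hw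
    · exact hconst 0 1 1 0 (fun w hw => (hE w hw).1) w hw
    · exact hconst 1 0 0 1 (fun w hw => by rw [(hE w hw).1, star_star]) w hw
    · exact hconst 1 1 0 0 (fun w hw => by rw [(hE w hw).2, star_star]) w hw
  rw [hMG w hw, hc]

section

variable {f : ℂ → Fin 4 → ℝ} {F : ℂ → Matrix (Fin 2) (Fin 2) ℂ}

/-- Both F and F ∘ `deck` lift the same f, because `exp` does not see the deck transformation. -/
theorem IsNullLift.exists_monodromy (h : IsNullLift f F) :
    ∃ ρ ∈ SU11, ∀ w ∈ univCover, F (deck w) = F w * ρ := by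
  have hdeck : ∀ w ∈ univCover, deck w ∈ univCover := fun w hw => deck_mem.2 hw
  refine exists_eq_mul_of_same_product h.holomorphic (G := fun w => F (deck w)) ?_
    h.det_eq_one (fun w hw => h.det_eq_one _ (hdeck w hw)) ?_
  · intro i j
    exact (h.holomorphic i j).comp
      (fun w _ => (hasDerivAt_deck w).differentiableAt.differentiableWithinAt) hdeck
  · intro w hw
    rw [← h.lift w hw, ← h.lift _ (hdeck w hw), exp_deck]

theorem IsNullLift.exists_eq_mul {G : ℂ → Matrix (Fin 2) (Fin 2) ℂ} (h : IsNullLift f F)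
    (hG : IsNullLift f G) : ∃ Q ∈ SU11, ∀ w ∈ univCover, G w = F w * Q :=
  exists_eq_mul_of_same_product h.holomorphic hG.holomorphic h.det_eq_one hG.det_eq_one
    fun w hw => by rw [← h.lift w hw, ← hG.lift w hw]

theorem IsNullLift.matDeriv_deck (h : IsNullLift f F) {ρ : Matrix (Fin 2) (Fin 2) ℂ}
    (hρ : ∀ w ∈ univCover, F (deck w) = F w * ρ) {w : ℂ} (hw : w ∈ univCover) :
    matDeriv F (deck w) = matDeriv F w * ρ := by
  ext i j
  have h1 : HasDerivAt (fun v => F (deck v) i j) (1 * matDeriv F (deck w) i j) w :=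
    (hasDerivAt_entry h.holomorphic (deck_mem.2 hw) i j).scomp w (hasDerivAt_deck w)
  have h2 : HasDerivAt (fun v => F v i 0 * ρ 0 j + F v i 1 * ρ 1 j)
      (matDeriv F w i 0 * ρ 0 j + matDeriv F w i 1 * ρ 1 j) w :=
    ((hasDerivAt_entry h.holomorphic hw i 0).mul_const _).add
      ((hasDerivAt_entry h.holomorphic hw i 1).mul_const _)
  rw [one_mul] at h1
  rw [Matrix.mul_apply, Fin.sum_univ_two]
  refine h1.unique (h2.congr_of_eventuallyEq ?_)
  filter_upwards [(isOpen_leftHalfPlane 0).mem_nhds hw] with v hv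
  rw [hρ v hv, Matrix.mul_apply, Fin.sum_univ_two]

theorem IsNullLift.maurerCartan_deck (h : IsNullLift f F) {ρ : Matrix (Fin 2) (Fin 2) ℂ}
    (hρ : ∀ w ∈ univCover, F (deck w) = F w * ρ) {w : ℂ} (hw : w ∈ univCover) :
    maurerCartan F (deck w) = ρ⁻¹ * maurerCartan F w * ρ := by
  rw [maurerCartan, h.matDeriv_deck hρ hw, hρ w hw, Matrix.mul_inv_rev, maurerCartan]
  simp only [Matrix.mul_assoc]

/-- Nonsingular points accumulate at the puncture. -/
theorem IsCMC1Face.exists_not_mem_singularSet (hf : IsCMC1Face f) (R : ℝ) :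
    ∃ w ∈ leftHalfPlane R, w ∈ univCover ∧ exp w ∉ singularSet f := by
  obtain ⟨W, hW, _, hcl, hsp, _⟩ := hf.exists_dense
  set x : ℝ := min R 0 - 1 with hx
  have hxR : x < R := by have := min_le_left R 0; linarith
  have hx0 : x < 0 := by have := min_le_right R 0; linarith
  set V : Set ℂ := {z | 0 < ‖z‖ ∧ ‖z‖ < Real.exp (min R 0)} with hV
  have hVo : IsOpen V :=
    (isOpen_lt continuous_const continuous_norm).inter (isOpen_lt continuous_norm continuous_const)
  have hmem : exp (x : ℂ) ∈ V := by
    simp only [hV, Set.mem_ofPred_eq, norm_exp, ofReal_re]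
    exact ⟨Real.exp_pos _, Real.exp_lt_exp.2 (by linarith)⟩
  have hpd : exp (x : ℂ) ∈ puncturedDisk := exp_mem_puncturedDisk.2 (by simpa [univCover] using hx0)
  obtain ⟨z, hzV, hzW⟩ := mem_closure_iff.1 (hcl hpd) V hVo hmem
  have hz0 : z ≠ 0 := norm_pos_iff.1 hzV.1
  have hre : (log z).re < min R 0 := by
    rw [log_re]; exact (Real.log_lt_iff_lt_exp hzV.1).2 hzV.2
  refine ⟨log z, lt_of_lt_of_le hre (min_le_left _ _), lt_of_lt_of_le hre (min_le_right _ _), ?_⟩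
  rw [exp_log hz0]
  exact fun h => (hsp z hzW).1.2.ne' h.2

end

end

end CMC1Face

namespace CMC1Face

noncomputable section

open Complex Matrix Filter Topology
open scoped ContDiff

/-! ### Tame frames -/

/-- A holomorphic nilpotent matrix function `B` near the end that spans the same line as the
Maurer-Cartan form of a null lift (up to a constant change of basis), has moderate growth at the
puncture and monodromy given by conjugation with `ρ`. The Hermitian form `E` detects the singular
points. -/
structure TameFrame (f : ℂ → Fin 4 → ℝ) (ρ E : Matrix (Fin 2) (Fin 2) ℂ) (R : ℝ)
    (B : ℂ → Matrix (Fin 2) (Fin 2) ℂ) : Prop where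
  nonpos : R ≤ 0
  holomorphic : ∀ i j, DifferentiableOn ℂ (fun w => B w i j) (leftHalfPlane R)
  growth : ∀ i j, ExpGrowth (fun w => B w i j) R
  mul_deck : ∀ w ∈ leftHalfPlane R, ρ * B (deck w) = B w * ρ
  nilpotent : ∀ w ∈ leftHalfPlane R, IsNilpotentTwo (B w)
  singular_iff : ∀ w ∈ leftHalfPlane R, B w ≠ 0 →
    (exp w ∈ singularSet f ↔ (B w)ᴴ * E * B w = 0)
  exists_ne_zero : ∃ w ∈ leftHalfPlane R, B w ≠ 0

section TameFrame

variable {f : ℂ → Fin 4 → ℝ} {ρ E : Matrix (Fin 2) (Fin 2) ℂ} {R : ℝ}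
  {B : ℂ → Matrix (Fin 2) (Fin 2) ℂ}

/-- Conjugation does not see the sign of ρ, so ±Λ_h need not be treated separately. -/
theorem TameFrame.neg (h : TameFrame f (-ρ) E R B) : TameFrame f ρ E R B where
  nonpos := h.nonpos
  holomorphic := h.holomorphic
  growth := h.growth
  mul_deck := fun w hw => by simpa using h.mul_deck w hw
  nilpotent := h.nilpotent
  singular_iff := h.singular_iff
  exists_ne_zero := h.exists_ne_zero

theorem conj_ne_zero {A C : Matrix (Fin 2) (Fin 2) ℂ} (hC : IsUnit C.det) (hA : A ≠ 0) :
    C⁻¹ * A * C ≠ 0 := by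
  intro h0
  apply hA
  calc A = C * (C⁻¹ * A * C) * C⁻¹ := by
        rw [← Matrix.mul_assoc, ← Matrix.mul_assoc, mul_nonsing_inv _ hC, Matrix.one_mul,
          Matrix.mul_assoc, mul_nonsing_inv _ hC, Matrix.mul_one]
    _ = 0 := by rw [h0]; simp

/-- Constant change of basis. C need not lie in SU(1,1): the form E records how e₃ is transformed.
-/
theorem TameFrame.conj (h : TameFrame f ρ E R B) {C : Matrix (Fin 2) (Fin 2) ℂ}
    (hC : IsUnit C.det) :
    TameFrame f (C⁻¹ * ρ * C) (Cᴴ * E * C) R (fun w => C⁻¹ * B w * C) where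
  nonpos := h.nonpos
  holomorphic := fun i j => by
    have hB := h.holomorphic
    simp only [Matrix.mul_apply, Fin.sum_univ_two]
    fun_prop
  growth := fun i j => by
    have hB := h.growth
    simp only [Matrix.mul_apply, Fin.sum_univ_two]
    have hc := fun c => expGrowth_const c R
    exact ((((hc _).mul (hB _ _)).add ((hc _).mul (hB _ _))).mul (hc _)).add
      ((((hc _).mul (hB _ _)).add ((hc _).mul (hB _ _))).mul (hc _))
  mul_deck := fun w hw => by
    calc C⁻¹ * ρ * C * (C⁻¹ * B (deck w) * C) = C⁻¹ * ρ * (C * C⁻¹) * B (deck w) * C := by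
          simp only [Matrix.mul_assoc]
      _ = C⁻¹ * (ρ * B (deck w)) * C := by
          rw [mul_nonsing_inv _ hC]; simp only [Matrix.mul_assoc, Matrix.one_mul]
      _ = C⁻¹ * B w * (C * C⁻¹) * ρ * C := by
          rw [h.mul_deck w hw, mul_nonsing_inv _ hC]
          simp only [Matrix.mul_assoc, Matrix.one_mul]
      _ = _ := by simp only [Matrix.mul_assoc]
  nilpotent := fun w hw => (h.nilpotent w hw).conj hC
  singular_iff := fun w hw hne => by
    have hne' : B w ≠ 0 := by
      intro h0; apply hne; simp [h0]
    rw [h.singular_iff w hw hne']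
    have hCC : C * C⁻¹ = 1 := mul_nonsing_inv _ hC
    have hCC' : (C⁻¹)ᴴ * Cᴴ = 1 := by
      rw [← conjTranspose_mul, hCC, conjTranspose_one]
    have e : (C⁻¹ * B w * C)ᴴ * (Cᴴ * E * C) * (C⁻¹ * B w * C)
        = Cᴴ * ((B w)ᴴ * E * B w) * C := by
      calc _ = Cᴴ * (B w)ᴴ * ((C⁻¹)ᴴ * Cᴴ) * E * (C * C⁻¹) * B w * C := by
            simp only [conjTranspose_mul, Matrix.mul_assoc]
        _ = _ := by rw [hCC, hCC']; simp only [Matrix.mul_assoc, Matrix.one_mul]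
    rw [e]
    constructor
    · intro h0; rw [h0]; simp
    · intro h0
      calc (B w)ᴴ * E * B w = (C⁻¹)ᴴ * Cᴴ * ((B w)ᴴ * E * B w) * (C * C⁻¹) := by
            rw [hCC, hCC']; simp
        _ = (C⁻¹)ᴴ * (Cᴴ * ((B w)ᴴ * E * B w) * C) * C⁻¹ := by simp only [Matrix.mul_assoc]
        _ = 0 := by rw [h0]; simp
  exists_ne_zero := by
    obtain ⟨w, hw, hne⟩ := h.exists_ne_zero
    exact ⟨w, hw, conj_ne_zero hC hne⟩

variable {F : ℂ → Matrix (Fin 2) (Fin 2) ℂ}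

/-- A holomorphic multiple of the Maurer-Cartan form with moderate growth is a tame frame. -/
theorem IsNullLift.tameFrame (h : IsNullLift f F) (hf : ContDiffOn ℝ ∞ f puncturedDisk)
    (hR : R ≤ 0) (hB : ∀ i j, DifferentiableOn ℂ (fun w => B w i j) (leftHalfPlane R))
    (hg : ∀ i j, ExpGrowth (fun w => B w i j) R)
    (hd : ∀ w ∈ leftHalfPlane R, ρ * B (deck w) = B w * ρ)
    (hs : ∀ w ∈ leftHalfPlane R, ∃ s : ℂ, B w = s • maurerCartan F w)
    (hne : ∃ w ∈ leftHalfPlane R, B w ≠ 0) : TameFrame f ρ e₃ R B where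
  nonpos := hR
  holomorphic := hB
  growth := hg
  mul_deck := hd
  nilpotent := fun w hw => by
    obtain ⟨s, hs⟩ := hs w hw
    rw [hs]
    exact (h.isNilpotentTwo_maurerCartan (leftHalfPlane_mono hR hw)).smul s
  singular_iff := fun w hw hne => by
    obtain ⟨s, hs⟩ := hs w hw
    have hw' : w ∈ univCover := leftHalfPlane_mono hR hw
    have hn := h.isNilpotentTwo_maurerCartan hw'
    have hs0 : s ≠ 0 := by rintro rfl; simp [hs] at hne
    rw [h.exp_mem_singularSet_iff hw' hf, norm_eq_iff_conjTranspose_mul hn, hs]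
    simp [conjTranspose_smul, hs0]
  exists_ne_zero := hne

end TameFrame

/-! ### The Schwarzian derivative in the coordinate of the universal cover -/

/-- Chain rule for z = exp w: the added 1/2 is minus the Schwarzian derivative of the exponential.
-/
theorem schwarzian_eq {g : ℂ → ℂ} {w : ℂ} (hg : AnalyticAt ℂ g w) (hg' : deriv g w ≠ 0) :
    schwarzian g w = exp (-w) ^ 2 * (deriv (fun v => deriv (deriv g) v / deriv g v) w
      - (deriv (deriv g) w / deriv g w) ^ 2 / 2 + 1 / 2) := by
  have hexp : ∀ v : ℂ, HasDerivAt (fun v : ℂ => exp (-v)) (-exp (-v)) v := fun v => by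
    simpa using (hasDerivAt_neg v).cexp
  have h1 : ∀ᶠ v in 𝓝 w, dz (dz g) v = exp (-v) ^ 2 * (deriv (deriv g) v - deriv g v) := by
    filter_upwards [hg.eventually_analyticAt] with v hv
    have : deriv (dz g) v = -exp (-v) * deriv g v + exp (-v) * deriv (deriv g) v :=
      ((hexp v).mul hv.deriv.differentiableAt.hasDerivAt).deriv
    rw [dz, this]; ring
  have h2 : ∀ᶠ v in 𝓝 w, dz (dz g) v / dz g v
      = exp (-v) * (deriv (deriv g) v / deriv g v - 1) := by
    filter_upwards [h1, hg.deriv.continuousAt.eventually_ne hg'] with v hv hv0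
    rw [hv, dz]
    have := exp_ne_zero (-v)
    field_simp
  have hP : DifferentiableAt ℂ (fun v => deriv (deriv g) v / deriv g v) w :=
    hg.deriv.deriv.differentiableAt.div hg.deriv.differentiableAt hg'
  have h3 : deriv (fun v => dz (dz g) v / dz g v) w
      = -exp (-w) * (deriv (deriv g) w / deriv g w - 1)
        + exp (-w) * deriv (fun v => deriv (deriv g) v / deriv g v) w := by
    rw [EventuallyEq.deriv_eq h2]
    exact ((hexp w).mul (hP.hasDerivAt.sub_const 1)).deriv
  rw [schwarzian, h2.self_of_nhds, dz, h3]
  ring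

theorem exists_analyticAt_sq_mul {p : ℂ → ℂ} (hp : MeromorphicAt p 0)
    (ho : (-2 : ℤ) ≤ meromorphicOrderAt p 0) :
    ∃ q : ℂ → ℂ, AnalyticAt ℂ q 0 ∧ ∀ᶠ z in 𝓝[≠] (0 : ℂ), z ^ 2 * p z = q z := by
  have hsq : MeromorphicAt (fun z : ℂ => z ^ 2) 0 := by fun_prop
  have hm : MeromorphicAt (fun z : ℂ => z ^ 2 * p z) 0 := hsq.mul hp
  have h2 : meromorphicOrderAt (fun z : ℂ => z ^ 2) 0 = 2 := by
    have := fun_meromorphicOrderAt_pow_id_sub_const (𝕜 := ℂ) (x := 0) (n := 2)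
    simpa using this
  have hord : 0 ≤ meromorphicOrderAt (fun z : ℂ => z ^ 2 * p z) 0 := by
    rw [fun_meromorphicOrderAt_mul hsq hp, h2]
    have := add_le_add_right ho (2 : WithTop ℤ)
    refine le_trans ?_ this
    decide
  exact (hm.meromorphicOrderAt_nonneg_iff).1 hord

theorem eventually_ne_zero_of_exists {H : ℂ → ℂ} {R : ℝ}
    (hH : DifferentiableOn ℂ H (leftHalfPlane R)) (hne : ∃ w ∈ leftHalfPlane R, H w ≠ 0) {c : ℂ}
    (hc : c ∈ leftHalfPlane R) : ∀ᶠ w in 𝓝[≠] c, H w ≠ 0 := by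
  have ha := analyticOnNhd_of_differentiableOn hH
  rcases (ha c hc).eventually_eq_zero_or_eventually_ne_zero with h | h
  · obtain ⟨w, hw, hwne⟩ := hne
    exact absurd (ha.eqOn_zero_of_preconnected_of_eventuallyEq_zero
      (convex_leftHalfPlane R).isPreconnected hc h hw) hwne
  · exact h

theorem eq_of_eventually_eq_nhdsNE {φ ψ : ℂ → ℂ} {c : ℂ} (hφ : ContinuousAt φ c)
    (hψ : ContinuousAt ψ c) (h : ∀ᶠ w in 𝓝[≠] c, φ w = ψ w) : φ c = ψ c :=
  tendsto_nhds_unique (hφ.tendsto.mono_left nhdsWithin_le_nhds)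
    ((hψ.tendsto.mono_left nhdsWithin_le_nhds).congr' (h.mono fun _ hw => hw.symm))

end

end CMC1Face

namespace CMC1Face

noncomputable section

open Complex Matrix Filter Topology
open scoped ContDiff

/-! ### Derivative of the secondary Gauss map and tame frames for regular ends. -/

section

variable {f : ℂ → Fin 4 → ℝ} {F : ℂ → Matrix (Fin 2) (Fin 2) ℂ}
  {ρ : Matrix (Fin 2) (Fin 2) ℂ}

/-- The numerator `a' c - a c'` of the derivative of the secondary Gauss map `g = a / c`. -/
def gaussWronskian (F : ℂ → Matrix (Fin 2) (Fin 2) ℂ) (w : ℂ) : ℂ :=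
  matDeriv (maurerCartan F) w 0 0 * maurerCartan F w 1 0
    - maurerCartan F w 0 0 * matDeriv (maurerCartan F) w 1 0

theorem IsNullLift.mul_maurerCartan_deck (h : IsNullLift f F) (hρu : IsUnit ρ.det)
    (hρ : ∀ w ∈ univCover, F (deck w) = F w * ρ) {w : ℂ} (hw : w ∈ univCover) :
    ρ * maurerCartan F (deck w) = maurerCartan F w * ρ := by
  rw [h.maurerCartan_deck hρ hw, ← Matrix.mul_assoc, ← Matrix.mul_assoc, mul_nonsing_inv _ hρu,
    Matrix.one_mul]

theorem IsNullLift.differentiableOn_gaussWronskian (h : IsNullLift f F) :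
    DifferentiableOn ℂ (gaussWronskian F) univCover :=
  ((differentiableOn_matDeriv h.differentiableOn_maurerCartan 0 0).mul
    (h.differentiableOn_maurerCartan 1 0)).sub
    ((h.differentiableOn_maurerCartan 0 0).mul
      (differentiableOn_matDeriv h.differentiableOn_maurerCartan 1 0))

/-! #### Constant secondary Gauss map -/

/-- Either A₁₀ is not identically zero, and g = A₀₀ / A₁₀ is locally constant, hence constant by the
identity theorem; or A₁₀ = 0 throughout, which is the case g = ∞. -/
theorem IsNullLift.exists_const_of_gaussWronskian_eq_zero (h : IsNullLift f F)
    (hN : ∀ w ∈ univCover, gaussWronskian F w = 0) :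
    ∃ (A : Matrix (Fin 2) (Fin 2) ℂ) (k : ℂ → ℂ), ∀ w ∈ univCover, maurerCartan F w = k w • A := by
  have hA := h.differentiableOn_maurerCartan
  by_cases hc : ∃ w ∈ univCover, maurerCartan F w 1 0 ≠ 0
  · obtain ⟨w₀, hw₀, hc₀⟩ := hc
    set g₀ := maurerCartan F w₀ 0 0 / maurerCartan F w₀ 1 0 with hg₀
    have hn₀ : univCover ∈ 𝓝 w₀ := (isOpen_leftHalfPlane 0).mem_nhds hw₀
    have hcev : ∀ᶠ w in 𝓝 w₀, maurerCartan F w 1 0 ≠ 0 :=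
      ((hA 1 0).differentiableAt hn₀).continuousAt.eventually_ne hc₀
    obtain ⟨ε, hε, hball⟩ := Metric.eventually_nhds_iff_ball.1
      (hcev.and (eventually_mem_nhds_iff.2 hn₀))
    have hd : ∀ w ∈ Metric.ball w₀ ε,
        HasDerivAt (fun v => maurerCartan F v 0 0 / maurerCartan F v 1 0) 0 w := by
      intro w hw
      obtain ⟨hcw, hnw⟩ := hball w hw
      have hwU : w ∈ univCover := mem_of_mem_nhds hnw
      convert! (hasDerivAt_entry hA hwU 0 0).div (hasDerivAt_entry hA hwU 1 0) hcw using 1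
      have := hN w hwU
      rw [gaussWronskian] at this
      rw [this, zero_div]
    have hconst : ∀ w ∈ Metric.ball w₀ ε,
        maurerCartan F w 0 0 / maurerCartan F w 1 0 = g₀ := by
      intro w hw
      refine (convex_ball w₀ ε).is_const_of_fderivWithin_eq_zero (𝕜 := ℂ)
        (f := fun v => maurerCartan F v 0 0 / maurerCartan F v 1 0)
        (fun v hv => (hd v hv).differentiableAt.differentiableWithinAt) ?_ hw
        (Metric.mem_ball_self hε)
      intro v hv
      rw [fderivWithin_of_isOpen Metric.isOpen_ball hv]
      ext
      simp [(hd v hv).deriv]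
    have hag : ∀ w ∈ univCover, maurerCartan F w 0 0 - g₀ * maurerCartan F w 1 0 = 0 := by
      have hdiff : DifferentiableOn ℂ
          (fun w => maurerCartan F w 0 0 - g₀ * maurerCartan F w 1 0) (leftHalfPlane 0) :=
        (hA 0 0).sub ((hA 1 0).const_mul g₀)
      refine (analyticOnNhd_of_differentiableOn hdiff).eqOn_zero_of_preconnected_of_eventuallyEq_zero
        (convex_leftHalfPlane 0).isPreconnected hw₀ ?_
      filter_upwards [Metric.ball_mem_nhds w₀ hε] with w hw
      have h1 := hconst w hw
      rw [div_eq_iff (hball w hw).1] at h1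
      simp [h1]
    have hbg : ∀ w ∈ univCover, maurerCartan F w 0 1 + g₀ ^ 2 * maurerCartan F w 1 0 = 0 := by
      intro w hw
      have hev := eventually_ne_zero_of_exists (hA 1 0) ⟨w₀, hw₀, hc₀⟩ hw
      have hn := (isOpen_leftHalfPlane 0).mem_nhds hw
      have hmem : ∀ᶠ v in 𝓝[≠] w, v ∈ univCover := nhdsWithin_le_nhds hn
      have hcont := (((hA 0 1).add ((hA 1 0).const_mul (g₀ ^ 2))).differentiableAt hn).continuousAt
      refine eq_of_eventually_eq_nhdsNE
        (φ := fun v => maurerCartan F v 0 1 + g₀ ^ 2 * maurerCartan F v 1 0)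
        (ψ := fun _ => 0) hcont continuousAt_const ?_
      filter_upwards [hev, hmem] with v hv hvU
      have h2 := (h.isNilpotentTwo_maurerCartan hvU).det_eq
      refine (mul_eq_zero_iff_right hv).1 ?_
      linear_combination h2 -
        (maurerCartan F v 0 0 + g₀ * maurerCartan F v 1 0) * hag v hvU
    refine ⟨!![g₀, -g₀ ^ 2; 1, -g₀], fun w => maurerCartan F w 1 0, fun w hw => ?_⟩
    have e1 := hag w hw
    have e2 := hbg w hw
    have e3 := (h.isNilpotentTwo_maurerCartan hw).trace_eq
    ext i j
    fin_cases i <;> fin_cases j <;> simp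
    · linear_combination e1
    · linear_combination e2
    · rw [e3]; linear_combination -e1
  · push Not at hc
    refine ⟨!![0, 1; 0, 0], fun w => maurerCartan F w 0 1, fun w hw => ?_⟩
    obtain ⟨e3, e4⟩ := h.isNilpotentTwo_maurerCartan hw
    have e1 := hc w hw
    have e2 : maurerCartan F w 0 0 = 0 := by
      rw [e1, mul_zero, neg_zero] at e4
      simpa using e4
    ext i j
    fin_cases i <;> fin_cases j <;> simp [e1, e2, e3]

/-- The scalar k in A = k · const is not controlled at the puncture. Only its multiplier under the
deck transformation matters, and an exponential has that multiplier and moderate growth. -/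
theorem IsNullLift.exists_tameFrame_of_const (h : IsNullLift f F)
    (hf : ContDiffOn ℝ ∞ f puncturedDisk) (hρu : IsUnit ρ.det)
    (hρ : ∀ w ∈ univCover, F (deck w) = F w * ρ)
    (hN : ∀ w ∈ univCover, gaussWronskian F w = 0) :
    ∃ B, TameFrame f ρ e₃ 0 B := by
  obtain ⟨A, k, hAk⟩ := h.exists_const_of_gaussWronskian_eq_zero hN
  have hk : ∀ w ∈ univCover, k w ≠ 0 := by
    intro w hw h0
    apply h.maurerCartan_ne_zero hw
    rw [hAk w hw, h0, zero_smul]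
  have hw₀ : (-1 : ℂ) ∈ univCover := by simp [univCover]
  have hA0 : A ≠ 0 := by
    intro h0
    apply h.maurerCartan_ne_zero hw₀
    rw [hAk _ hw₀, h0, smul_zero]
  -- One base point suffices: the relation t ρA = Aρ is between constant matrices.
  set t : ℂ := k (deck (-1)) / k (-1) with ht
  have hw₁ : deck (-1) ∈ univCover := deck_mem.2 hw₀
  have ht0 : t ≠ 0 := div_ne_zero (hk _ hw₁) (hk _ hw₀)
  have hAt : t • (ρ * A) = A * ρ := by
    have h1 := h.mul_maurerCartan_deck hρu hρ hw₀
    rw [hAk _ hw₀, hAk _ hw₁, Matrix.mul_smul, Matrix.smul_mul] at h1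
    rw [ht, div_eq_inv_mul, mul_smul, h1, smul_smul, inv_mul_cancel₀ (hk _ hw₀), one_smul]
  set κ : ℂ := log t / (2 * Real.pi * I) with hκ
  have hκt : exp (2 * Real.pi * I * κ) = t := by
    rw [hκ, mul_div_cancel₀ _ two_pi_I_ne_zero, exp_log ht0]
  refine ⟨fun w => exp (κ * w) • A, h.tameFrame hf le_rfl ?_ ?_ ?_ ?_ ?_⟩
  · intro i j
    simp only [Matrix.smul_apply, smul_eq_mul]
    exact Differentiable.differentiableOn (by fun_prop)
  · intro i j
    simp only [Matrix.smul_apply, smul_eq_mul]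
    exact (expGrowth_cexp _ _).mul (expGrowth_const _ _)
  · intro w _
    have e : exp (κ * deck w) = exp (κ * w) * t := by
      rw [← hκt, ← exp_add]; congr 1; simp only [deck]; ring
    rw [Matrix.mul_smul, Matrix.smul_mul, e, mul_smul, hAt]
  · intro w hw
    refine ⟨exp (κ * w) / k w, ?_⟩
    rw [hAk w hw, smul_smul, div_mul_cancel₀ _ (hk w hw)]
  · exact ⟨-1, hw₀, by simp [hA0, exp_ne_zero]⟩

/-! #### Nonconstant secondary Gauss map -/

theorem IsNullLift.hasDerivAt_secondaryGauss (h : IsNullLift f F) {w : ℂ} (hw : w ∈ univCover)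
    (hc : maurerCartan F w 1 0 ≠ 0) :
    HasDerivAt (secondaryGauss F) (gaussWronskian F w / maurerCartan F w 1 0 ^ 2) w :=
  (hasDerivAt_entry h.differentiableOn_maurerCartan hw 0 0).div
    (hasDerivAt_entry h.differentiableOn_maurerCartan hw 1 0) hc

theorem IsNullLift.analyticAt_secondaryGauss (h : IsNullLift f F) {w : ℂ} (hw : w ∈ univCover)
    (hc : maurerCartan F w 1 0 ≠ 0) : AnalyticAt ℂ (secondaryGauss F) w :=
  (analyticOnNhd_of_differentiableOn (h.differentiableOn_maurerCartan 0 0) w hw).div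
    (analyticOnNhd_of_differentiableOn (h.differentiableOn_maurerCartan 1 0) w hw) hc

/-- Write A = c (g, 1)ᵀ (1, -g). Since (1, -g) annihilates (g, 1), only the derivative of g inside
the column survives, with factor c g'. This characterizes c g' without reference to a basis. -/
theorem IsNullLift.mul_matDeriv_maurerCartan (h : IsNullLift f F) {w : ℂ} (hw : w ∈ univCover)
    (hc : maurerCartan F w 1 0 ≠ 0) :
    maurerCartan F w * matDeriv (maurerCartan F) w =
      (gaussWronskian F w / maurerCartan F w 1 0) • maurerCartan F w := by
  obtain ⟨e3, e4⟩ := h.isNilpotentTwo_maurerCartan hw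
  have hd := fun i j => hasDerivAt_entry h.differentiableOn_maurerCartan hw i j
  have hn := (isOpen_leftHalfPlane 0).mem_nhds hw
  have d3 : matDeriv (maurerCartan F) w 1 1 = -matDeriv (maurerCartan F) w 0 0 := by
    refine (hd 1 1).unique ((hd 0 0).neg.congr_of_eventuallyEq ?_)
    filter_upwards [hn] with v hv using (h.isNilpotentTwo_maurerCartan hv).trace_eq
  have d4 : 2 * maurerCartan F w 0 0 * matDeriv (maurerCartan F) w 0 0 =
      -(matDeriv (maurerCartan F) w 0 1 * maurerCartan F w 1 0
        + maurerCartan F w 0 1 * matDeriv (maurerCartan F) w 1 0) := by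
    have k1 := (hd 0 0).pow 2
    have k2 := ((hd 0 1).mul (hd 1 0)).neg
    have := k1.unique (k2.congr_of_eventuallyEq ?_)
    · simpa using this
    · filter_upwards [hn] with v hv using (h.isNilpotentTwo_maurerCartan hv).det_eq
  rw [gaussWronskian]
  set A := maurerCartan F w
  set D := matDeriv (maurerCartan F) w
  ext i j
  fin_cases i <;> fin_cases j <;>
    simp [Matrix.mul_apply, Fin.sum_univ_two, d3, e3] <;> field_simp
  · linear_combination D 1 0 * e4
  · linear_combination A 0 0 * d4 + (-2 * D 0 0) * e4
  · ring
  · linear_combination d4 * A 1 0 - D 1 0 * e4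

theorem mul_matDeriv_deck {A : ℂ → Matrix (Fin 2) (Fin 2) ℂ}
    (hA : ∀ i j, DifferentiableOn ℂ (fun w => A w i j) univCover)
    (h : ∀ w ∈ univCover, ρ * A (deck w) = A w * ρ) {w : ℂ} (hw : w ∈ univCover) :
    ρ * matDeriv A (deck w) = matDeriv A w * ρ := by
  ext i j
  have hd : ∀ i j, HasDerivAt (fun v => A (deck v) i j) (matDeriv A (deck w) i j) w := by
    intro i j
    have h1 : HasDerivAt (fun v => A (deck v) i j) (1 * matDeriv A (deck w) i j) w :=
      (hasDerivAt_entry hA (deck_mem.2 hw) i j).scomp w (hasDerivAt_deck w)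
    rwa [one_mul] at h1
  have h1 : HasDerivAt (fun v => ρ i 0 * A (deck v) 0 j + ρ i 1 * A (deck v) 1 j)
      (ρ i 0 * matDeriv A (deck w) 0 j + ρ i 1 * matDeriv A (deck w) 1 j) w :=
    ((hd 0 j).const_mul _).add ((hd 1 j).const_mul _)
  have h2 : HasDerivAt (fun v => A v i 0 * ρ 0 j + A v i 1 * ρ 1 j)
      (matDeriv A w i 0 * ρ 0 j + matDeriv A w i 1 * ρ 1 j) w :=
    ((hasDerivAt_entry hA hw i 0).mul_const _).add ((hasDerivAt_entry hA hw i 1).mul_const _)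
  rw [Matrix.mul_apply, Fin.sum_univ_two, Matrix.mul_apply, Fin.sum_univ_two]
  refine h1.unique (h2.congr_of_eventuallyEq ?_)
  filter_upwards [(isOpen_leftHalfPlane 0).mem_nhds hw] with v hv
  have := congrFun (congrFun (h v hv) i) j
  rwa [Matrix.mul_apply, Fin.sum_univ_two, Matrix.mul_apply, Fin.sum_univ_two] at this

/-- The factor σ = c g' is determined by A A' = σ A with A ≠ 0, an identity invariant under
conjugation by the constant matrix ρ. -/
theorem IsNullLift.div_gaussWronskian_deck (h : IsNullLift f F) (hρu : IsUnit ρ.det)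
    (hρ : ∀ w ∈ univCover, F (deck w) = F w * ρ) {w : ℂ} (hw : w ∈ univCover)
    (hc : maurerCartan F w 1 0 ≠ 0) (hc' : maurerCartan F (deck w) 1 0 ≠ 0) :
    gaussWronskian F (deck w) / maurerCartan F (deck w) 1 0
      = gaussWronskian F w / maurerCartan F w 1 0 := by
  have hw' : deck w ∈ univCover := deck_mem.2 hw
  have h1 := h.mul_matDeriv_maurerCartan hw hc
  have h2 := h.mul_matDeriv_maurerCartan hw' hc'
  have h3 := h.mul_maurerCartan_deck hρu hρ hw
  have h4 := mul_matDeriv_deck (ρ := ρ) h.differentiableOn_maurerCartan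
    (fun v hv => h.mul_maurerCartan_deck hρu hρ hv) hw
  set σ := gaussWronskian F w / maurerCartan F w 1 0
  set σ' := gaussWronskian F (deck w) / maurerCartan F (deck w) 1 0
  have h5 : σ' • (ρ * maurerCartan F (deck w)) = σ • (ρ * maurerCartan F (deck w)) := by
    rw [← Matrix.mul_smul, ← h2, ← Matrix.mul_assoc, h3, Matrix.mul_assoc, h4, ← Matrix.mul_assoc,
      h1, Matrix.smul_mul]
  have h6 : ρ * maurerCartan F (deck w) ≠ 0 := by
    intro h0
    apply h.maurerCartan_ne_zero hw'
    calc maurerCartan F (deck w) = ρ⁻¹ * (ρ * maurerCartan F (deck w)) := by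
          rw [← Matrix.mul_assoc, nonsing_inv_mul _ hρu, Matrix.one_mul]
      _ = 0 := by rw [h0, Matrix.mul_zero]
  exact smul_left_injective ℂ h6 h5

/-- The Schwarzian derivative with respect to `w` of a `g`-regular secondary Gauss map extends to a
bounded function near the end. -/
theorem exists_bounded_schwarzian {p : ℂ → ℂ} (hp : MeromorphicAt p 0)
    (ho : (-2 : ℤ) ≤ meromorphicOrderAt p 0) {r : ℝ} (hr : 0 < r) (hr1 : r < 1) {g : ℂ → ℂ}
    (hS : ∀ w : ℂ, ‖exp w‖ < r → AnalyticAt ℂ g w → deriv g w ≠ 0 →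
        schwarzian g w = p (exp w)) :
    ∃ R ≤ (0 : ℝ), ∃ (T : ℂ → ℂ) (M : ℝ), 0 ≤ M ∧ ContinuousOn T (leftHalfPlane R) ∧
      (∀ w ∈ leftHalfPlane R, ‖T w‖ ≤ M) ∧
      ∀ w ∈ leftHalfPlane R, AnalyticAt ℂ g w → deriv g w ≠ 0 →
        deriv (fun v => deriv (deriv g) v / deriv g v) w
          - (deriv (deriv g) w / deriv g w) ^ 2 / 2 = T w := by
  obtain ⟨q, hq, hpq⟩ := exists_analyticAt_sq_mul hp ho
  have hb : ∀ᶠ z in 𝓝 (0 : ℂ), ‖q z‖ < ‖q 0‖ + 1 :=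
    hq.continuousAt.norm.eventually_lt continuousAt_const (by simp)
  obtain ⟨S, hSS⟩ := tendsto_exp_of_left
    ((hq.eventually_analyticAt.and hb).and (eventually_nhdsWithin_iff.1 hpq))
  -- Here q(z) extends z² p(z), and the 1/2 is the correction in `schwarzian_eq`. The bound log r <
  -- 0 places exp w in the disk where the Schwarzian identity holds.
  refine ⟨min S (Real.log r), (min_le_right _ _).trans (Real.log_nonpos hr.le hr1.le),
    fun w => q (exp w) - 1 / 2, ‖q 0‖ + 1 + 1, by positivity, ?_, ?_, ?_⟩
  · intro w hw
    have h1 := (hSS w (leftHalfPlane_mono (min_le_left _ _) hw)).1.1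
    exact ((ContinuousAt.comp (f := exp) h1.continuousAt
      continuous_exp.continuousAt).sub continuousAt_const).continuousWithinAt
  · intro w hw
    have h1 := (hSS w (leftHalfPlane_mono (min_le_left _ _) hw)).1.2
    have h2 : ‖(1 / 2 : ℂ)‖ ≤ 1 := by norm_num
    exact norm_sub_le_of_le h1.le h2
  · intro w hw hg hg'
    have h1 := (hSS w (leftHalfPlane_mono (min_le_left _ _) hw)).2 (exp_ne_zero w)
    have h2 := hS w (by
      rw [norm_exp]
      exact (Real.lt_log_iff_exp_lt hr).1 (lt_of_lt_of_le hw (min_le_right _ _))) hg hg'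
    rw [schwarzian_eq hg hg'] at h2
    have h3 : exp w ^ 2 * exp (-w) ^ 2 = 1 := by
      rw [← mul_pow, ← exp_add]; simp
    change _ = q (exp w) - 1 / 2
    rw [← h1, ← h2, ← mul_assoc, h3]
    ring

/-- The frame is (g, -g²; 1, -g) / g' = A / (c g'). At poles and branch points of g it is defined by
extending solutions of the linear system, and every identity is carried there by continuity. -/
theorem IsNullLift.exists_tameFrame_of_nonconst (h : IsNullLift f F)
    (hf : ContDiffOn ℝ ∞ f puncturedDisk) (hρu : IsUnit ρ.det)
    (hρ : ∀ w ∈ univCover, F (deck w) = F w * ρ)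
    (hN : ∃ w ∈ univCover, gaussWronskian F w ≠ 0)
    {R M : ℝ} (hR : R ≤ 0) {T : ℂ → ℂ} (hM : 0 ≤ M) (hTc : ContinuousOn T (leftHalfPlane R))
    (hTM : ∀ w ∈ leftHalfPlane R, ‖T w‖ ≤ M)
    (hT : ∀ w ∈ leftHalfPlane R, AnalyticAt ℂ (secondaryGauss F) w →
      deriv (secondaryGauss F) w ≠ 0 →
        deriv (fun v => deriv (deriv (secondaryGauss F)) v / deriv (secondaryGauss F) v) w
          - (deriv (deriv (secondaryGauss F)) w / deriv (secondaryGauss F) w) ^ 2 / 2 = T w) :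
    ∃ B, TameFrame f ρ e₃ (R - 1) B := by
  have hA := h.differentiableOn_maurerCartan
  set g := secondaryGauss F with hg
  have hNd := h.differentiableOn_gaussWronskian
  -- the points where `g` is finite and unramified
  set Good : ℂ → Prop := fun w => maurerCartan F w 1 0 ≠ 0 ∧ gaussWronskian F w ≠ 0 with hGood
  have hcne : ∃ w ∈ univCover, maurerCartan F w 1 0 ≠ 0 := by
    by_contra! hc
    obtain ⟨w, hw, hne⟩ := hN
    apply hne
    have hn := (isOpen_leftHalfPlane 0).mem_nhds hw
    have hd : matDeriv (maurerCartan F) w 1 0 = 0 := by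
      refine (hasDerivAt_entry hA hw 1 0).unique
        ((hasDerivAt_const w (0 : ℂ)).congr_of_eventuallyEq ?_)
      filter_upwards [hn] with v hv using hc v hv
    rw [gaussWronskian, hc w hw, hd]; ring
  have hgoodev : ∀ w ∈ univCover, ∀ᶠ v in 𝓝[≠] w, Good v := fun w hw =>
    (eventually_ne_zero_of_exists (hA 1 0) hcne hw).and (eventually_ne_zero_of_exists hNd hN hw)
  have hgoodev' : ∀ w ∈ univCover, ∀ᶠ v in 𝓝[≠] w, Good (deck v) := by
    intro w hw
    have ht : Tendsto deck (𝓝[≠] w) (𝓝[≠] (deck w)) :=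
      tendsto_nhdsWithin_of_tendsto_nhds_of_eventually_within _
        ((hasDerivAt_deck w).continuousAt.tendsto.mono_left nhdsWithin_le_nhds)
        (eventually_nhdsWithin_of_forall fun v hv hv' => hv (by
          simpa [deck] using hv'))
    exact ht.eventually (hgoodev _ (deck_mem.2 hw))
  have hsub : leftHalfPlane R ⊆ univCover := leftHalfPlane_mono hR
  have hsub1 : leftHalfPlane (R - 1) ⊆ leftHalfPlane R := leftHalfPlane_mono (by linarith)
  have hga : ∀ w ∈ univCover, Good w → AnalyticAt ℂ g w ∧
      deriv g w = gaussWronskian F w / maurerCartan F w 1 0 ^ 2 := fun w hw hG =>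
    ⟨h.analyticAt_secondaryGauss hw hG.1, (h.hasDerivAt_secondaryGauss hw hG.1).deriv⟩
  have hgval : ∀ w, g w = maurerCartan F w 0 0 / maurerCartan F w 1 0 := fun w => rfl
  have hext : ∀ α β γ : ℂ, ∃ X : ℂ → ℂ, DifferentiableOn ℂ X (leftHalfPlane R) ∧
      ExpGrowth X (R - 1) ∧ ∀ w ∈ leftHalfPlane R, Good w →
        X w = (α * g w ^ 2 + β * g w + γ) / deriv g w := by
    intro α β γ
    obtain ⟨Y₀, Z₀, hsol₀⟩ := exists_solvesAt_quadratic_div_deriv g T α β γ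
    have hsol : ∀ w ∈ leftHalfPlane R, Good w →
        SolvesAt T (fun v => (α * g v ^ 2 + β * g v + γ) / deriv g v) Y₀ Z₀ w := by
      intro w hw hG
      obtain ⟨h1, h2⟩ := hga w (hsub hw) hG
      have h3 : deriv g w ≠ 0 := by rw [h2]; exact div_ne_zero hG.2 (pow_ne_zero 2 hG.1)
      exact hsol₀ w h1 h3 (hT w hw h1 h3)
    obtain ⟨X, Y, Z, hXYZ, hX⟩ := exists_solvesAt_extension hM hTc hTM (fun c hc => by
      filter_upwards [hgoodev c (hsub hc),
        nhdsWithin_le_nhds ((isOpen_leftHalfPlane R).mem_nhds hc)] with w hw hwR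
      exact hsol w hwR hw)
    exact ⟨X, fun w hw => (hXYZ w hw).fst.differentiableAt.differentiableWithinAt,
      expGrowth_of_solvesAt hM hTM hXYZ, fun w hw hG => hX w (hsol w hw hG)⟩
  -- The three quadratics g, -g² and 1 give the entries of the frame.
  obtain ⟨x, hxd, hxg, hx⟩ := hext 0 1 0
  obtain ⟨y, hyd, hyg, hy⟩ := hext (-1) 0 0
  obtain ⟨k, hkd, hkg, hk⟩ := hext 0 0 1
  set B : ℂ → Matrix (Fin 2) (Fin 2) ℂ := fun w => !![x w, y w; k w, -x w] with hB
  have hBd : ∀ i j, DifferentiableOn ℂ (fun w => B w i j) (leftHalfPlane R) := by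
    intro i j
    fin_cases i <;> fin_cases j
    exacts [hxd, hyd, hkd, hxd.neg]
  have hBg : ∀ i j, ExpGrowth (fun w => B w i j) (R - 1) := by
    intro i j
    fin_cases i <;> fin_cases j
    · exact hxg
    · exact hyg
    · exact hkg
    · have := (expGrowth_const (-1) (R - 1)).mul hxg
      exact (by simpa using this : ExpGrowth (fun w => -x w) (R - 1))
  have hBc : ∀ i j, ∀ w ∈ leftHalfPlane R, ContinuousAt (fun w => B w i j) w := fun i j w hw =>
    ((hBd i j).differentiableAt ((isOpen_leftHalfPlane R).mem_nhds hw)).continuousAt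
  have hAc : ∀ i j, ∀ w ∈ univCover, ContinuousAt (fun w => maurerCartan F w i j) w :=
    fun i j w hw => (hasDerivAt_entry hA hw i j).continuousAt
  have hBA : ∀ w ∈ leftHalfPlane R, Good w →
      B w = (gaussWronskian F w / maurerCartan F w 1 0)⁻¹ • maurerCartan F w := by
    intro w hw hG
    obtain ⟨e3, e4⟩ := h.isNilpotentTwo_maurerCartan (hsub hw)
    obtain ⟨-, hg'⟩ := hga w (hsub hw) hG
    have ex := hx w hw hG
    have ey := hy w hw hG
    have ek := hk w hw hG
    rw [hg', hgval] at ex ey ek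
    obtain ⟨hc, hNw⟩ := hG
    simp only [hB]
    ext i j
    fin_cases i <;> fin_cases j <;> simp [ex, ey, ek, e3] <;> field_simp
    linear_combination -e4
  have hmemR : ∀ w ∈ leftHalfPlane R, ∀ᶠ v in 𝓝[≠] w, v ∈ leftHalfPlane R := fun w hw =>
    nhdsWithin_le_nhds ((isOpen_leftHalfPlane R).mem_nhds hw)
  refine ⟨B, h.tameFrame hf (by linarith) (fun i j => (hBd i j).mono hsub1) hBg ?_ ?_ ?_⟩
  · intro w hw
    replace hw := hsub1 hw
    have hcd : ∀ i j, ContinuousAt (fun w => B (deck w) i j) w := fun i j =>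
      ContinuousAt.comp (f := deck) (hBc i j _ (deck_mem.2 hw)) (hasDerivAt_deck w).continuousAt
    ext i j
    refine eq_of_eventually_eq_nhdsNE (φ := fun w => (ρ * B (deck w)) i j)
      (ψ := fun w => (B w * ρ) i j) ?_ ?_ ?_
    · simp only [Matrix.mul_apply, Fin.sum_univ_two]
      exact (continuousAt_const.mul (hcd 0 j)).add (continuousAt_const.mul (hcd 1 j))
    · simp only [Matrix.mul_apply, Fin.sum_univ_two]
      exact ((hBc i 0 w hw).mul continuousAt_const).add ((hBc i 1 w hw).mul continuousAt_const)
    · filter_upwards [hgoodev w (hsub hw), hgoodev' w (hsub hw), hmemR w hw] with v hv hv' hvR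
      rw [hBA v hvR hv, hBA _ (deck_mem.2 hvR) hv',
        h.div_gaussWronskian_deck hρu hρ (hsub hvR) hv.1 hv'.1, Matrix.mul_smul, Matrix.smul_mul,
        h.mul_maurerCartan_deck hρu hρ (hsub hvR)]
  · intro w hw
    replace hw := hsub1 hw
    -- Proportionality of B and A stated as vanishing minors, which passes to the limit at bad
    -- points. Since A ≠ 0 there, the scalar is recovered afterwards.
    have hcross : ∀ i j i' j', B w i j * maurerCartan F w i' j'
        = maurerCartan F w i j * B w i' j' := by
      intro i j i' j'
      refine eq_of_eventually_eq_nhdsNE (φ := fun w => B w i j * maurerCartan F w i' j')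
        (ψ := fun w => maurerCartan F w i j * B w i' j')
        ((hBc i j w hw).mul (hAc i' j' w (hsub hw)))
        ((hAc i j w (hsub hw)).mul (hBc i' j' w hw)) ?_
      filter_upwards [hgoodev w (hsub hw), hmemR w hw] with v hv hvR
      rw [hBA v hvR hv]
      simp only [Matrix.smul_apply, smul_eq_mul]; ring
    obtain ⟨i', j', hne⟩ : ∃ i' j', maurerCartan F w i' j' ≠ 0 := by
      by_contra! h0
      exact h.maurerCartan_ne_zero (hsub hw) (by ext i j; simpa using h0 i j)
    refine ⟨B w i' j' / maurerCartan F w i' j', ?_⟩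
    ext i j
    rw [Matrix.smul_apply, smul_eq_mul, div_mul_eq_mul_div, eq_div_iff hne, hcross i j i' j']
    ring
  · set w₀ : ℂ := ((R - 2 : ℝ) : ℂ) with hw₀
    have hw₀m : w₀ ∈ leftHalfPlane (R - 1) := by
      simp only [leftHalfPlane, Set.mem_ofPred_eq, hw₀, ofReal_re]; linarith
    obtain ⟨v, hv, hvR⟩ := ((hgoodev w₀ (hsub (hsub1 hw₀m))).and
      (nhdsWithin_le_nhds ((isOpen_leftHalfPlane (R - 1)).mem_nhds hw₀m))).exists
    refine ⟨v, hvR, ?_⟩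
    rw [hBA v (hsub1 hvR) hv]
    exact smul_ne_zero (inv_ne_zero (div_ne_zero hv.2 hv.1))
      (h.maurerCartan_ne_zero (hsub (hsub1 hvR)))

/-- A `g`-regular end has a null lift with a tame frame. -/
theorem IsGRegular.exists_tameFrame (hreg : IsGRegular f) (hf : ContDiffOn ℝ ∞ f puncturedDisk) :
    ∃ F, IsNullLift f F ∧ ∃ ρ ∈ SU11, (∀ w ∈ univCover, F (deck w) = F w * ρ) ∧
      ∃ R B, TameFrame f ρ e₃ R B := by
  obtain ⟨F, h, p, hp, ho, r, hr, hr1, hS⟩ := hreg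
  obtain ⟨ρ, hρ, hFρ⟩ := h.exists_monodromy
  refine ⟨F, h, ρ, hρ, hFρ, ?_⟩
  by_cases hN : ∃ w ∈ univCover, gaussWronskian F w ≠ 0
  · obtain ⟨R, hR, T, M, hM, hTc, hTM, hT⟩ := exists_bounded_schwarzian hp ho hr hr1 hS
    exact ⟨R - 1, h.exists_tameFrame_of_nonconst hf (SU11.isUnit_det hρ) hFρ hN hR hM hTc hTM hT⟩
  · push Not at hN
    exact ⟨0, h.exists_tameFrame_of_const hf (SU11.isUnit_det hρ) hFρ hN⟩

end

end

end CMC1Face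

namespace CMC1Face

noncomputable section

open Complex Matrix Filter Topology
open scoped ContDiff

/-! ### Singular points on rays -/

theorem not_forall_infinite_of_ray {s : Set ℂ} {θ S : ℝ}
    (h : ∀ w ∈ leftHalfPlane S, w.im = θ → exp w ∉ s) :
    ¬ ∀ θ r : ℝ, 0 < r →
      {t : ℝ | 0 < t ∧ t < r ∧ (t : ℂ) * exp (θ * I) ∈ s}.Infinite := by
  intro hinf
  obtain ⟨t, ht0, htr, hts⟩ := (hinf θ (Real.exp S) (Real.exp_pos S)).nonempty
  refine h ((Real.log t : ℝ) + θ * I) ?_ (by simp) ?_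
  · simp only [leftHalfPlane, Set.mem_ofPred_eq, add_re, ofReal_re, mul_re, I_re, ofReal_im, I_im]
    have := (Real.log_lt_iff_lt_exp ht0).2 htr
    linarith
  · rwa [exp_add, ← ofReal_exp, Real.exp_log ht0]

theorem infinite_of_forall_exists {s : Set ℂ}
    (h : ∀ θ S : ℝ, ∃ w ∈ leftHalfPlane S, w.im = θ ∧ exp w ∈ s) :
    ∀ θ r : ℝ, 0 < r →
      {t : ℝ | 0 < t ∧ t < r ∧ (t : ℂ) * exp (θ * I) ∈ s}.Infinite := by
  intro θ r hr
  have key : ∀ r' : ℝ, 0 < r' → ∃ t : ℝ, 0 < t ∧ t < r' ∧ (t : ℂ) * exp (θ * I) ∈ s := by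
    intro r' hr'
    obtain ⟨w, hw, hwθ, hws⟩ := h θ (Real.log r')
    refine ⟨Real.exp w.re, Real.exp_pos _, (Real.lt_log_iff_exp_lt hr').1 hw, ?_⟩
    rwa [ofReal_exp, ← exp_add, ← hwθ, re_add_im]
  intro hfin
  obtain ⟨t₁, ht₁, ht₁r, ht₁s⟩ := key r hr
  -- A finite set of radii would have a least element, but there is a singular point still closer to
  -- the puncture.
  obtain ⟨t₀, ⟨ht₀, ht₀r, _⟩, hmin⟩ := Set.exists_min_image _ id hfin ⟨t₁, ht₁, ht₁r, ht₁s⟩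
  obtain ⟨t, ht, htt, hts⟩ := key t₀ ht₀
  exact absurd (hmin t ⟨ht, htt.trans ht₀r, hts⟩) (not_le.2 htt)

/-- On the ray of angle θ the monomial zⁿ has phase nθ, so for n ≠ 0 a ray can be chosen that turns
c into any prescribed direction. -/
theorem exists_angle {n : ℤ} (hn : n ≠ 0) (c : ℂ) {u : ℂ} (hu : ‖u‖ = 1) :
    ∃ θ : ℝ, exp ((n * θ : ℝ) * I) * c = ‖c‖ * u := by
  refine ⟨(arg u - arg c) / n, ?_⟩
  have hn' : (n : ℝ) ≠ 0 := by exact_mod_cast hn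
  rw [mul_div_cancel₀ _ hn']
  have hu' : exp (arg u * I) = u := by
    have := norm_mul_exp_arg_mul_I u
    rwa [hu, ofReal_one, one_mul] at this
  calc exp ((arg u - arg c : ℝ) * I) * c
      = exp ((arg u - arg c : ℝ) * I) * (‖c‖ * exp (arg c * I)) := by
        rw [norm_mul_exp_arg_mul_I]
    _ = ‖c‖ * exp (arg u * I) := by
        rw [mul_left_comm, ← exp_add]; congr 2; push_cast; ring
    _ = ‖c‖ * u := by rw [hu']

section

variable {f : ℂ → Fin 4 → ℝ} {ρ E : Matrix (Fin 2) (Fin 2) ℂ} {R : ℝ}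
  {B : ℂ → Matrix (Fin 2) (Fin 2) ℂ}

/-- B has rank one: its second column is a multiple of the first, so B* E B vanishes as soon as the
first column is E-isotropic. -/
theorem TameFrame.singular_iff_of_ne_zero (h : TameFrame f ρ E R B) {w : ℂ}
    (hw : w ∈ leftHalfPlane R) (hk : B w 1 0 ≠ 0) :
    exp w ∈ singularSet f ↔ star (B w 0 0) * (E 0 0 * B w 0 0 + E 0 1 * B w 1 0)
      + star (B w 1 0) * (E 1 0 * B w 0 0 + E 1 1 * B w 1 0) = 0 := by
  have hne : B w ≠ 0 := by
    intro h0; apply hk; rw [h0]; rfl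
  rw [h.singular_iff w hw hne]
  obtain ⟨h1, h2⟩ := h.nilpotent w hw
  have e00 : ((B w)ᴴ * E * B w) 0 0 = star (B w 0 0) * (E 0 0 * B w 0 0 + E 0 1 * B w 1 0)
      + star (B w 1 0) * (E 1 0 * B w 0 0 + E 1 1 * B w 1 0) := by
    simp [Matrix.mul_apply, Fin.sum_univ_two, conjTranspose_apply]; ring
  set u : ℂ := -B w 0 0 / B w 1 0 with hu
  have h01 : B w 0 1 = B w 0 0 * u := by
    rw [hu]; field_simp; linear_combination h2
  have h11 : B w 1 1 = B w 1 0 * u := by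
    rw [hu, h1]; field_simp
  constructor
  · intro h0
    rw [← e00, h0]; rfl
  · intro h0
    have hB : B w = (Matrix.of ![![B w 0 0, 0], ![B w 1 0, 0]]) * !![1, u; 0, 0] := by
      ext i j
      fin_cases i <;> fin_cases j <;> simp [Matrix.mul_apply, Fin.sum_univ_two, h01, h11]
    have hV : (Matrix.of ![![B w 0 0, 0], ![B w 1 0, 0]])ᴴ * E *
        (Matrix.of ![![B w 0 0, 0], ![B w 1 0, 0]]) = 0 := by
      ext i j
      fin_cases i <;> fin_cases j <;>
        simp [Matrix.mul_apply, Fin.sum_univ_two, conjTranspose_apply]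
      simp only [star_def] at h0
      linear_combination h0
    rw [hB, conjTranspose_mul]
    calc _ = (!![1, u; 0, 0] : Matrix (Fin 2) (Fin 2) ℂ)ᴴ *
          ((Matrix.of ![![B w 0 0, 0], ![B w 1 0, 0]])ᴴ * E *
          (Matrix.of ![![B w 0 0, 0], ![B w 1 0, 0]])) * !![1, u; 0, 0] := by
          simp only [Matrix.mul_assoc]
      _ = 0 := by rw [hV]; simp

theorem TameFrame.eq_of_lower_zero (h : TameFrame f ρ E R B)
    (hk : ∀ w ∈ leftHalfPlane R, B w 1 0 = 0) {w : ℂ} (hw : w ∈ leftHalfPlane R) :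
    B w = !![0, B w 0 1; 0, 0] := by
  obtain ⟨h1, h2⟩ := h.nilpotent w hw
  have h3 := hk w hw
  have h4 : B w 0 0 = 0 := by
    rw [h3, mul_zero, neg_zero] at h2
    simpa using h2
  ext i j
  fin_cases i <;> fin_cases j <;> simp [h1, h3, h4]

theorem TameFrame.exists_upper_ne_zero (h : TameFrame f ρ E R B)
    (hk : ∀ w ∈ leftHalfPlane R, B w 1 0 = 0) : ∃ w ∈ leftHalfPlane R, B w 0 1 ≠ 0 := by
  obtain ⟨w, hw, hne⟩ := h.exists_ne_zero
  refine ⟨w, hw, fun h0 => hne ?_⟩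
  rw [h.eq_of_lower_zero hk hw, h0]
  ext i j; fin_cases i <;> fin_cases j <;> rfl

/-- This is the case g = ∞ in the chosen basis: the image of B is the first coordinate line, which
is isotropic exactly when E₀₀ = 0. -/
theorem TameFrame.singular_iff_of_lower_zero (h : TameFrame f ρ E R B)
    (hk : ∀ w ∈ leftHalfPlane R, B w 1 0 = 0) {w : ℂ} (hw : w ∈ leftHalfPlane R)
    (hy : B w 0 1 ≠ 0) : exp w ∈ singularSet f ↔ E 0 0 = 0 := by
  have hne : B w ≠ 0 := by
    intro h0; apply hy; rw [h0]; rfl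
  rw [h.singular_iff w hw hne]
  have e := h.eq_of_lower_zero hk hw
  have e11 : ((B w)ᴴ * E * B w) = !![0, 0; 0, star (B w 0 1) * E 0 0 * B w 0 1] := by
    rw [e]
    ext i j
    fin_cases i <;> fin_cases j <;>
      simp [Matrix.mul_apply, Fin.sum_univ_two, conjTranspose_apply]
  rw [e11]
  constructor
  · intro h0
    have := congrFun (congrFun h0 1) 1
    simpa [hy] using this
  · intro h0
    rw [h0]
    ext i j; fin_cases i <;> fin_cases j <;> simp

/-- The normal form of a twisted periodic entry of a tame frame. -/
theorem TameFrame.entry_normalForm (h : TameFrame f ρ E R B) {i j : Fin 2} {κ : ℂ}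
    (hp : ∀ w ∈ leftHalfPlane R, B (deck w) i j = exp (2 * Real.pi * I * κ) * B w i j)
    (hne : ∃ w ∈ leftHalfPlane R, B w i j ≠ 0) :
    ∃ (m : ℤ) (q : ℂ → ℂ), AnalyticAt ℂ q 0 ∧ q 0 ≠ 0 ∧ ∃ S ≤ R, ∀ w ∈ leftHalfPlane S,
      B w i j = exp ((κ + m) * w) * q (exp w) ∧ B w i j ≠ 0 := by
  obtain ⟨m, q, hq, hq0, S, hS, hB⟩ := exists_normalForm (h.holomorphic i j) (h.growth i j) hp hne
  obtain ⟨T, hT⟩ := tendsto_exp_of_left (hq.continuousAt.eventually_ne hq0)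
  refine ⟨m, q, hq, hq0, min S T, (min_le_left _ _).trans hS, fun w hw => ?_⟩
  have h1 := hB w (leftHalfPlane_mono (min_le_left _ _) hw)
  refine ⟨h1, ?_⟩
  rw [h1]
  exact mul_ne_zero (exp_ne_zero _) (hT w (leftHalfPlane_mono (min_le_right _ _) hw))

/-- The quotient of two normal forms. -/
theorem exists_quotient_normalForm {X Y : ℂ → ℂ} {κ κ' : ℂ} {m m' : ℤ} {q q' : ℂ → ℂ} {S S' : ℝ}
    (hq : AnalyticAt ℂ q 0) (hq0 : q 0 ≠ 0) (hq' : AnalyticAt ℂ q' 0) (hq0' : q' 0 ≠ 0)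
    (hX : ∀ w ∈ leftHalfPlane S, X w = exp ((κ + m) * w) * q (exp w))
    (hY : ∀ w ∈ leftHalfPlane S', Y w = exp ((κ' + m') * w) * q' (exp w) ∧ Y w ≠ 0) :
    ∃ p : ℂ → ℂ, AnalyticAt ℂ p 0 ∧ p 0 ≠ 0 ∧ ∀ w ∈ leftHalfPlane (min S S'),
      X w / Y w = exp ((κ - κ' + (m - m' : ℤ)) * w) * p (exp w) := by
  refine ⟨fun z => q z / q' z, hq.div hq' hq0', div_ne_zero hq0 hq0', fun w hw => ?_⟩
  have h1 := hX w (leftHalfPlane_mono (min_le_left _ _) hw)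
  obtain ⟨h2, h3⟩ := hY w (leftHalfPlane_mono (min_le_right _ _) hw)
  rw [h2] at h3
  rw [h1, h2, div_eq_iff h3]
  have h4 : q' (exp w) ≠ 0 := right_ne_zero_of_mul h3
  have h5 : exp ((κ + m) * w) = exp ((κ - κ' + (m - m' : ℤ)) * w) * exp ((κ' + m') * w) := by
    rw [← exp_add]; congr 1; push_cast; ring
  rw [h5]; field_simp

end

/-! ### Functions `exp(κw) p(exp w)` on rays -/

section

variable {p : ℂ → ℂ}

/-- A nonconstant germ avoids the unit circle along some ray. -/
theorem exists_ray_norm_ne_one (hp : AnalyticAt ℂ p 0)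
    (hc : ¬ ∀ᶠ z in 𝓝 (0 : ℂ), p z = p 0) :
    ∃ θ S : ℝ, ∀ w ∈ leftHalfPlane S, w.im = θ → ‖p (exp w)‖ ≠ 1 := by
  by_cases h1 : ‖p 0‖ = 1
  · have hsub : AnalyticAt ℂ (fun z => p z - p 0) 0 := hp.sub analyticAt_const
    obtain ⟨n, r, hr, hr0, hpr⟩ := hsub.exists_eventuallyEq_pow_smul_nonzero_iff.2 (by
      simpa [sub_eq_zero] using hc)
    have hn : n ≠ 0 := by
      rintro rfl
      have := hpr.self_of_nhds
      simp at this
      exact hr0 this.symm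
    have hp0 : p 0 ≠ 0 := by
      intro h0; rw [h0] at h1; simp at h1
    -- With p = p(0) + zⁿ r(z) and |p(0)| = 1, this ray makes the leading correction point radially
    -- outward at p(0), so that |p| > 1 along it.
    obtain ⟨θ, hθ⟩ := exists_angle (n := n) (by exact_mod_cast hn) (star (p 0) * r 0) (u := 1) (by simp)
    set φ : ℂ → ℂ := fun z => exp (((n : ℤ) * θ : ℝ) * I) * (star (p 0) * r z) with hφ
    have hφ0 : 0 < (φ 0).re := by
      simp only [hφ, hθ, mul_one, ofReal_re]
      exact norm_pos_iff.2 (mul_ne_zero (star_ne_zero.2 hp0) hr0)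
    have hφc : ContinuousAt (fun z => (φ z).re) 0 :=
      continuous_re.continuousAt.comp
        (continuousAt_const.mul (continuousAt_const.mul hr.continuousAt))
    obtain ⟨S, hS⟩ := tendsto_exp_of_left (hpr.and (hφc.eventually (lt_mem_nhds hφ0)))
    refine ⟨θ, S, fun w hw hwθ => ?_⟩
    obtain ⟨e1, e2⟩ := hS w hw
    rw [sub_zero, smul_eq_mul] at e1
    have e3 : exp w ^ n = Real.exp (n * w.re) * exp (((n : ℤ) * θ : ℝ) * I) := by
      rw [← exp_nat_mul, ofReal_exp, ← exp_add]
      congr 1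
      rw [← hwθ]
      conv_lhs => rw [← re_add_im w]
      push_cast; ring
    have e4 : star (p 0) * p (exp w) = 1 + Real.exp (n * w.re) * φ (exp w) := by
      have h2 : star (p 0) * p 0 = 1 := by
        rw [star_def, mul_comm, mul_conj, normSq_eq_norm_sq, h1]; simp
      simp only [hφ]
      rw [e3] at e1
      linear_combination star (p 0) * e1 + h2
    have e5 : 1 < (star (p 0) * p (exp w)).re := by
      rw [e4, add_re, one_re, re_ofReal_mul]
      have := mul_pos (Real.exp_pos (n * w.re)) e2
      linarith
    have e6 : ‖star (p 0) * p (exp w)‖ = ‖p (exp w)‖ := by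
      rw [norm_mul, norm_star, h1, one_mul]
    have e7 := re_le_norm (star (p 0) * p (exp w))
    rw [e6] at e7
    exact (lt_of_lt_of_le e5 e7).ne'
  · obtain ⟨S, hS⟩ := tendsto_exp_of_left (hp.continuousAt.norm.eventually_ne h1)
    exact ⟨0, S, fun w hw _ => hS w hw⟩

/-- The logarithm of the modulus is δ Re w plus a bounded term, hence nonzero far to the left. -/
theorem exists_norm_exp_mul_ne_one (hp : AnalyticAt ℂ p 0) (hp0 : p 0 ≠ 0) {δ : ℝ} (hδ : δ ≠ 0) :
    ∃ S : ℝ, ∀ w ∈ leftHalfPlane S, ‖exp (δ * w) * p (exp w)‖ ≠ 1 := by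
  have hc : ContinuousAt (fun z => |Real.log ‖p z‖|) 0 :=
    (hp.continuousAt.norm.log (norm_ne_zero_iff.2 hp0)).abs
  obtain ⟨S, hS⟩ := tendsto_exp_of_left ((hc.eventually (gt_mem_nhds (lt_add_one _))).and
    (hp.continuousAt.eventually_ne hp0))
  set M := |Real.log ‖p 0‖| + 1 with hM
  have hM0 : 0 ≤ M := by positivity
  have hδ0 : 0 < |δ| := abs_pos.2 hδ
  refine ⟨min S (-(M / |δ|)), fun w hw h1 => ?_⟩
  obtain ⟨h2, h3⟩ := hS w (leftHalfPlane_mono (min_le_left _ _) hw)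
  have h4 : w.re < -(M / |δ|) := lt_of_lt_of_le hw (min_le_right _ _)
  have h5 : δ * w.re + Real.log ‖p (exp w)‖ = 0 := by
    have := congrArg Real.log h1
    rw [norm_mul, norm_exp, Real.log_mul (Real.exp_pos _).ne' (norm_ne_zero_iff.2 h3),
      Real.log_exp, Real.log_one, re_ofReal_mul] at this
    exact this
  have h6 : |δ| * |w.re| < M := by
    rw [← abs_mul, show δ * w.re = -Real.log ‖p (exp w)‖ by linarith, abs_neg]
    exact h2
  have h7 : M / |δ| < |w.re| := by
    have := neg_le_abs w.re
    linarith
  rw [div_lt_iff₀ hδ0] at h7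
  linarith

/-- Adding `s w / (πi)`, with `s ≠ 0` real, to `exp(jw) p(exp w)`, with `j` an integer, gives
nonreal values along some ray. -/
theorem exists_ray_im_ne_zero (hp : AnalyticAt ℂ p 0) (hp0 : p 0 ≠ 0) {s : ℝ} (hs : s ≠ 0)
    (j : ℤ) : ∃ θ S : ℝ, ∀ w ∈ leftHalfPlane S, w.im = θ →
      (s / (Real.pi * I) * w + exp (j * w) * p (exp w)).im ≠ 0 := by
  -- Far to the left this imaginary part has the sign of s and is unbounded.
  have him : ∀ w : ℂ, (s / (Real.pi * I) * w : ℂ).im = -(s * w.re / Real.pi) := by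
    intro w
    have : (s / (Real.pi * I) * w : ℂ) = ((s / Real.pi : ℝ) : ℂ) * (-I * w) := by
      have : (Real.pi : ℂ) ≠ 0 := by exact_mod_cast Real.pi_ne_zero
      push_cast
      field_simp
      linear_combination (s : ℂ) * w * I_sq
    rw [this, im_ofReal_mul]
    simp; ring
  have hpi := Real.pi_pos
  -- For j = 0 the second term is bounded and the linear term wins on every ray. For j < 0 the
  -- second term may dominate, so for j ≠ 0 the ray is chosen to give it an imaginary part of the
  -- sign of s as well.
  by_cases hj : j = 0
  · subst hj
    obtain ⟨S, hS⟩ := tendsto_exp_of_left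
      (hp.continuousAt.norm.eventually (gt_mem_nhds (lt_add_one _)))
    set M := ‖p 0‖ + 1 with hM
    have hs0 : 0 < |s| := abs_pos.2 hs
    refine ⟨0, min S (-(M * Real.pi / |s|)), fun w hw _ h0 => ?_⟩
    have h1 := hS w (leftHalfPlane_mono (min_le_left _ _) hw)
    have h2 : w.re < -(M * Real.pi / |s|) := lt_of_lt_of_le hw (min_le_right _ _)
    rw [add_im, him] at h0
    simp only [Int.cast_zero, zero_mul, exp_zero, one_mul] at h0
    have h3 : |s * w.re / Real.pi| < M := by
      rw [show s * w.re / Real.pi = (p (exp w)).im by linarith]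
      exact (abs_im_le_norm _).trans_lt h1
    rw [abs_div, abs_mul, abs_of_pos hpi, div_lt_iff₀ hpi] at h3
    have h7 : M * Real.pi / |s| < |w.re| := by
      have := neg_le_abs w.re
      linarith
    rw [div_lt_iff₀ hs0] at h7
    linarith
  · set σ : ℝ := s / |s| with hσ
    have hs0 : 0 < |s| := abs_pos.2 hs
    have hσn : ‖(σ * I : ℂ)‖ = 1 := by
      rw [norm_mul, norm_I, mul_one, norm_real, hσ, norm_div, Real.norm_eq_abs, Real.norm_eq_abs,
        abs_abs, div_self hs0.ne']
    obtain ⟨θ, hθ⟩ := exists_angle hj (p 0) hσn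
    have hφ0 : 0 < s * (exp ((j * θ : ℝ) * I) * p 0).im := by
      rw [hθ]
      have : s * σ = |s| := by
        rw [hσ]; field_simp; rw [sq_abs]
      have h2 : ((‖p 0‖ : ℂ) * (σ * I)).im = ‖p 0‖ * σ := by simp
      rw [h2, mul_left_comm, this]
      exact mul_pos (norm_pos_iff.2 hp0) hs0
    have hφc : ContinuousAt (fun z => s * (exp ((j * θ : ℝ) * I) * p z).im) 0 :=
      continuousAt_const.mul (continuous_im.continuousAt.comp
        (continuousAt_const.mul hp.continuousAt))
    obtain ⟨S, hS⟩ := tendsto_exp_of_left (hφc.eventually (lt_mem_nhds hφ0))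
    refine ⟨θ, min S 0, fun w hw hwθ h0 => ?_⟩
    have h1 := hS w (leftHalfPlane_mono (min_le_left _ _) hw)
    have h2 : w.re < 0 := lt_of_lt_of_le hw (min_le_right _ _)
    have h3 : exp (j * w) = Real.exp (j * w.re) * exp ((j * θ : ℝ) * I) := by
      rw [ofReal_exp, ← exp_add]
      congr 1
      rw [← hwθ]
      conv_lhs => rw [← re_add_im w]
      push_cast; ring
    rw [add_im, him, h3, mul_assoc, im_ofReal_mul] at h0
    have h4 : 0 < Real.exp (j * w.re) * (s * (exp ((j * θ : ℝ) * I) * p (exp w)).im) :=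
      mul_pos (Real.exp_pos _) h1
    have h5 : 0 ≤ s * (-(s * w.re / Real.pi)) := by
      have : s * (-(s * w.re / Real.pi)) = s ^ 2 * (-w.re) / Real.pi := by ring
      rw [this]
      have : 0 < -w.re := by linarith
      positivity
    have h6 : s * (-(s * w.re / Real.pi)) +
        Real.exp (j * w.re) * (s * (exp ((j * θ : ℝ) * I) * p (exp w)).im) = 0 := by
      linear_combination s * h0
    linarith

/-- A function `exp(κw) p(exp w)` with `Im κ > 0` takes imaginary values on every ray arbitrarily
near the puncture. -/
theorem exists_re_eq_zero_on_ray (hp : AnalyticAt ℂ p 0) (hp0 : p 0 ≠ 0) {κ : ℂ} {n : ℤ}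
    {τ : ℝ} (hτ : 0 < τ) (hκ : κ = n + τ * I) (θ S : ℝ) :
    ∃ w ∈ leftHalfPlane S, w.im = θ ∧ (exp (κ * w) * p (exp w)).re = 0 := by
  set φ := arg (p 0) with hφ
  have hpos : 0 < (exp (-φ * I) * p 0).re := by
    conv in p 0 => rw [← norm_mul_exp_arg_mul_I (p 0)]
    rw [mul_left_comm, ← exp_add, hφ, show -(arg (p 0) : ℂ) * I + arg (p 0) * I = 0 by ring,
      exp_zero, mul_one, ofReal_re]
    exact norm_pos_iff.2 hp0
  have hcr : ContinuousAt (fun z => (exp (-φ * I) * p z).re) 0 :=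
    continuous_re.continuousAt.comp (continuousAt_const.mul hp.continuousAt)
  obtain ⟨S₁, hS₁⟩ := tendsto_exp_of_left
    ((hcr.eventually (lt_mem_nhds hpos)).and hp.eventually_analyticAt)
  -- The positive modulus of exp(κw) is dropped; only the phase nθ + τx matters for the zeros.
  set ψ : ℝ → ℝ := fun x => (exp ((n * θ + τ * x : ℝ) * I) * p (exp (x + θ * I))).re with hψ
  have hmem : ∀ x : ℝ, x < S₁ → (x + θ * I : ℂ) ∈ leftHalfPlane S₁ := fun x hx => by
    simpa [leftHalfPlane] using hx
  have hψc : ∀ x : ℝ, x < S₁ → ContinuousAt ψ x := by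
    intro x hx
    have h1 : ContinuousAt p (exp (x + θ * I)) := (hS₁ _ (hmem x hx)).2.continuousAt
    have h2 : ContinuousAt (fun x : ℝ => exp (x + θ * I : ℂ)) x := by fun_prop
    have h3 : ContinuousAt (fun x : ℝ => p (exp (x + θ * I))) x :=
      ContinuousAt.comp (f := fun x : ℝ => exp (x + θ * I : ℂ)) h1 h2
    have h4 : ContinuousAt (fun x : ℝ => exp ((n * θ + τ * x : ℝ) * I)) x := by fun_prop
    exact continuous_re.continuousAt.comp (h4.mul h3)
  -- At X j the phase together with φ = arg p(0) equals -jπ, so ψ has sign (-1)ʲ once p(z) is close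
  -- to p(0). As τ > 0, large j means near the puncture.
  set X : ℤ → ℝ := fun j => (-(j * Real.pi) - φ - n * θ) / τ with hX
  have hψX : ∀ j : ℤ, ψ (X j) =
      (exp (-((j : ℂ) * Real.pi) * I) * (exp (-φ * I) * p (exp (X j + θ * I)))).re := by
    intro j
    simp only [hψ]
    rw [← mul_assoc, ← exp_add]
    congr 3
    have : n * θ + τ * X j = -(j * Real.pi) - φ := by simp only [hX]; field_simp; ring
    rw [this]; push_cast; ring
  obtain ⟨N, hN⟩ := exists_nat_gt ((-(φ + n * θ) - τ * min S S₁) / Real.pi)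
  have hpi := Real.pi_pos
  have hXlt : ∀ j : ℤ, (N : ℤ) ≤ j → X j < min S S₁ := by
    intro j hj
    have hj' : (N : ℝ) ≤ j := by exact_mod_cast hj
    rw [div_lt_iff₀ hpi] at hN
    simp only [hX]
    rw [div_lt_iff₀ hτ]
    nlinarith
  have hb : X (2 * N) < min S S₁ := hXlt _ (by omega)
  have ha : X (2 * N + 1) < min S S₁ := hXlt _ (by omega)
  have hab : X (2 * N + 1) ≤ X (2 * N) := by
    simp only [hX]
    push_cast
    gcongr
    linarith
  have hψb : 0 < ψ (X (2 * N)) := by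
    rw [hψX]
    have : exp (-(((2 * N : ℤ) : ℂ) * Real.pi) * I) = 1 := by
      rw [exp_eq_one_iff]; exact ⟨-N, by push_cast; ring⟩
    rw [this, one_mul]
    exact (hS₁ _ (hmem _ (lt_of_lt_of_le hb (min_le_right _ _)))).1
  have hψa : ψ (X (2 * N + 1)) < 0 := by
    rw [hψX]
    have : exp (-(((2 * N + 1 : ℤ) : ℂ) * Real.pi) * I) = -1 := by
      have h1 : exp (-(((2 * N : ℤ) : ℂ) * Real.pi) * I) = 1 := by
        rw [exp_eq_one_iff]; exact ⟨-N, by push_cast; ring⟩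
      have h2 : -(((2 * N + 1 : ℤ) : ℂ) * Real.pi) * I
          = -(((2 * N : ℤ) : ℂ) * Real.pi) * I + -(Real.pi * I) := by push_cast; ring
      rw [h2, exp_add, h1, exp_neg, exp_pi_mul_I]; norm_num
    rw [this, neg_one_mul, neg_re, neg_lt_zero]
    exact (hS₁ _ (hmem _ (lt_of_lt_of_le ha (min_le_right _ _)))).1
  have hcont : ContinuousOn ψ (Set.Icc (X (2 * N + 1)) (X (2 * N))) := fun x hx =>
    (hψc x (lt_of_le_of_lt hx.2 (lt_of_lt_of_le hb (min_le_right _ _)))).continuousWithinAt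
  obtain ⟨x, hx, hx0⟩ := intermediate_value_Icc hab hcont ⟨hψa.le, hψb.le⟩
  refine ⟨x + θ * I, ?_, by simp, ?_⟩
  · have : x < S := lt_of_le_of_lt hx.2 (lt_of_lt_of_le hb (min_le_left _ _))
    simpa [leftHalfPlane] using this
  · have h1 : exp (κ * (x + θ * I)) =
        Real.exp (n * x - τ * θ) * exp ((n * θ + τ * x : ℝ) * I) := by
      rw [ofReal_exp, ← exp_add, hκ]
      congr 1
      push_cast
      linear_combination (τ * θ : ℂ) * I_sq
    rw [h1, mul_assoc, re_ofReal_mul]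
    have hx0' : (exp ((n * θ + τ * x : ℝ) * I) * p (exp (x + θ * I))).re = 0 := hx0
    rw [hx0', mul_zero]

end

end

end CMC1Face

namespace CMC1Face

noncomputable section

open Complex Matrix Filter Topology
open scoped ContDiff

/-! ### The three types of monodromy -/

section

variable {f : ℂ → Fin 4 → ℝ} {R : ℝ} {B : ℂ → Matrix (Fin 2) (Fin 2) ℂ}

theorem exp_period_of_norm_one {u : ℂ} (hu : ‖u‖ = 1) :
    exp (2 * Real.pi * I * ((arg u / (2 * Real.pi) : ℝ) : ℂ)) = u := by
  have h1 := norm_mul_exp_arg_mul_I u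
  rw [hu, ofReal_one, one_mul] at h1
  conv_rhs => rw [← h1]
  have : (Real.pi : ℂ) ≠ 0 := by exact_mod_cast Real.pi_ne_zero
  congr 1
  push_cast
  field_simp

/-- If the monodromy is diagonal and unitary, some ray has no singular points near the puncture. -/
theorem TameFrame.exists_ray_of_elliptic {μ D : ℂ} (hμ : ‖μ‖ = 1) (hD : D ≠ 0)
    (h : TameFrame f !![μ, 0; 0, μ⁻¹] !![D, 0; 0, -D] R B)
    (hns : ∀ S, ∃ w ∈ leftHalfPlane S, exp w ∉ singularSet f) :
    ∃ θ S : ℝ, ∀ w ∈ leftHalfPlane S, w.im = θ → exp w ∉ singularSet f := by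
  have hμ0 : μ ≠ 0 := by rintro rfl; simp at hμ
  have hdeck : ∀ w ∈ leftHalfPlane R, B (deck w) 0 0 = B w 0 0 ∧
      B (deck w) 0 1 = (μ ^ 2)⁻¹ * B w 0 1 ∧ B (deck w) 1 0 = μ ^ 2 * B w 1 0 := by
    intro w hw
    have h1 := h.mul_deck w hw
    have h00 := congrFun (congrFun h1 0) 0
    have h01 := congrFun (congrFun h1 0) 1
    have h10 := congrFun (congrFun h1 1) 0
    simp [Matrix.mul_apply, Fin.sum_univ_two] at h00 h01 h10
    refine ⟨?_, ?_, ?_⟩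
    · exact mul_left_cancel₀ hμ0 (by rw [h00]; ring)
    · refine mul_left_cancel₀ hμ0 ?_
      rw [h01]; field_simp
    · rw [inv_mul_eq_iff_eq_mul₀ hμ0] at h10
      rw [h10]; ring
  have hμ2 : ‖μ ^ 2‖ = 1 := by rw [norm_pow, hμ, one_pow]
  have hμ2' : ‖(μ ^ 2)⁻¹‖ = 1 := by rw [norm_inv, hμ2, inv_one]
  by_cases hk : ∃ w ∈ leftHalfPlane R, B w 1 0 ≠ 0
  · obtain ⟨m, q, hq, hq0, S, hS, hB⟩ := h.entry_normalForm (i := 1) (j := 0)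
      (κ := ((arg (μ ^ 2) / (2 * Real.pi) : ℝ) : ℂ))
      (fun w hw => by rw [exp_period_of_norm_one hμ2]; exact (hdeck w hw).2.2) hk
    set a : ℝ := arg (μ ^ 2) / (2 * Real.pi) with ha
    have hsing : ∀ w ∈ leftHalfPlane S,
        exp w ∈ singularSet f ↔ ‖B w 0 0 / B w 1 0‖ = 1 := by
      intro w hw
      have hk0 := (hB w hw).2
      rw [h.singular_iff_of_ne_zero (leftHalfPlane_mono hS hw) hk0, norm_div,
        div_eq_one_iff_eq (norm_ne_zero_iff.2 hk0)]
      have hsq : ∀ z : ℂ, star z * z = (‖z‖ ^ 2 : ℝ) := fun z => by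
        rw [mul_comm, star_def, mul_conj, normSq_eq_norm_sq]
      have e : star (B w 0 0) * (D * B w 0 0) + star (B w 1 0) * (-D * B w 1 0)
          = D * ((‖B w 0 0‖ ^ 2 - ‖B w 1 0‖ ^ 2 : ℝ) : ℂ) := by
        rw [ofReal_sub, ← hsq, ← hsq]; ring
      have e' : star (B w 0 0) * ((!![D, 0; 0, -D] : Matrix (Fin 2) (Fin 2) ℂ) 0 0 * B w 0 0
          + (!![D, 0; 0, -D] : Matrix (Fin 2) (Fin 2) ℂ) 0 1 * B w 1 0) + star (B w 1 0) *
          ((!![D, 0; 0, -D] : Matrix (Fin 2) (Fin 2) ℂ) 1 0 * B w 0 0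
          + (!![D, 0; 0, -D] : Matrix (Fin 2) (Fin 2) ℂ) 1 1 * B w 1 0)
          = D * ((‖B w 0 0‖ ^ 2 - ‖B w 1 0‖ ^ 2 : ℝ) : ℂ) := by
        rw [← e]; simp
      rw [e', mul_eq_zero_iff_left hD, ofReal_eq_zero, sub_eq_zero,
        sq_eq_sq₀ (norm_nonneg _) (norm_nonneg _)]
    by_cases hx : ∃ w ∈ leftHalfPlane R, B w 0 0 ≠ 0
    · obtain ⟨m', q', hq', hq0', S', hS', hB'⟩ := h.entry_normalForm (i := 0) (j := 0) (κ := 0)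
        (fun w hw => by rw [(hdeck w hw).1]; simp) hx
      obtain ⟨p, hp, hp0, hBp⟩ := exists_quotient_normalForm hq' hq0' hq hq0
        (fun w hw => (hB' w hw).1) hB
      -- The exponent is real because both multipliers have modulus 1.
      set δ : ℝ := -a + (m' - m : ℤ) with hδ
      have hBp' : ∀ w ∈ leftHalfPlane (min S' S),
          B w 0 0 / B w 1 0 = exp (δ * w) * p (exp w) := by
        intro w hw
        rw [hBp w hw, hδ]
        congr 2
        push_cast; ring
      by_cases hδ0 : δ = 0
      · have hBp0 : ∀ w ∈ leftHalfPlane (min S' S), B w 0 0 / B w 1 0 = p (exp w) := by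
          intro w hw
          rw [hBp' w hw, hδ0]; simp
        -- If G is constant, one nonsingular point shows that its modulus is not 1, and then no
        -- point near the puncture is singular.
        by_cases hc : ∀ᶠ z in 𝓝 (0 : ℂ), p z = p 0
        · obtain ⟨T, hT⟩ := tendsto_exp_of_left hc
          obtain ⟨w, hw, hwn⟩ := hns (min (min S' S) T)
          have hw1 := leftHalfPlane_mono (min_le_left _ _) hw
          have hw2 := leftHalfPlane_mono (min_le_right _ _) hw
          have hp1 : ‖p 0‖ ≠ 1 := by
            intro h1
            apply hwn
            rw [hsing w (leftHalfPlane_mono (min_le_right _ _) hw1), hBp0 w hw1, hT w hw2, h1]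
          refine ⟨0, min (min S' S) T, fun v hv _ hvs => hp1 ?_⟩
          have hv1 := leftHalfPlane_mono (min_le_left _ _) hv
          have hv2 := leftHalfPlane_mono (min_le_right _ _) hv
          rwa [hsing v (leftHalfPlane_mono (min_le_right _ _) hv1), hBp0 v hv1, hT v hv2] at hvs
        · obtain ⟨θ, T, hT⟩ := exists_ray_norm_ne_one hp hc
          refine ⟨θ, min (min S' S) T, fun v hv hvθ hvs => ?_⟩
          have hv1 := leftHalfPlane_mono (min_le_left _ _) hv
          have hv2 := leftHalfPlane_mono (min_le_right _ _) hv
          rw [hsing v (leftHalfPlane_mono (min_le_right _ _) hv1), hBp0 v hv1] at hvs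
          exact hT v hv2 hvθ hvs
      · obtain ⟨T, hT⟩ := exists_norm_exp_mul_ne_one hp hp0 hδ0
        refine ⟨0, min (min S' S) T, fun v hv _ hvs => ?_⟩
        have hv1 := leftHalfPlane_mono (min_le_left _ _) hv
        have hv2 := leftHalfPlane_mono (min_le_right _ _) hv
        rw [hsing v (leftHalfPlane_mono (min_le_right _ _) hv1), hBp' v hv1] at hvs
        exact hT v hv2 hvs
    · push Not at hx
      refine ⟨0, S, fun w hw _ hws => ?_⟩
      rw [hsing w hw, hx w (leftHalfPlane_mono hS hw)] at hws
      simp at hws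
  · push Not at hk
    obtain ⟨m, q, hq, hq0, S, hS, hB⟩ := h.entry_normalForm (i := 0) (j := 1)
      (κ := ((arg (μ ^ 2)⁻¹ / (2 * Real.pi) : ℝ) : ℂ))
      (fun w hw => by rw [exp_period_of_norm_one hμ2']; exact (hdeck w hw).2.1)
      (h.exists_upper_ne_zero hk)
    refine ⟨0, S, fun w hw _ hws => hD ?_⟩
    rw [h.singular_iff_of_lower_zero hk (leftHalfPlane_mono hS hw) (hB w hw).2] at hws
    simpa using hws

/-- If the lower left entry of a tame frame vanishes and the form `E` has an isotropic first basis
vector, all points near the puncture are singular. -/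
theorem TameFrame.exists_lower_ne_zero {ρ E : Matrix (Fin 2) (Fin 2) ℂ}
    (h : TameFrame f ρ E R B) (hE : E 0 0 = 0) {κ : ℂ}
    (hp : (∀ w ∈ leftHalfPlane R, B w 1 0 = 0) →
      ∀ w ∈ leftHalfPlane R, B (deck w) 0 1 = exp (2 * Real.pi * I * κ) * B w 0 1)
    (hns : ∀ S, ∃ w ∈ leftHalfPlane S, exp w ∉ singularSet f) :
    ∃ w ∈ leftHalfPlane R, B w 1 0 ≠ 0 := by
  by_contra! hk
  obtain ⟨m, q, hq, hq0, S, hS, hB⟩ := h.entry_normalForm (hp hk) (h.exists_upper_ne_zero hk)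
  obtain ⟨w, hw, hwn⟩ := hns S
  apply hwn
  rw [h.singular_iff_of_lower_zero hk (leftHalfPlane_mono hS hw) (hB w hw).2, hE]

/-- If the monodromy is parabolic, some ray has no singular points near the puncture. -/
theorem TameFrame.exists_ray_of_parabolic {s : ℝ} (hs : s ≠ 0)
    (h : TameFrame f !![1, -2 * s; 0, 1] !![0, I / 2; -I / 2, 0] R B)
    (hns : ∀ S, ∃ w ∈ leftHalfPlane S, exp w ∉ singularSet f) :
    ∃ θ S : ℝ, ∀ w ∈ leftHalfPlane S, w.im = θ → exp w ∉ singularSet f := by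
  have hdeck : ∀ w ∈ leftHalfPlane R, B (deck w) 1 0 = B w 1 0 ∧
      B (deck w) 0 0 = B w 0 0 + 2 * s * B w 1 0 ∧
      B (deck w) 0 1 - 2 * s * B (deck w) 1 1 = -(2 * s) * B w 0 0 + B w 0 1 := by
    intro w hw
    have h1 := h.mul_deck w hw
    have h00 := congrFun (congrFun h1 0) 0
    have h01 := congrFun (congrFun h1 0) 1
    have h10 := congrFun (congrFun h1 1) 0
    simp [Matrix.mul_apply, Fin.sum_univ_two] at h00 h01 h10
    refine ⟨h10, ?_, ?_⟩
    · rw [h10] at h00; linear_combination h00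
    · linear_combination h01
  have hk := h.exists_lower_ne_zero (κ := 0) (by simp) (fun hk0 w hw => by
    have h1 := (hdeck w hw).2.2
    have e1 := h.eq_of_lower_zero hk0 hw
    have e2 := h.eq_of_lower_zero hk0 (deck_mem.2 hw)
    have e3 : B w 0 0 = 0 := by rw [e1]; rfl
    have e4 : B (deck w) 1 1 = 0 := by rw [e2]; rfl
    rw [e3, e4] at h1
    simpa using h1) hns
  obtain ⟨m, q, hq, hq0, S, hS, hB⟩ := h.entry_normalForm (i := 1) (j := 0) (κ := 0)
    (fun w hw => by rw [(hdeck w hw).1]; simp) hk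
  have hsing : ∀ w ∈ leftHalfPlane S, exp w ∈ singularSet f ↔ (B w 0 0 / B w 1 0).im = 0 := by
    intro w hw
    have hk0 := (hB w hw).2
    rw [h.singular_iff_of_ne_zero (leftHalfPlane_mono hS hw) hk0]
    obtain ⟨G, hG⟩ : ∃ G, G = B w 0 0 / B w 1 0 := ⟨_, rfl⟩
    rw [← hG]
    have hx : B w 0 0 = G * B w 1 0 := by rw [hG, div_mul_cancel₀ _ hk0]
    have e : star (B w 0 0) * ((!![0, I / 2; -I / 2, 0] : Matrix (Fin 2) (Fin 2) ℂ) 0 0 * B w 0 0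
        + (!![0, I / 2; -I / 2, 0] : Matrix (Fin 2) (Fin 2) ℂ) 0 1 * B w 1 0) + star (B w 1 0) *
        ((!![0, I / 2; -I / 2, 0] : Matrix (Fin 2) (Fin 2) ℂ) 1 0 * B w 0 0
        + (!![0, I / 2; -I / 2, 0] : Matrix (Fin 2) (Fin 2) ℂ) 1 1 * B w 1 0)
        = star (B w 1 0) * B w 1 0 * (G.im : ℂ) := by
      rw [hx, im_eq_sub_conj]
      simp
      field_simp
      linear_combination (starRingEnd ℂ) (B w 1 0) * (G - (starRingEnd ℂ) G) * (-I_sq)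
    rw [e, mul_eq_zero_iff_left (mul_ne_zero (star_ne_zero.2 hk0) hk0), ofReal_eq_zero]
  -- The quotient B₀₀ / B₁₀ increases by 2s around the puncture, and so does cw, as c · 2πi = 2s.
  -- Subtracting cw leaves a periodic function.
  set c : ℂ := s / (Real.pi * I) with hc
  have hc2 : c * (2 * Real.pi * I) = 2 * s := by
    have : (Real.pi : ℂ) ≠ 0 := by exact_mod_cast Real.pi_ne_zero
    rw [hc]; field_simp
  set X : ℂ → ℂ := fun w => B w 0 0 + -c * w * B w 1 0 with hX
  have hXd : DifferentiableOn ℂ X (leftHalfPlane R) :=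
    (h.holomorphic 0 0).add ((Differentiable.differentiableOn (by fun_prop)).mul
      (h.holomorphic 1 0))
  have hXg : ExpGrowth X R :=
    (h.growth 0 0).add (((expGrowth_const _ _).mul (expGrowth_id R)).mul (h.growth 1 0))
  have hXp : ∀ w ∈ leftHalfPlane R, X (deck w) = exp (2 * Real.pi * I * 0) * X w := by
    intro w hw
    obtain ⟨h1, h2, -⟩ := hdeck w hw
    simp only [hX]
    rw [h1, h2, mul_zero, exp_zero, deck]
    linear_combination -B w 1 0 * hc2
  have hXq : ∀ w ∈ leftHalfPlane S, B w 0 0 / B w 1 0 = c * w + X w / B w 1 0 := by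
    intro w hw
    have := (hB w hw).2
    simp only [hX]
    field_simp
    ring
  by_cases hX0 : ∃ w ∈ leftHalfPlane R, X w ≠ 0
  · obtain ⟨m', q', hq', hq0', S', hS', hX'⟩ := exists_normalForm hXd hXg hXp hX0
    obtain ⟨p, hp, hp0, hBp⟩ := exists_quotient_normalForm hq' hq0' hq hq0 hX' hB
    obtain ⟨θ, T, hT⟩ := exists_ray_im_ne_zero hp hp0 hs (m' - m)
    refine ⟨θ, min (min S' S) T, fun v hv hvθ hvs => ?_⟩
    have hv1 := leftHalfPlane_mono (min_le_left _ _) hv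
    have hv2 := leftHalfPlane_mono (min_le_right _ _) hv
    have hvS := leftHalfPlane_mono (min_le_right _ _) hv1
    rw [hsing v hvS, hXq v hvS, hBp v hv1] at hvs
    apply hT v hv2 hvθ
    rw [← hvs, hc]
    congr 4
    ring
  · push Not at hX0
    refine ⟨0, min S 0, fun v hv _ hvs => ?_⟩
    have hvS := leftHalfPlane_mono (min_le_left _ _) hv
    have hv0 : v.re < 0 := lt_of_lt_of_le hv (min_le_right _ _)
    rw [hsing v hvS, hXq v hvS, hX0 v (leftHalfPlane_mono hS hvS), zero_div, add_zero] at hvs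
    have e : c * v = ((s / Real.pi : ℝ) : ℂ) * (-I * v) := by
      have : (Real.pi : ℂ) ≠ 0 := by exact_mod_cast Real.pi_ne_zero
      rw [hc]
      push_cast
      field_simp
      linear_combination (s : ℂ) * v * I_sq
    rw [e, im_ofReal_mul] at hvs
    have h2 : (-I * v).im = -v.re := by simp
    rw [h2, mul_eq_zero, div_eq_zero_iff] at hvs
    have := Real.pi_ne_zero
    rcases hvs with (h3 | h3) | h3
    · exact hs h3
    · exact this h3
    · linarith

/-- If the monodromy is hyperbolic, every ray has singular points arbitrarily near the puncture. -/
theorem TameFrame.exists_singular_of_hyperbolic {t : ℝ} (ht : 0 < t)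
    (h : TameFrame f !![exp t, 0; 0, exp (-t)] !![0, -2; -2, 0] R B)
    (hns : ∀ S, ∃ w ∈ leftHalfPlane S, exp w ∉ singularSet f) (θ S₀ : ℝ) :
    ∃ w ∈ leftHalfPlane S₀, w.im = θ ∧ exp w ∈ singularSet f := by
  -- A purely imaginary exponent gives the real multiplier exp(2t) of the lower left entry; the
  -- quotient then carries τ = t/π > 0.
  set κ : ℂ := -((t / Real.pi : ℝ) * I) with hκ
  have hκe : exp (2 * Real.pi * I * κ) = exp t ^ 2 := by
    rw [← exp_nat_mul, hκ]
    congr 1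
    push_cast
    field_simp
    linear_combination -(t : ℂ) * I_sq
  have hκe' : exp (2 * Real.pi * I * (-κ)) = exp (-t) ^ 2 := by
    rw [mul_neg, Complex.exp_neg, hκe, Complex.exp_neg, inv_pow]
  have hee : exp (t : ℂ) * exp (-t) = 1 := by rw [← exp_add]; simp
  have hdeck : ∀ w ∈ leftHalfPlane R, B (deck w) 0 0 = B w 0 0 ∧
      B (deck w) 0 1 = exp (-t) ^ 2 * B w 0 1 ∧ B (deck w) 1 0 = exp t ^ 2 * B w 1 0 := by
    intro w hw
    have h1 := h.mul_deck w hw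
    have h00 := congrFun (congrFun h1 0) 0
    have h01 := congrFun (congrFun h1 0) 1
    have h10 := congrFun (congrFun h1 1) 0
    simp only [Matrix.mul_apply, Fin.sum_univ_two, of_apply, cons_val', cons_val_zero,
      cons_val_one, cons_val_fin_one] at h00 h01 h10
    refine ⟨?_, ?_, ?_⟩
    · linear_combination exp (-t) * h00 - (B (deck w) 0 0 - B w 0 0) * hee
    · linear_combination exp (-t) * h01 - B (deck w) 0 1 * hee
    · linear_combination exp t * h10 - B (deck w) 1 0 * hee
  have hk := h.exists_lower_ne_zero (κ := -κ) (by simp)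
    (fun _ w hw => by rw [hκe', (hdeck w hw).2.1]) hns
  obtain ⟨m, q, hq, hq0, S, hS, hB⟩ := h.entry_normalForm (i := 1) (j := 0) (κ := κ)
    (fun w hw => by rw [(hdeck w hw).2.2, hκe]) hk
  have hsing : ∀ w ∈ leftHalfPlane S, exp w ∈ singularSet f ↔ (B w 0 0 / B w 1 0).re = 0 := by
    intro w hw
    have hk0 := (hB w hw).2
    rw [h.singular_iff_of_ne_zero (leftHalfPlane_mono hS hw) hk0]
    obtain ⟨G, hG⟩ : ∃ G, G = B w 0 0 / B w 1 0 := ⟨_, rfl⟩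
    rw [← hG]
    have hx : B w 0 0 = G * B w 1 0 := by rw [hG, div_mul_cancel₀ _ hk0]
    have e : star (B w 0 0) * ((!![0, -2; -2, 0] : Matrix (Fin 2) (Fin 2) ℂ) 0 0 * B w 0 0
        + (!![0, -2; -2, 0] : Matrix (Fin 2) (Fin 2) ℂ) 0 1 * B w 1 0) + star (B w 1 0) *
        ((!![0, -2; -2, 0] : Matrix (Fin 2) (Fin 2) ℂ) 1 0 * B w 0 0
        + (!![0, -2; -2, 0] : Matrix (Fin 2) (Fin 2) ℂ) 1 1 * B w 1 0)
        = -4 * (star (B w 1 0) * B w 1 0) * (G.re : ℂ) := by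
      rw [hx, re_eq_add_conj]
      simp
      ring
    rw [e, mul_eq_zero_iff_left (mul_ne_zero (by norm_num)
      (mul_ne_zero (star_ne_zero.2 hk0) hk0)), ofReal_eq_zero]
  -- Otherwise the quotient would be 0 and every point near the puncture singular.
  have hx : ∃ w ∈ leftHalfPlane R, B w 0 0 ≠ 0 := by
    by_contra! hx
    obtain ⟨w, hw, hwn⟩ := hns S
    apply hwn
    rw [hsing w hw, hx w (leftHalfPlane_mono hS hw)]
    simp
  obtain ⟨m', q', hq', hq0', S', hS', hB'⟩ := h.entry_normalForm (i := 0) (j := 0) (κ := 0)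
    (fun w hw => by rw [(hdeck w hw).1]; simp) hx
  obtain ⟨p, hp, hp0, hBp⟩ := exists_quotient_normalForm hq' hq0' hq hq0
    (fun w hw => (hB' w hw).1) hB
  obtain ⟨w, hw, hwθ, hw0⟩ := exists_re_eq_zero_on_ray (κ := 0 - κ + (m' - m : ℤ)) hp hp0
    (n := m' - m) (τ := t / Real.pi) (by positivity) (by rw [hκ]; ring) θ (min (min S' S) S₀)
  have hw1 := leftHalfPlane_mono (min_le_left _ _) hw
  refine ⟨w, leftHalfPlane_mono (min_le_right _ _) hw, hwθ, ?_⟩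
  rw [hsing w (leftHalfPlane_mono (min_le_right _ _) hw1), hBp w hw1]
  exact hw0

end

end

end CMC1Face

namespace CMC1Face

noncomputable section

open Complex Matrix Filter Topology
open scoped ContDiff

/-! ### Conjugacy classes in `SU(1,1)` -/

theorem conj_eq_of_mul_eq {ρ C Λ : Matrix (Fin 2) (Fin 2) ℂ} (hC : IsUnit C.det)
    (h : ρ * C = C * Λ) : C⁻¹ * ρ * C = Λ := by
  rw [Matrix.mul_assoc, h, ← Matrix.mul_assoc, nonsing_inv_mul _ hC, Matrix.one_mul]

theorem SU11.neg {A : Matrix (Fin 2) (Fin 2) ℂ} (hA : A ∈ SU11) : -A ∈ SU11 := by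
  refine ⟨by rw [det_neg]; simp [hA.1], ?_⟩
  have := hA.2
  simpa using this

theorem isHyperbolicMatrix_neg {A : Matrix (Fin 2) (Fin 2) ℂ} (h : IsHyperbolicMatrix (-A)) :
    IsHyperbolicMatrix A := by
  obtain ⟨hA, P, hP, t, ht, h⟩ := h
  refine ⟨by simpa using SU11.neg hA, P, hP, t, ht, ?_⟩
  simp only [Matrix.mul_neg, Matrix.neg_mul] at h
  rcases h with h | h
  · right; rw [← h, neg_neg]
  · left; exact neg_inj.1 h

/-- Applied to β / z with |β| = |z|, this yields β X̄ = z X, which makes (X, X̄) an eigenvector in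
the applications. -/
theorem exists_sq_eq_of_norm_one {z : ℂ} (hz : ‖z‖ = 1) :
    ∃ X : ℂ, X ^ 2 = z ∧ X * (starRingEnd ℂ) X = 1 := by
  obtain ⟨X, hX⟩ := IsAlgClosed.exists_pow_nat_eq z (n := 2) (by norm_num)
  refine ⟨X, hX, ?_⟩
  have : ‖X‖ ^ 2 = 1 := by rw [← norm_pow, hX, hz]
  rw [mul_conj, normSq_eq_norm_sq, this, ofReal_one]

theorem mul_conj_eq {z : ℂ} : z * (starRingEnd ℂ) z = ((z.re ^ 2 + z.im ^ 2 : ℝ) : ℂ) := by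
  rw [mul_conj, normSq_apply]; congr 1; ring

/-- The parameters of an element of `SU(1,1)`. -/
theorem SU11.exists_params {ρ : Matrix (Fin 2) (Fin 2) ℂ} (hρ : ρ ∈ SU11) :
    ∃ (c σ : ℝ) (β : ℂ), ρ = !![c + σ * I, β; (starRingEnd ℂ) β, c - σ * I] ∧
      β * (starRingEnd ℂ) β = ((c ^ 2 + σ ^ 2 - 1 : ℝ) : ℂ) := by
  obtain ⟨h10, h11⟩ := SU11.entries hρ
  refine ⟨(ρ 0 0).re, (ρ 0 0).im, ρ 0 1, ?_, ?_⟩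
  · ext i j
    fin_cases i <;> fin_cases j
    · simp
    · rfl
    · exact h10
    · change ρ 1 1 = _
      rw [h11]
      apply Complex.ext <;> simp
  · have h := hρ.1
    rw [det_fin_two, h10, h11, star_def, mul_conj_eq] at h
    push_cast at h ⊢
    linear_combination -h

/-- Take c = cosh t and s = sinh t. The eigenvectors (X, X̄) and (y, -ȳ) for c + s and c - s are to
be the images of the eigenvectors (1, 1) and (1, -1) of Λ_h(t). -/
theorem exists_SU11_conj_Lambdah {c σ : ℝ} {β : ℂ} (hc : 1 < c)
    (hβ : β * (starRingEnd ℂ) β = ((c ^ 2 + σ ^ 2 - 1 : ℝ) : ℂ)) :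
    ∃ P ∈ SU11, ∃ t : ℝ, 0 < t ∧
      P⁻¹ * !![c + σ * I, β; (starRingEnd ℂ) β, c - σ * I] * P = Lambdah t := by
  obtain ⟨t, ht, hct⟩ : ∃ t : ℝ, 0 < t ∧ Real.cosh t = c :=
    ⟨Real.arcosh c, Real.arcosh_pos hc, Real.cosh_arcosh hc.le⟩
  have hs : 0 < Real.sinh t := Real.sinh_pos_iff.2 ht
  have hcs : c ^ 2 = Real.sinh t ^ 2 + 1 := by rw [← hct, Real.cosh_sq]
  obtain ⟨s, hst⟩ : ∃ s, s = Real.sinh t := ⟨_, rfl⟩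
  rw [← hst] at hs hcs
  have hsC : (s : ℂ) ≠ 0 := by exact_mod_cast hs.ne'
  set z : ℂ := s - σ * I with hz
  have hzz : z * (starRingEnd ℂ) z = β * (starRingEnd ℂ) β := by
    rw [hβ, hcs, mul_conj_eq]
    simp [hz]
    ring
  have hz0 : z ≠ 0 := by
    intro h0
    have := congrArg Complex.re h0
    simp [hz] at this
    exact hs.ne' this
  have hn : ‖β / z‖ = 1 := by
    rw [norm_div, div_eq_one_iff_eq (norm_ne_zero_iff.2 hz0)]
    rw [mul_conj, mul_conj, normSq_eq_norm_sq, normSq_eq_norm_sq, ofReal_inj] at hzz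
    exact ((sq_eq_sq₀ (norm_nonneg _) (norm_nonneg _)).1 hzz).symm
  obtain ⟨X, hX2, hX1⟩ := exists_sq_eq_of_norm_one hn
  rw [eq_div_iff hz0] at hX2
  have hcz : (starRingEnd ℂ) z = s + σ * I := by simp [hz]
  have hβX : β * (starRingEnd ℂ) X = z * X := by
    linear_combination -(starRingEnd ℂ) X * hX2 + X * z * hX1
  have hβX' : (starRingEnd ℂ) β * X = (s + σ * I) * (starRingEnd ℂ) X := by
    have := congrArg (starRingEnd ℂ) hβX
    simpa [hcz] using this
  -- Dividing by s normalizes Re(X ȳ) = 1, which is the determinant condition for SU(1,1).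
  set y : ℂ := z * X / s with hy
  have hys : y * s = z * X := by rw [hy, div_mul_cancel₀ _ hsC]
  have hys' : (starRingEnd ℂ) y * s = (s + σ * I) * (starRingEnd ℂ) X := by
    have := congrArg (starRingEnd ℂ) hys
    simpa [hcz] using this
  have hdet : (X + y) / 2 * star ((X + y) / 2) - (X - y) / 2 * star ((X - y) / 2) = 1 := by
    simp only [star_def, map_div₀, map_add, map_sub, map_ofNat]
    refine mul_right_cancel₀ hsC ?_
    linear_combination (1 / 2 : ℂ) * X * hys' + (1 / 2 : ℂ) * (starRingEnd ℂ) X * hys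
      + (s : ℂ) * hX1 + (1 / 2 : ℂ) * X * (starRingEnd ℂ) X * hz
  have hP := mem_SU11_of_entries hdet
  refine ⟨_, hP, t, ht, conj_eq_of_mul_eq (SU11.isUnit_det hP) ?_⟩
  have hβy : β * (starRingEnd ℂ) y * s = (s + σ * I) * (z * X) := by
    linear_combination β * hys' + (s + σ * I) * hβX
  have hβy' : (starRingEnd ℂ) β * y * s = z * ((s + σ * I) * (starRingEnd ℂ) X) := by
    linear_combination (starRingEnd ℂ) β * hys + z * hβX'
  ext i j
  simp only [Lambdah, hct, ← hst]
  fin_cases i <;> fin_cases j <;>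
    simp [Matrix.mul_apply, Fin.sum_univ_two] <;>
    refine mul_right_cancel₀ hsC ?_
  · linear_combination (1 / 2 : ℂ) * s * hβX - (1 / 2 : ℂ) * hβy
      + (1 / 2 : ℂ) * (σ * I + s) * hys + (1 / 2 : ℂ) * X * s * hz
  · linear_combination (1 / 2 : ℂ) * s * hβX + (1 / 2 : ℂ) * hβy
      - (1 / 2 : ℂ) * (σ * I + s) * hys + (1 / 2 : ℂ) * X * s * hz
  · linear_combination (1 / 2 : ℂ) * s * hβX' + (1 / 2 : ℂ) * hβy'
      - (1 / 2 : ℂ) * (-σ * I + s) * hys'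
      + (1 / 2 : ℂ) * (s + σ * I) * (starRingEnd ℂ) X * hz
  · linear_combination (1 / 2 : ℂ) * s * hβX' - (1 / 2 : ℂ) * hβy'
      + (1 / 2 : ℂ) * (-σ * I + s) * hys'
      - (1 / 2 : ℂ) * (s + σ * I) * (starRingEnd ℂ) X * hz

/-! ### Rays for each conjugacy class of the monodromy. -/

section

variable {f : ℂ → Fin 4 → ℝ} {R : ℝ} {B : ℂ → Matrix (Fin 2) (Fin 2) ℂ}

theorem e₃_eq : e₃ = !![1, 0; 0, -1] := rfl

/-- The elliptic class: the eigenvalues are c ± is with c² + s² = 1, and the eigenvectors are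
orthogonal for e₃. -/
theorem TameFrame.exists_ray_of_abs_re_lt_one {c σ : ℝ} {β : ℂ} (hβ0 : β ≠ 0) (hc : c ^ 2 < 1)
    (hβ : β * (starRingEnd ℂ) β = ((c ^ 2 + σ ^ 2 - 1 : ℝ) : ℂ))
    (h : TameFrame f !![c + σ * I, β; (starRingEnd ℂ) β, c - σ * I] e₃ R B)
    (hns : ∀ S, ∃ w ∈ leftHalfPlane S, exp w ∉ singularSet f) :
    ∃ θ S : ℝ, ∀ w ∈ leftHalfPlane S, w.im = θ → exp w ∉ singularSet f := by
  obtain ⟨s, hs, hcs⟩ : ∃ s : ℝ, 0 < s ∧ c ^ 2 + s ^ 2 = 1 :=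
    ⟨Real.sqrt (1 - c ^ 2), Real.sqrt_pos.2 (by linarith), by
      rw [Real.sq_sqrt (by linarith)]; ring⟩
  have hcsC : (c : ℂ) ^ 2 + s ^ 2 = 1 := by exact_mod_cast hcs
  have hσs : σ ≠ s := by
    rintro rfl
    rw [hcs] at hβ
    simp [hβ0] at hβ
  set μ : ℂ := c + s * I with hμ
  set y : ℂ := (s - σ) * I with hy
  have hyc : (starRingEnd ℂ) y = -y := by simp [hy]
  set D : ℂ := ((2 * s * (σ - s) : ℝ) : ℂ) with hD
  have hD0 : D ≠ 0 := by
    rw [hD, Ne, ofReal_eq_zero]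
    exact mul_ne_zero (by positivity) (sub_ne_zero.2 hσs)
  have hI := I_sq
  push_cast at hβ
  have hDβ : β * (starRingEnd ℂ) β + y * y = D := by
    rw [hβ, hD, hy]; push_cast
    linear_combination ((s : ℂ) - σ) ^ 2 * hI + hcsC
  have hμn : ‖μ‖ = 1 := by
    have h1 : μ * (starRingEnd ℂ) μ = 1 := by
      rw [mul_conj_eq]; simp [hμ]; exact hcsC
    rw [mul_conj, normSq_eq_norm_sq] at h1
    have h2 : ‖μ‖ ^ 2 = 1 := by exact_mod_cast h1
    exact (pow_eq_one_iff_of_nonneg (norm_nonneg _) two_ne_zero).1 h2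
  have hμi : μ⁻¹ = c - s * I := by
    refine inv_eq_of_mul_eq_one_right ?_
    rw [hμ]; linear_combination hcsC - (s : ℂ) ^ 2 * hI
  -- The columns are eigenvectors for μ = c + is and μ⁻¹; their e₃-squares are D and -D, with D =
  -- 2s(σ - s).
  set C : Matrix (Fin 2) (Fin 2) ℂ := !![β, -y; y, (starRingEnd ℂ) β] with hC
  have hCu : IsUnit C.det := by
    rw [hC, det_fin_two_of, isUnit_iff_ne_zero]
    convert hD0 using 1
    linear_combination hDβ
  have h1 := h.conj hCu
  have e1 : C⁻¹ * !![c + σ * I, β; (starRingEnd ℂ) β, c - σ * I] * C = !![μ, 0; 0, μ⁻¹] := by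
    refine conj_eq_of_mul_eq hCu ?_
    rw [hμi]
    ext i j
    fin_cases i <;> fin_cases j <;> simp [hC, Matrix.mul_apply, Fin.sum_univ_two, hμ, hy]
    · ring
    · linear_combination hβ - ((s : ℂ) ^ 2 - σ ^ 2) * hI + hcsC
    · linear_combination hβ - (s : ℂ) * (s - σ) * hI - σ * (s - σ) * hI + hcsC
    · ring
  have e2 : Cᴴ * e₃ * C = !![D, 0; 0, -D] := by
    ext i j
    fin_cases i <;> fin_cases j <;>
      simp [hC, e₃, Matrix.mul_apply, Fin.sum_univ_two, conjTranspose_apply, hyc]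
    · linear_combination hDβ
    · ring
    · ring
    · linear_combination -hDβ
  rw [e1, e2] at h1
  exact h1.exists_ray_of_elliptic hμn hD0 hns

/-- The parabolic class: 1 is the only eigenvalue, with isotropic eigenvector (X, X̄). -/
theorem TameFrame.exists_ray_of_re_eq_one {σ : ℝ} {β : ℂ} (hβ0 : β ≠ 0)
    (hβ : β * (starRingEnd ℂ) β = ((σ ^ 2 : ℝ) : ℂ))
    (h : TameFrame f !![1 + σ * I, β; (starRingEnd ℂ) β, 1 - σ * I] e₃ R B)
    (hns : ∀ S, ∃ w ∈ leftHalfPlane S, exp w ∉ singularSet f) :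
    ∃ θ S : ℝ, ∀ w ∈ leftHalfPlane S, w.im = θ → exp w ∉ singularSet f := by
  have hσ : σ ≠ 0 := by
    rintro rfl
    simp [hβ0] at hβ
  set z : ℂ := -(σ * I) with hz
  have hz0 : z ≠ 0 := by simp [hz, hσ]
  have hn : ‖β / z‖ = 1 := by
    rw [norm_div, div_eq_one_iff_eq (norm_ne_zero_iff.2 hz0)]
    rw [mul_conj, normSq_eq_norm_sq, ofReal_inj] at hβ
    have : ‖z‖ ^ 2 = σ ^ 2 := by
      rw [hz, norm_neg, norm_mul, norm_I, mul_one, norm_real, Real.norm_eq_abs, sq_abs]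
    rw [← this] at hβ
    exact (sq_eq_sq₀ (norm_nonneg _) (norm_nonneg _)).1 hβ
  obtain ⟨X, hX2, hX1⟩ := exists_sq_eq_of_norm_one hn
  rw [eq_div_iff hz0] at hX2
  have hβX : β * (starRingEnd ℂ) X = -(σ * I) * X := by
    linear_combination -(starRingEnd ℂ) X * hX2 + X * z * hX1
  have hβX' : (starRingEnd ℂ) β * X = σ * I * (starRingEnd ℂ) X := by
    have := congrArg (starRingEnd ℂ) hβX
    simpa using this
  -- The first column is proportional to the eigenvector (X, X̄), the second to (X, -X̄). Both are
  -- isotropic, so e₃ becomes antidiagonal, and up to a positive factor the form is Im G.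
  set C : Matrix (Fin 2) (Fin 2) ℂ := !![-(I / 2) * X, X / 2;
    -(I / 2) * (starRingEnd ℂ) X, -(starRingEnd ℂ) X / 2] with hC
  have hCu : IsUnit C.det := by
    rw [hC, det_fin_two_of, isUnit_iff_ne_zero]
    have : -(I / 2) * X * (-(starRingEnd ℂ) X / 2) - X / 2 * (-(I / 2) * (starRingEnd ℂ) X)
        = I / 2 := by linear_combination (I / 2) * hX1
    rw [this]; simp
  have h1 := h.conj hCu
  have e1 : C⁻¹ * !![1 + σ * I, β; (starRingEnd ℂ) β, 1 - σ * I] * C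
      = !![1, -2 * (σ : ℂ); 0, 1] := by
    refine conj_eq_of_mul_eq hCu ?_
    ext i j
    fin_cases i <;> fin_cases j <;> simp [hC, Matrix.mul_apply, Fin.sum_univ_two]
    · linear_combination -(I / 2) * hβX
    · linear_combination -(1 / 2 : ℂ) * hβX
    · linear_combination -(I / 2) * hβX'
    · linear_combination (1 / 2 : ℂ) * hβX'
  have e2 : Cᴴ * e₃ * C = !![0, I / 2; -I / 2, 0] := by
    have h2 : (starRingEnd ℂ) 2 = 2 := map_ofNat _ 2
    ext i j
    fin_cases i <;> fin_cases j <;>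
      simp [hC, e₃, Matrix.mul_apply, Fin.sum_univ_two, conjTranspose_apply, h2]
    · ring
    · linear_combination (I / 2) * hX1
    · linear_combination -(I / 2) * hX1
    · ring
  rw [e1, e2] at h1
  exact h1.exists_ray_of_parabolic hσ hns

/-- If the monodromy is not hyperbolic, some ray has no singular points near the puncture. -/
theorem TameFrame.exists_ray_of_not_hyperbolic {ρ : Matrix (Fin 2) (Fin 2) ℂ} (hρ : ρ ∈ SU11)
    (hnh : ¬ IsHyperbolicMatrix ρ) (h : TameFrame f ρ e₃ R B)
    (hns : ∀ S, ∃ w ∈ leftHalfPlane S, exp w ∉ singularSet f) :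
    ∃ θ S : ℝ, ∀ w ∈ leftHalfPlane S, w.im = θ → exp w ∉ singularSet f := by
  obtain ⟨c, σ, β, rfl, hβ⟩ := SU11.exists_params hρ
  have hneg : -(!![c + σ * I, β; (starRingEnd ℂ) β, c - σ * I] : Matrix (Fin 2) (Fin 2) ℂ)
      = !![((-c : ℝ) : ℂ) + (-σ : ℝ) * I, -β; (starRingEnd ℂ) (-β),
        ((-c : ℝ) : ℂ) - (-σ : ℝ) * I] := by
    ext i j
    fin_cases i <;> fin_cases j <;> simp <;> ring
  have hβ' : -β * (starRingEnd ℂ) (-β) = (((-c) ^ 2 + (-σ) ^ 2 - 1 : ℝ) : ℂ) := by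
    rw [map_neg, neg_mul_neg, hβ]; congr 1; ring
  by_cases hβ0 : β = 0
  · subst hβ0
    have h0 : c ^ 2 + σ ^ 2 - 1 = 0 := by
      rw [zero_mul] at hβ
      exact_mod_cast hβ.symm
    have h0C : (c : ℂ) ^ 2 + σ ^ 2 = 1 := by
      have : c ^ 2 + σ ^ 2 = 1 := by linarith
      exact_mod_cast this
    have hi : (c + σ * I : ℂ)⁻¹ = c - σ * I := by
      refine inv_eq_of_mul_eq_one_right ?_
      linear_combination h0C - (σ : ℂ) ^ 2 * I_sq
    have hn : ‖(c + σ * I : ℂ)‖ = 1 := by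
      rw [← pow_eq_one_iff_of_nonneg (norm_nonneg _) two_ne_zero, ← normSq_eq_norm_sq,
        normSq_apply]
      simp; linarith
    rw [map_zero, ← hi, e₃_eq] at h
    exact h.exists_ray_of_elliptic hn one_ne_zero hns
  -- The real half-trace c decides the class; for c < 0 in the parabolic and hyperbolic cases pass
  -- to -ρ.
  rcases lt_trichotomy (c ^ 2) 1 with hc | hc | hc
  · exact h.exists_ray_of_abs_re_lt_one hβ0 hc hβ hns
  · rcases (mul_self_eq_one_iff.1 ((sq c).symm.trans hc)) with rfl | rfl
    · refine TameFrame.exists_ray_of_re_eq_one (σ := σ) hβ0 ?_ (by simpa using h) hns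
      rw [hβ]; congr 1; ring
    · refine TameFrame.exists_ray_of_re_eq_one (σ := -σ) (neg_ne_zero.2 hβ0) ?_
        (R := R) (B := B) ?_ hns
      · rw [hβ']; congr 1; ring
      · refine TameFrame.neg ?_
        convert h using 1
        rw [← neg_inj, neg_neg, hneg]
        simp
  · refine absurd ?_ hnh
    rcases lt_abs.1 ((one_lt_sq_iff_one_lt_abs c).1 hc) with hc1 | hc1
    · obtain ⟨P, hP, t, ht, hPt⟩ := exists_SU11_conj_Lambdah hc1 hβ
      exact ⟨hρ, P, hP, t, ht, Or.inl hPt⟩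
    · obtain ⟨P, hP, t, ht, hPt⟩ := exists_SU11_conj_Lambdah hc1 hβ'
      rw [← hneg] at hPt
      exact isHyperbolicMatrix_neg ⟨SU11.neg hρ, P, hP, t, ht, Or.inl hPt⟩

theorem TameFrame.exists_singular_of_conj_Lambdah {ρ S : Matrix (Fin 2) (Fin 2) ℂ} (hS : S ∈ SU11)
    {t : ℝ} (ht : 0 < t) (hconj : S⁻¹ * ρ * S = Lambdah t ∨ S⁻¹ * ρ * S = -Lambdah t)
    (h : TameFrame f ρ e₃ R B)
    (hns : ∀ S, ∃ w ∈ leftHalfPlane S, exp w ∉ singularSet f) (θ S₀ : ℝ) :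
    ∃ w ∈ leftHalfPlane S₀, w.im = θ ∧ exp w ∈ singularSet f := by
  have h1 := h.conj (SU11.isUnit_det hS)
  rw [SU11.conjTranspose_mul_mul hS] at h1
  have h2 : TameFrame f (Lambdah t) e₃ R (fun w => S⁻¹ * B w * S) := by
    rcases hconj with hc | hc
    · rwa [hc] at h1
    · rw [hc] at h1
      exact h1.neg
  -- The eigenvectors of Λ_h(t) for exp t and exp(-t), both isotropic for e₃, so the form becomes a
  -- multiple of Re G.
  set C : Matrix (Fin 2) (Fin 2) ℂ := !![1, -1; 1, 1] with hC
  have hCu : IsUnit C.det := by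
    rw [hC, det_fin_two_of, isUnit_iff_ne_zero]; norm_num
  have h3 := h2.conj hCu
  have e1 : C⁻¹ * Lambdah t * C = !![exp (t : ℂ), 0; 0, exp (-(t : ℂ))] := by
    refine conj_eq_of_mul_eq hCu ?_
    have hp : (Real.cosh t : ℂ) + Real.sinh t = exp t := by
      rw [ofReal_cosh, ofReal_sinh, Complex.cosh_add_sinh]
    have hm : (Real.cosh t : ℂ) - Real.sinh t = exp (-t) := by
      rw [ofReal_cosh, ofReal_sinh, Complex.cosh_sub_sinh]
    ext i j
    fin_cases i <;> fin_cases j <;>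
      simp only [hC, Lambdah, Matrix.mul_apply, Fin.sum_univ_two, of_apply, cons_val',
        cons_val_zero, cons_val_one, cons_val_fin_one, Fin.zero_eta, Fin.mk_one, ← hp, ← hm] <;>
      ring
  have e2 : Cᴴ * e₃ * C = !![0, -2; -2, 0] := by
    ext i j
    fin_cases i <;> fin_cases j <;>
      simp [hC, e₃, Matrix.mul_apply, Fin.sum_univ_two, conjTranspose_apply] <;> norm_num
  rw [e1, e2] at h3
  exact h3.exists_singular_of_hyperbolic ht hns θ S₀

end

end

end CMC1Face

/-! ### The characterization of hyperbolic ends. -/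

open CMC1Face in
theorem mainTheorem9 (f : ℂ → Fin 4 → ℝ) (hf : CMC1Face.IsCMC1Face f)
    (hreg : CMC1Face.IsGRegular f) :
    CMC1Face.IsHyperbolicEnd f ↔
      ∀ θ r : ℝ, 0 < r →
        {t : ℝ | 0 < t ∧ t < r ∧
          (t : ℂ) * Complex.exp (θ * Complex.I) ∈ CMC1Face.singularSet f}.Infinite := by
  have hns : ∀ S, ∃ w ∈ leftHalfPlane S, Complex.exp w ∉ singularSet f := fun S =>
    let ⟨w, hw, _, hwn⟩ := hf.exists_not_mem_singularSet S
    ⟨w, hw, hwn⟩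
  obtain ⟨F, hF, ρ, hρ, hFρ, R, B, hB⟩ := hreg.exists_tameFrame hf.smooth
  constructor
  · rintro ⟨G, hG, ρ', hGρ', -, P, hP, t, ht, hconj⟩
    obtain ⟨Q, hQ, hGQ⟩ := hF.exists_eq_mul hG
    have hw : (-1 : ℂ) ∈ univCover := by simp [univCover]
    have hu : IsUnit (F (-1)).det := isUnit_det_of_eq_one (hF.det_eq_one _ hw)
    -- Hyperbolicity is given for some lift G, regularity for some lift F. They differ by Q ∈
    -- SU(1,1), so their monodromies are conjugate in SU(1,1).
    have hρQ : ρ * Q = Q * ρ' := by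
      have h1 := hGρ' _ hw
      rw [hGQ _ hw, hGQ _ (deck_mem.2 hw), hFρ _ hw, Matrix.mul_assoc, Matrix.mul_assoc] at h1
      have h2 := congrArg (fun A => (F (-1))⁻¹ * A) h1
      simpa only [← Matrix.mul_assoc, Matrix.nonsing_inv_mul _ hu, Matrix.one_mul] using h2
    have hS : (Q * P)⁻¹ * ρ * (Q * P) = P⁻¹ * ρ' * P := by
      rw [Matrix.mul_inv_rev, Matrix.mul_assoc, ← Matrix.mul_assoc ρ, hρQ]
      simp only [← Matrix.mul_assoc]
      rw [Matrix.mul_assoc P⁻¹, Matrix.nonsing_inv_mul _ (SU11.isUnit_det hQ), Matrix.mul_one]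
    rw [← hS] at hconj
    exact infinite_of_forall_exists
      (hB.exists_singular_of_conj_Lambdah (SU11.mul hQ hP) ht hconj hns)
  · intro hinf
    by_contra hnh
    have hnm : ¬ IsHyperbolicMatrix ρ := fun hh => hnh ⟨F, hF, ρ, hFρ, hh⟩
    obtain ⟨θ, S, hray⟩ := hB.exists_ray_of_not_hyperbolic hρ hnm hns
    exact not_forall_infinite_of_ray hray hinf
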